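/- **Conventions.** Simplicial sets are small. A map of quasi-categories is an *isofibration* if it is an inner fibration with the right lifting property against both inclusions $1\hookrightarrow\mathbb I$ of an endpoint of the nerve $\mathbb I$ of the free-standing isomorphism; a map $f\colon X\to Y$ is an *equivalence* if there are $g\colon Y\to X$ and maps $X\to X^{\mathbb I}$, $Y\to Y^{\mathbb I}$ that restrict at the two vertices of $\mathbb I$ to $(\mathrm{id}_X, gf)$ and $(fg,\mathrm{id}_Y)$. An *$\infty$-cosmos* is a simplicially enriched category $\mathcal K$ whose function complexes $\mathrm{Fun}_{\mathcal K}(A,B)$ are quasi-categories, with a specified subcategory of *isofibrations*, such that: (a) $\mathcal K$ has, as simplicially enriched limits, a terminal object $1$, small products, cotensors $A^U$ by all small simplicial sets $U$, limits of countable towers $\cdots\to E_1\to E_0$ of isofibrations, and pullbacks of isofibrations along any functor; (b) the isofibrations contain the isomorphisms and all $A\to 1$; they are stable under pullback along all functors and under small products; the limit cone of a countable tower of isofibrations consists of isofibrations; for an isofibration $p\colon E\to B$ and a monomorphism $U\hookrightarrow V$ of simplicial sets the map $E^V\to E^U\times_{B^U}B^V$ is an isofibration; and $\mathrm{Fun}_{\mathcal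 K}(X,p)$ is an isofibration of quasi-categories for every object $X$ and isofibration $p$. In a simplicially enriched category, a functor $f$ is an *equivalence* if $\mathrm{Fun}(X,f)$ is an equivalence of quasi-categories for every $X$; a *trivial fibration* is an isofibration that is an equivalence. For an object $A$ of $\mathcal K$, let $\mathcal K_{/A}$ be the simplicial category of isofibrations $p\colon E\to A$, where $\mathrm{Fun}(p,q)$ is the fibre of $\mathrm{Fun}_{\mathcal K}(E,q)\colon\mathrm{Fun}_{\mathcal K}(E,F)\to\mathrm{Fun}_{\mathcal K}(E,A)$ over $p$, and whose isofibrations are those of $\mathcal K$. Let $\mathcal K^{\mathbb 2}$ be the simplicial category of all isofibrations of $\mathcal K$, where for $p\colon E\to A$ and $q\colon F\to B$ one puts $\mathrm{Fun}(p,q)=\mathrm{Fun}_{\mathcal K}(E,F)\times_{\mathrm{Fun}_{\mathcal K}(E,B)}\mathrm{Fun}_{\mathcal K}(A,B)$, and whose isofibrations are the squares $(g\colon E\to F,\ f\colon A\to B)$ for which $f$ and the induced map $E\to A\times_BF$ are isofibrations. **Proposition.** Let $\mathcal K$ be an $\infty$-cosmos. (i) For every object $A$ of $\mathcal K$, the full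 simplicial subcategory $\mathcal K^{\simeq}_{/A}\hookrightarrow\mathcal K_{/A}$ spanned by the trivial fibrations in $\mathcal K$ is an $\infty$-cosmos, with limits, isofibrations, equivalences and trivial fibrations created by the inclusion. All functors in $\mathcal K^{\simeq}_{/A}$ are equivalences (and so are their underlying functors in $\mathcal K$). (ii) The full simplicial subcategory $\mathcal K^{\mathbb 2}_{\simeq}\hookrightarrow\mathcal K^{\mathbb 2}$ spanned by the trivial fibrations in $\mathcal K$ is an $\infty$-cosmos, with limits, isofibrations, equivalences and trivial fibrations created by the inclusion. A square $(g,f)$ in it is an equivalence if and only if $g$ and $f$ are equivalences in $\mathcal K$, and a trivial fibration if and only if $f$ and $E\to A\times_BF$ are trivial fibrations in $\mathcal K$. Here *limits are created* means, for each limit type named in (a) and each diagram of that type in the subcategory: the limit exists in the ambient simplicial category, every such limit lies in the subcategory, and it is a limit there. -/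

import Mathlib

open CategoryTheory MonoidalCategory CartesianMonoidalCategory Limits Enriched

universe v u w

namespace InfCosmos

noncomputable section

/-! ### Quasi-categories: isofibrations and equivalences -/

/-- The inclusion of a vertex into the nerve `𝕀` of the free-standing isomorphism. -/
def endpoint (x : (SSet.coherentIso.{v}).obj (Opposite.op (SimplexCategory.mk 0))) :
    𝟙_ SSet.{v} ⟶ SSet.coherentIso.{v} :=
  (SSet.unitHomEquiv _).symm x

/-- A map of simplicial sets is an isofibration (of quasi-categories) when it is an inner fibration
that has the right lifting property with respect to the inclusions `𝟙 ↪ 𝕀` of either endpoint. -/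
structure IsQCatIsofibration {X Y : SSet.{v}} (f : X ⟶ Y) : Prop where
  inner : SSet.InnerFibration f
  lift_zero : HasLiftingProperty (endpoint.{v} SSet.coherentIso.x₀) f
  lift_one : HasLiftingProperty (endpoint.{v} SSet.coherentIso.x₁) f

/-- The evaluation `X ^ 𝕀 ⟶ X` at a vertex of `𝕀`. -/
def evalAt (X : SSet.{v}) (x : (SSet.coherentIso.{v}).obj (Opposite.op (SimplexCategory.mk 0))) :
    (ihom SSet.coherentIso.{v}).obj X ⟶ X :=
  lift (toUnit _ ≫ endpoint x) (𝟙 _) ≫ (ihom.ev SSet.coherentIso.{v}).app X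

/-- A map `f : X ⟶ Y` of quasi-categories is an equivalence when there are a map `g : Y ⟶ X` and
homotopies `X ⟶ X ^ 𝕀`, from the identity to `g f`, and `Y ⟶ Y ^ 𝕀`, from `f g` to the
identity. -/
def IsQCatEquivalence {X Y : SSet.{v}} (f : X ⟶ Y) : Prop :=
  ∃ (g : Y ⟶ X) (α : X ⟶ (ihom SSet.coherentIso.{v}).obj X)
    (β : Y ⟶ (ihom SSet.coherentIso.{v}).obj Y),
    α ≫ evalAt X SSet.coherentIso.x₀ = 𝟙 X ∧ α ≫ evalAt X SSet.coherentIso.x₁ = f ≫ g ∧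
    β ≫ evalAt Y SSet.coherentIso.x₀ = g ≫ f ∧ β ≫ evalAt Y SSet.coherentIso.x₁ = 𝟙 Y

/-! ### Limits in simplicially enriched categories -/

section Simplicial

variable {C : Type u} [Category.{v} C] [SimplicialCategory C]

/-- The function complex. -/
abbrev Fun (X Y : C) : SSet.{v} := SimplicialCategory.sHom X Y

/-- Postcomposition with a functor `g : Y ⟶ Z`, as a map of function complexes. -/
abbrev Fun.post (X : C) {Y Z : C} (g : Y ⟶ Z) : Fun X Y ⟶ Fun X Z := eHomWhiskerLeft SSet.{v} X g

/-- Precomposition with a functor `f : X ⟶ Y`, as a map of function complexes. -/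
abbrev Fun.pre {X Y : C} (f : X ⟶ Y) (Z : C) : Fun Y Z ⟶ Fun X Z := eHomWhiskerRight SSet.{v} f Z

/-- The vertex of the function complex given by a functor. -/
abbrev Fun.vertex {X Y : C} (f : X ⟶ Y) : 𝟙_ SSet.{v} ⟶ Fun X Y := eHomEquiv SSet.{v} f

/-- A cone is a conical (that is, simplicially enriched) limit cone when it is a limit cone in the
underlying category and is carried to a limit cone of simplicial sets by every `Fun(X, -)`. -/
structure IsConicalLimit {J : Type w} [Category J] {F : J ⥤ C} (c : Cone F) : Prop where
  isLimit : Nonempty (IsLimit c)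
  isLimit_map : ∀ X : C, Nonempty (IsLimit ((eCoyoneda SSet.{v} X).mapCone c))

/-- The comparison `Fun(X, P) ⟶ Fun(X, A) ^ U` induced by `ε : U ⟶ Fun(P, A)`. -/
def cotensorComparison {U : SSet.{v}} {A P : C} (ε : U ⟶ Fun P A) (X : C) :
    Fun X P ⟶ (ihom U).obj (Fun X A) :=
  MonoidalClosed.curry
    (lift (snd U (Fun X P)) (fst U (Fun X P) ≫ ε) ≫ SimplicialCategory.sHomComp X P A)

/-- `ε : U ⟶ Fun(P, A)` exhibits `P` as the simplicial cotensor `A ^ U`: the induced map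
`Fun(X, P) ⟶ Fun(X, A) ^ U` is an isomorphism of simplicial sets for all `X`. -/
def IsCotensor {U : SSet.{v}} {A P : C} (ε : U ⟶ Fun P A) : Prop :=
  ∀ X : C, IsIso (cotensorComparison ε X)

/-- A simplicial cotensor `A ^ U`. -/
structure Cotensor (U : SSet.{v}) (A : C) where
  obj : C
  ε : U ⟶ Fun obj A
  isCotensor : IsCotensor ε

namespace Cotensor

variable {U V : SSet.{v}} {A B : C}

/-- Functors `X ⟶ A ^ U` correspond to maps `U ⟶ Fun(X, A)`. -/
def homEquiv (c : Cotensor U A) (X : C) : (X ⟶ c.obj) ≃ (U ⟶ Fun X A) :=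
  haveI := c.isCotensor X
  (eHomEquiv SSet.{v}).trans
    (((asIso (cotensorComparison c.ε X)).homToEquiv).trans
      ((((ihom.adjunction U).homEquiv (𝟙_ SSet.{v}) (Fun X A)).symm).trans
        ((ρ_ U).homFromEquiv)))

/-- The functor `A ^ i : A ^ V ⟶ A ^ U` for `i : U ⟶ V`. -/
def restrict (i : U ⟶ V) (c : Cotensor V A) (d : Cotensor U A) : c.obj ⟶ d.obj :=
  (d.homEquiv c.obj).symm (i ≫ c.ε)

/-- The functor `p ^ U : A ^ U ⟶ B ^ U` for `p : A ⟶ B`. -/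
def map (p : A ⟶ B) (c : Cotensor U A) (d : Cotensor U B) : c.obj ⟶ d.obj :=
  (d.homEquiv c.obj).symm (c.ε ≫ Fun.post c.obj p)

end Cotensor

/-! ### ∞-cosmoi -/

/-- A tower (a diagram indexed by `ℕᵒᵖ`) all of whose bonding maps lie in `W`. -/
def IsTower (W : MorphismProperty C) (F : ℕᵒᵖ ⥤ C) : Prop :=
  ∀ n : ℕ, W (F.map (homOfLE (Nat.le_succ n)).op)

/-- The simplicial category `C`, with the maps in `W` as isofibrations, is an ∞-cosmos. -/
structure IsInfinityCosmos (W : MorphismProperty C) : Prop where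
  quasicategory (X Y : C) : SSet.Quasicategory (Fun X Y)
  -- the isofibrations form a subcategory
  isMultiplicative : W.IsMultiplicative
  -- completeness
  hasTerminal : HasConicalTerminal SSet.{v} C
  hasProducts : HasConicalProducts.{v} SSet.{v} C
  hasCotensors (U : SSet.{v}) (A : C) : Nonempty (Cotensor U A)
  hasTowerLimits (F : ℕᵒᵖ ⥤ C) (hF : IsTower W F) : HasConicalLimit SSet.{v} F
  hasPullbacks {E B A : C} (p : E ⟶ B) (hp : W p) (f : A ⟶ B) : HasConicalPullback SSet.{v} p f
  -- isofibrations
  of_iso {A B : C} (f : A ⟶ B) (hf : IsIso f) : W f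
  to_terminal {A T : C} (hT : IsTerminal T) (f : A ⟶ T) : W f
  pullback_stable : W.IsStableUnderBaseChange
  product_stable (J : Type v) : W.IsStableUnderProductsOfShape J
  tower_stable (F : ℕᵒᵖ ⥤ C) (hF : IsTower W F) (c : Cone F) (hc : IsLimit c) (n : ℕ) :
    W (c.π.app (Opposite.op n))
  /-- The Leibniz cotensor `E ^ V ⟶ E ^ U ×_{B ^ U} B ^ V` of a monomorphism and an isofibration
  is an isofibration. -/
  leibniz {U V : SSet.{v}} (i : U ⟶ V) (hi : Mono i) {E B : C} (p : E ⟶ B) (hp : W p)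
    (EV : Cotensor V E) (EU : Cotensor U E) (BV : Cotensor V B) (BU : Cotensor U B)
    {P : C} (π₁ : P ⟶ EU.obj) (π₂ : P ⟶ BV.obj)
    (hP : IsPullback π₁ π₂ (Cotensor.map p EU BU) (Cotensor.restrict i BV BU))
    (k : EV.obj ⟶ P) (hk₁ : k ≫ π₁ = Cotensor.restrict i EV EU)
    (hk₂ : k ≫ π₂ = Cotensor.map p EV BV) : W k
  isofibration_post (X : C) {E B : C} (p : E ⟶ B) (hp : W p) : IsQCatIsofibration (Fun.post X p)

/-- `f` is an equivalence when `Fun(X, f)` is an equivalence of quasi-categories for all `X`. -/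
def IsEquivalence {A B : C} (f : A ⟶ B) : Prop :=
  ∀ X : C, IsQCatEquivalence (Fun.post X f)

/-- Trivial fibrations are the functors that are both isofibrations and equivalences. -/
def IsTrivialFibration (W : MorphismProperty C) {A B : C} (f : A ⟶ B) : Prop :=
  W f ∧ IsEquivalence f

/-! ### Creation of limits by the inclusion of a full simplicial subcategory -/

section Creation

variable (P : ObjectProperty C)

/-- The inclusion of the full subcategory on `P` creates the conical limit of `F`: the limit exists
in the ambient category, every such limit cone lifts to the subcategory (up to isomorphism), and
any lift is a limit cone there. -/
structure CreatesConicalLimit {J : Type w} [Category J] (F : J ⥤ P.FullSubcategory) : Prop where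
  exists_limit : HasConicalLimit SSet.{v} (F ⋙ P.ι)
  exists_lift (t : Cone (F ⋙ P.ι)) (ht : IsConicalLimit t) :
    ∃ s : Cone F, Nonempty (P.ι.mapCone s ≅ t)
  isLimit_of_lift (s : Cone F) (hs : IsConicalLimit (P.ι.mapCone s)) : IsConicalLimit s

/-- The inclusion of the full subcategory on `P` creates the cotensor of `A` by `U`. -/
structure CreatesCotensor (U : SSet.{v}) (A : P.FullSubcategory) : Prop where
  exists_cotensor : Nonempty (Cotensor U A.obj)
  closed {Q : C} (ε : U ⟶ Fun Q A.obj) (hε : IsCotensor ε) : P Q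
  isCotensor_of_ambient (Q : P.FullSubcategory) (ε : U ⟶ Fun Q.obj A.obj) (hε : IsCotensor ε) :
    IsCotensor (C := P.FullSubcategory) (A := A) (P := Q) ε

/-- The inclusion of the full subcategory on `P` creates the limits that are named in the axioms of
an ∞-cosmos, where a map of the subcategory is an isofibration when it is in `W`. -/
structure CreatesCosmologicalLimits (W : MorphismProperty C) : Prop where
  terminal (F : Discrete PEmpty.{1} ⥤ P.FullSubcategory) : CreatesConicalLimit P F
  products (J : Type v) (F : Discrete J ⥤ P.FullSubcategory) : CreatesConicalLimit P F
  cotensors (U : SSet.{v}) (A : P.FullSubcategory) : CreatesCotensor P U A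
  towers (F : ℕᵒᵖ ⥤ P.FullSubcategory) (hF : IsTower (W.inverseImage P.ι) F) :
    CreatesConicalLimit P F
  pullbacks {E B A : P.FullSubcategory} (p : E ⟶ B) (hp : W (P.ι.map p)) (f : A ⟶ B) :
    CreatesConicalLimit P (cospan p f)

/-- The full simplicial subcategory on `P` is an ∞-cosmos whose limits, isofibrations, equivalences
and trivial fibrations are created by the inclusion into `C`, where the isofibrations of `C` are
the maps in `W`. -/
structure IsCreatedSubcosmos (W : MorphismProperty C) : Prop where
  /-- With the created isofibrations, the full subcategory is an ∞-cosmos. -/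
  isInfinityCosmos : IsInfinityCosmos (C := P.FullSubcategory) (W.inverseImage P.ι)
  limits : CreatesCosmologicalLimits P W
  equivalences {X Y : P.FullSubcategory} (f : X ⟶ Y) :
    IsEquivalence f ↔ IsEquivalence (P.ι.map f)
  trivialFibrations {X Y : P.FullSubcategory} (f : X ⟶ Y) :
    IsTrivialFibration (W.inverseImage P.ι) f ↔ IsTrivialFibration W (P.ι.map f)

end Creation

/-! ### Slices and arrow categories as simplicial categories -/

/-- Composition of generalized elements of function complexes. -/
def Fun.comp {X Y Z : C} {S T : SSet.{v}} (a : S ⟶ Fun X Y) (b : T ⟶ Fun Y Z) :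
    S ⊗ T ⟶ Fun X Z :=
  (a ⊗ₘ b) ≫ eComp SSet.{v} X Y Z

lemma Fun.precomp_comp {X Y Z : C} {S T S' T' : SSet.{v}} (a : S ⟶ Fun X Y) (b : T ⟶ Fun Y Z)
    (s : S' ⟶ S) (t : T' ⟶ T) : (s ⊗ₘ t) ≫ Fun.comp a b = Fun.comp (s ≫ a) (t ≫ b) := by
  simp [Fun.comp]

lemma Fun.comp_post {X Y Z Z' : C} {S T : SSet.{v}} (a : S ⟶ Fun X Y) (b : T ⟶ Fun Y Z)
    (h : Z ⟶ Z') : Fun.comp a b ≫ Fun.post X h = Fun.comp a (b ≫ Fun.post Y h) := by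
  have h1 := eComp_eHomWhiskerLeft SSet.{v} X Y h
  simp only [Fun.comp, Fun.post, Category.assoc, h1, MonoidalCategory.tensorHom_def,
    MonoidalCategory.whiskerLeft_comp]

lemma Fun.comp_pre {X X' Y Z : C} {S T : SSet.{v}} (a : S ⟶ Fun X Y) (b : T ⟶ Fun Y Z)
    (h : X' ⟶ X) : Fun.comp a b ≫ Fun.pre h Z = Fun.comp (a ≫ Fun.pre h Y) b := by
  have h1 := eComp_eHomWhiskerRight SSet.{v} h Y Z
  simp only [Fun.comp, Fun.pre, Category.assoc, h1, MonoidalCategory.tensorHom_def',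
    MonoidalCategory.comp_whiskerRight]

lemma Fun.comp_middle {X Y Y' Z : C} {S T : SSet.{v}} (a : S ⟶ Fun X Y) (b : T ⟶ Fun Y' Z)
    (h : Y ⟶ Y') : Fun.comp (a ≫ Fun.post X h) b = Fun.comp a (b ≫ Fun.pre h Z) := by
  have h1 : eHomWhiskerLeft SSet.{v} X h ▷ _ ≫ eComp SSet.{v} X Y' Z =
      _ ◁ eHomWhiskerRight SSet.{v} h Z ≫ eComp SSet.{v} X Y Z := by
    simp [eHomWhiskerLeft, eHomWhiskerRight]
  have h2 : (a ≫ Fun.post X h) ⊗ₘ b = (a ⊗ₘ b) ≫ eHomWhiskerLeft SSet.{v} X h ▷ _ := by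
    rw [← tensorHom_id, tensorHom_comp_tensorHom, Category.comp_id]
  have h3 : a ⊗ₘ (b ≫ Fun.pre h Z) = (a ⊗ₘ b) ≫ _ ◁ eHomWhiskerRight SSet.{v} h Z := by
    rw [← id_tensorHom, tensorHom_comp_tensorHom, Category.comp_id]
  rw [Fun.comp, Fun.comp, h2, h3, Category.assoc, Category.assoc, h1]

lemma Fun.comp_vertex {X Y Z : C} {S : SSet.{v}} (a : S ⟶ Fun X Y) (h : Y ⟶ Z) :
    (ρ_ S).inv ≫ Fun.comp a (Fun.vertex h) = a ≫ Fun.post X h := by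
  simp [Fun.comp, Fun.post, eHomWhiskerLeft, MonoidalCategory.tensorHom_def]

lemma Fun.vertex_comp {X Y Z : C} {S : SSet.{v}} (b : S ⟶ Fun Y Z) (h : X ⟶ Y) :
    (λ_ S).inv ≫ Fun.comp (Fun.vertex h) b = b ≫ Fun.pre h Z := by
  simp [Fun.comp, Fun.pre, eHomWhiskerRight, MonoidalCategory.tensorHom_def']

lemma Fun.vertex_post {X Y Z : C} (f : X ⟶ Y) (h : Y ⟶ Z) :
    Fun.vertex f ≫ Fun.post X h = Fun.vertex (f ≫ h) := by
  rw [← Fun.comp_vertex, Fun.comp, ← unitors_inv_equal]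
  exact (eHomEquiv_comp SSet.{v} f h).symm

lemma Fun.vertex_pre {X Y Z : C} (f : X ⟶ Y) (h : Y ⟶ Z) :
    Fun.vertex h ≫ Fun.pre f Z = Fun.vertex (f ≫ h) := by
  rw [← Fun.vertex_comp, Fun.comp]
  exact (eHomEquiv_comp SSet.{v} f h).symm

lemma Fun.comp_assoc {X Y Z W : C} {S T R : SSet.{v}} (a : S ⟶ Fun X Y) (b : T ⟶ Fun Y Z)
    (c : R ⟶ Fun Z W) :
    (α_ S T R).inv ≫ Fun.comp (Fun.comp a b) c = Fun.comp a (Fun.comp b c) := by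
  have h1 := e_assoc SSet.{v} X Y Z W
  have h2 : Fun.comp (Fun.comp a b) c =
      ((a ⊗ₘ b) ⊗ₘ c) ≫ eComp SSet.{v} X Y Z ▷ _ ≫ eComp SSet.{v} X Z W := by
    rw [Fun.comp, Fun.comp, ← tensorHom_id, tensorHom_comp_tensorHom_assoc, Category.comp_id]
  have h3 : Fun.comp a (Fun.comp b c) =
      (a ⊗ₘ (b ⊗ₘ c)) ≫ _ ◁ eComp SSet.{v} Y Z W ≫ eComp SSet.{v} X Y W := by
    rw [Fun.comp, Fun.comp, ← id_tensorHom, tensorHom_comp_tensorHom_assoc, Category.comp_id]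
  rw [h2, h3, ← h1]
  simp

section Over

variable {A : C}

/-- `Fun_{/A}(p, q)`: the fibre of `Fun(E, q) : Fun(E, F) ⟶ Fun(E, A)` over the vertex `p`. -/
def overFun (p q : Over A) : SSet.{v} :=
  pullback (Fun.post p.left q.hom) (Fun.vertex p.hom)

/-- The forgetful map `Fun_{/A}(p, q) ⟶ Fun(E, F)`. -/
def overFun.fst (p q : Over A) : overFun p q ⟶ Fun p.left q.left :=
  pullback.fst _ _

lemma overFun.condition (p q : Over A) :
    overFun.fst p q ≫ Fun.post p.left q.hom = toUnit _ ≫ Fun.vertex p.hom := by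
  have h : pullback.snd (Fun.post p.left q.hom) (Fun.vertex p.hom) = toUnit _ :=
    toUnit_unique _ _
  exact pullback.condition.trans (congrArg (fun t => t ≫ Fun.vertex p.hom) h)

/-- The universal property of `Fun_{/A}(p, q)`. -/
def overFun.lift {p q : Over A} {T : SSet.{v}} (f : T ⟶ Fun p.left q.left)
    (hf : f ≫ Fun.post p.left q.hom = toUnit _ ≫ Fun.vertex p.hom) : T ⟶ overFun p q :=
  pullback.lift f (toUnit _) hf

lemma overFun.lift_fst {p q : Over A} {T : SSet.{v}} (f : T ⟶ Fun p.left q.left)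
    (hf : f ≫ Fun.post p.left q.hom = toUnit _ ≫ Fun.vertex p.hom) :
    overFun.lift f hf ≫ overFun.fst p q = f :=
  pullback.lift_fst _ _ _

lemma overFun.hom_ext {p q : Over A} {T : SSet.{v}} {f g : T ⟶ overFun p q}
    (h : f ≫ overFun.fst p q = g ≫ overFun.fst p q) : f = g :=
  pullback.hom_ext h (toUnit_unique _ _)

/-- Composition in the slice. -/
def overFun.comp (p q r : Over A) : overFun p q ⊗ overFun q r ⟶ overFun p r :=
  overFun.lift (Fun.comp (overFun.fst p q) (overFun.fst q r)) (by
    have h : Fun.comp (overFun.fst p q) (toUnit (overFun q r) ≫ Fun.vertex q.hom) =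
        (overFun p q ◁ toUnit (overFun q r)) ≫ (ρ_ _).hom ≫ (ρ_ _).inv ≫
          Fun.comp (overFun.fst p q) (Fun.vertex q.hom) := by
      rw [Iso.hom_inv_id_assoc, ← id_tensorHom, Fun.precomp_comp, Category.id_comp]
    rw [Fun.comp_post, overFun.condition, h, Fun.comp_vertex, overFun.condition]
    simp only [← Category.assoc]
    congr 1)

lemma overFun.comp_fst (p q r : Over A) : overFun.comp p q r ≫ overFun.fst p r =
    Fun.comp (overFun.fst p q) (overFun.fst q r) :=
  overFun.lift_fst _ _

/-- The vertex of `Fun_{/A}(p, q)` given by a functor over `A`. -/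
def overFun.vertex {p q : Over A} (f : p ⟶ q) : 𝟙_ SSet.{v} ⟶ overFun p q :=
  overFun.lift (Fun.vertex f.left) (by
    rw [Fun.vertex_post, Over.w, toUnit_unique (toUnit (𝟙_ SSet.{v})) (𝟙 _), Category.id_comp])

lemma overFun.vertex_fst {p q : Over A} (f : p ⟶ q) :
    overFun.vertex f ≫ overFun.fst p q = Fun.vertex f.left :=
  overFun.lift_fst _ _

lemma overFun.vertex_comp {p q r : Over A} (f : p ⟶ q) (g : q ⟶ r) :
    overFun.vertex (f ≫ g) =
      (λ_ (𝟙_ SSet.{v})).inv ≫ (overFun.vertex f ⊗ₘ overFun.vertex g) ≫ overFun.comp p q r := by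
  apply overFun.hom_ext
  · rw [Category.assoc, Category.assoc, overFun.comp_fst, Fun.precomp_comp, overFun.vertex_fst,
      overFun.vertex_fst, overFun.vertex_fst]
    exact eHomEquiv_comp SSet.{v} f.left g.left

lemma overFun.vertex_bijective (p q : Over A) :
    Function.Bijective (overFun.vertex : (p ⟶ q) → _) := by
  refine ⟨fun f g h => ?_, fun g => ?_⟩
  · ext
    apply (eHomEquiv SSet.{v}).injective
    have := congrArg (fun t => t ≫ overFun.fst p q) h
    simpa only [overFun.vertex_fst] using this
  · refine ⟨Over.homMk ((eHomEquiv SSet.{v}).symm (g ≫ overFun.fst p q)) ?_, ?_⟩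
    · apply (eHomEquiv SSet.{v}).injective
      have h1 := Fun.vertex_post ((eHomEquiv SSet.{v}).symm (g ≫ overFun.fst p q)) q.hom
      rw [Fun.vertex, Equiv.apply_symm_apply, Category.assoc, overFun.condition,
        ← Category.assoc, toUnit_unique (g ≫ toUnit _) (𝟙 _), Category.id_comp] at h1
      exact h1.symm
    · apply overFun.hom_ext
      rw [overFun.vertex_fst]
      simp

/-- The slice of a simplicial category over an object, as a simplicial category. -/
instance overSimplicialCategory (A : C) : SimplicialCategory (Over A) where
  Hom p q := overFun p q
  id p := overFun.vertex (𝟙 p)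
  comp p q r := overFun.comp p q r
  id_comp p q := by
    apply overFun.hom_ext
    rw [Category.assoc, Category.assoc, overFun.comp_fst, ← tensorHom_id, Fun.precomp_comp,
      overFun.vertex_fst, Category.id_comp, Fun.vertex_comp]
    simp
  comp_id p q := by
    apply overFun.hom_ext
    rw [Category.assoc, Category.assoc, overFun.comp_fst, ← id_tensorHom, Fun.precomp_comp,
      overFun.vertex_fst, Category.id_comp, Fun.comp_vertex]
    simp
  assoc p q r s := by
    apply overFun.hom_ext
    simp only [Category.assoc, overFun.comp_fst]
    rw [← tensorHom_id, ← id_tensorHom, Fun.precomp_comp, Fun.precomp_comp, overFun.comp_fst,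
      overFun.comp_fst, Category.id_comp, Category.id_comp, Fun.comp_assoc]
  homEquiv {p q} := Equiv.ofBijective _ (overFun.vertex_bijective p q)
  homEquiv_id p := rfl
  homEquiv_comp f g := overFun.vertex_comp f g

end Over

section Arrow

/-- `Fun(p, q)` for arrows `p : E ⟶ A` and `q : F ⟶ B`: the pullback of
`Fun(E, q) : Fun(E, F) ⟶ Fun(E, B)` and `Fun(p, B) : Fun(A, B) ⟶ Fun(E, B)`. -/
def arrowFun (p q : Arrow C) : SSet.{v} :=
  pullback (Fun.post p.left q.hom) (Fun.pre p.hom q.right)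

/-- The domain projection `Fun(p, q) ⟶ Fun(E, F)`. -/
def arrowFun.fst (p q : Arrow C) : arrowFun p q ⟶ Fun p.left q.left :=
  pullback.fst _ _

/-- The codomain projection `Fun(p, q) ⟶ Fun(A, B)`. -/
def arrowFun.snd (p q : Arrow C) : arrowFun p q ⟶ Fun p.right q.right :=
  pullback.snd _ _

lemma arrowFun.condition (p q : Arrow C) :
    arrowFun.fst p q ≫ Fun.post p.left q.hom = arrowFun.snd p q ≫ Fun.pre p.hom q.right :=
  pullback.condition

/-- The universal property of `Fun(p, q)`. -/
def arrowFun.lift {p q : Arrow C} {T : SSet.{v}} (f : T ⟶ Fun p.left q.left)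
    (g : T ⟶ Fun p.right q.right)
    (h : f ≫ Fun.post p.left q.hom = g ≫ Fun.pre p.hom q.right) : T ⟶ arrowFun p q :=
  pullback.lift f g h

lemma arrowFun.lift_fst {p q : Arrow C} {T : SSet.{v}} (f : T ⟶ Fun p.left q.left)
    (g : T ⟶ Fun p.right q.right)
    (h : f ≫ Fun.post p.left q.hom = g ≫ Fun.pre p.hom q.right) :
    arrowFun.lift f g h ≫ arrowFun.fst p q = f :=
  pullback.lift_fst _ _ _

lemma arrowFun.lift_snd {p q : Arrow C} {T : SSet.{v}} (f : T ⟶ Fun p.left q.left)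
    (g : T ⟶ Fun p.right q.right)
    (h : f ≫ Fun.post p.left q.hom = g ≫ Fun.pre p.hom q.right) :
    arrowFun.lift f g h ≫ arrowFun.snd p q = g :=
  pullback.lift_snd _ _ _

lemma arrowFun.hom_ext {p q : Arrow C} {T : SSet.{v}} {f g : T ⟶ arrowFun p q}
    (h₁ : f ≫ arrowFun.fst p q = g ≫ arrowFun.fst p q)
    (h₂ : f ≫ arrowFun.snd p q = g ≫ arrowFun.snd p q) : f = g :=
  pullback.hom_ext h₁ h₂

/-- Composition of squares. -/
def arrowFun.comp (p q r : Arrow C) : arrowFun p q ⊗ arrowFun q r ⟶ arrowFun p r :=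
  arrowFun.lift (Fun.comp (arrowFun.fst p q) (arrowFun.fst q r))
    (Fun.comp (arrowFun.snd p q) (arrowFun.snd q r)) (by
    rw [Fun.comp_post, arrowFun.condition, ← Fun.comp_middle, arrowFun.condition, Fun.comp_pre])

lemma arrowFun.comp_fst (p q r : Arrow C) : arrowFun.comp p q r ≫ arrowFun.fst p r =
    Fun.comp (arrowFun.fst p q) (arrowFun.fst q r) :=
  arrowFun.lift_fst _ _ _

lemma arrowFun.comp_snd (p q r : Arrow C) : arrowFun.comp p q r ≫ arrowFun.snd p r =
    Fun.comp (arrowFun.snd p q) (arrowFun.snd q r) :=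
  arrowFun.lift_snd _ _ _

/-- The vertex of `Fun(p, q)` given by a commutative square. -/
def arrowFun.vertex {p q : Arrow C} (f : p ⟶ q) : 𝟙_ SSet.{v} ⟶ arrowFun p q :=
  arrowFun.lift (Fun.vertex f.left) (Fun.vertex f.right) (by
    rw [Fun.vertex_post, Fun.vertex_pre, Arrow.w])

lemma arrowFun.vertex_fst {p q : Arrow C} (f : p ⟶ q) :
    arrowFun.vertex f ≫ arrowFun.fst p q = Fun.vertex f.left :=
  arrowFun.lift_fst _ _ _

lemma arrowFun.vertex_snd {p q : Arrow C} (f : p ⟶ q) :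
    arrowFun.vertex f ≫ arrowFun.snd p q = Fun.vertex f.right :=
  arrowFun.lift_snd _ _ _

lemma arrowFun.vertex_comp {p q r : Arrow C} (f : p ⟶ q) (g : q ⟶ r) :
    arrowFun.vertex (f ≫ g) =
      (λ_ (𝟙_ SSet.{v})).inv ≫ (arrowFun.vertex f ⊗ₘ arrowFun.vertex g) ≫ arrowFun.comp p q r := by
  apply arrowFun.hom_ext
  · rw [Category.assoc, Category.assoc, arrowFun.comp_fst, Fun.precomp_comp, arrowFun.vertex_fst,
      arrowFun.vertex_fst, arrowFun.vertex_fst]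
    exact eHomEquiv_comp SSet.{v} f.left g.left
  · rw [Category.assoc, Category.assoc, arrowFun.comp_snd, Fun.precomp_comp, arrowFun.vertex_snd,
      arrowFun.vertex_snd, arrowFun.vertex_snd]
    exact eHomEquiv_comp SSet.{v} f.right g.right

lemma arrowFun.vertex_bijective (p q : Arrow C) :
    Function.Bijective (arrowFun.vertex : (p ⟶ q) → _) := by
  refine ⟨fun f g h => ?_, fun g => ?_⟩
  · ext
    · apply (eHomEquiv SSet.{v}).injective
      have := congrArg (fun t => t ≫ arrowFun.fst p q) h
      simpa only [arrowFun.vertex_fst] using this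
    · apply (eHomEquiv SSet.{v}).injective
      have := congrArg (fun t => t ≫ arrowFun.snd p q) h
      simpa only [arrowFun.vertex_snd] using this
  · refine ⟨Arrow.homMk ((eHomEquiv SSet.{v}).symm (g ≫ arrowFun.fst p q))
      ((eHomEquiv SSet.{v}).symm (g ≫ arrowFun.snd p q)) ?_, ?_⟩
    · apply (eHomEquiv SSet.{v}).injective
      have h1 := Fun.vertex_post ((eHomEquiv SSet.{v}).symm (g ≫ arrowFun.fst p q)) q.hom
      have h2 := Fun.vertex_pre p.hom ((eHomEquiv SSet.{v}).symm (g ≫ arrowFun.snd p q))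
      rw [Fun.vertex, Equiv.apply_symm_apply, Category.assoc] at h1 h2
      exact h1.symm.trans (.trans (by rw [arrowFun.condition]) h2)
    · apply arrowFun.hom_ext
      · rw [arrowFun.vertex_fst]
        simp
      · rw [arrowFun.vertex_snd]
        simp

/-- The category of arrows and commutative squares of a simplicial category, as a simplicial
category. -/
instance arrowSimplicialCategory : SimplicialCategory (Arrow C) where
  Hom p q := arrowFun p q
  id p := arrowFun.vertex (𝟙 p)
  comp p q r := arrowFun.comp p q r
  id_comp p q := by
    apply arrowFun.hom_ext
    · rw [Category.assoc, Category.assoc, arrowFun.comp_fst, ← tensorHom_id, Fun.precomp_comp,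
        arrowFun.vertex_fst, Category.id_comp, Fun.vertex_comp]
      simp
    · rw [Category.assoc, Category.assoc, arrowFun.comp_snd, ← tensorHom_id, Fun.precomp_comp,
        arrowFun.vertex_snd, Category.id_comp, Fun.vertex_comp]
      simp
  comp_id p q := by
    apply arrowFun.hom_ext
    · rw [Category.assoc, Category.assoc, arrowFun.comp_fst, ← id_tensorHom, Fun.precomp_comp,
        arrowFun.vertex_fst, Category.id_comp, Fun.comp_vertex]
      simp
    · rw [Category.assoc, Category.assoc, arrowFun.comp_snd, ← id_tensorHom, Fun.precomp_comp,
        arrowFun.vertex_snd, Category.id_comp, Fun.comp_vertex]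
      simp
  assoc p q r s := by
    apply arrowFun.hom_ext
    · simp only [Category.assoc, arrowFun.comp_fst]
      rw [← tensorHom_id, ← id_tensorHom, Fun.precomp_comp, Fun.precomp_comp, arrowFun.comp_fst,
        arrowFun.comp_fst, Category.id_comp, Category.id_comp, Fun.comp_assoc]
    · simp only [Category.assoc, arrowFun.comp_snd]
      rw [← tensorHom_id, ← id_tensorHom, Fun.precomp_comp, Fun.precomp_comp, arrowFun.comp_snd,
        arrowFun.comp_snd, Category.id_comp, Category.id_comp, Fun.comp_assoc]
  homEquiv {p q} := Equiv.ofBijective _ (arrowFun.vertex_bijective p q)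
  homEquiv_id p := rfl
  homEquiv_comp f g := arrowFun.vertex_comp f g

end Arrow

/-! ### The ∞-cosmoi of isofibrations and their subcategories of trivial fibrations -/

section Cosmoi

variable (W : MorphismProperty C)

/-- The class of trivial fibrations. -/
def trivialFibrations : MorphismProperty C := fun _ _ f => IsTrivialFibration W f

/-- The slice `K_{/A}`: the full simplicial subcategory of `Over A` on the isofibrations. -/
abbrev Slice (A : C) := ObjectProperty.FullSubcategory (C := Over A) fun p => W p.hom

/-- The forgetful functor `K_{/A} ⥤ K`. -/
abbrev Slice.forget (A : C) : Slice W A ⥤ C :=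
  ObjectProperty.ι (fun p : Over A => W p.hom) ⋙ Over.forget A

/-- The isofibrations of `K_{/A}` are created by the forgetful functor. -/
def sliceIsofibrations (A : C) : MorphismProperty (Slice W A) :=
  W.inverseImage (Slice.forget W A)

/-- The objects of `K_{/A}` that are trivial fibrations. -/
def sliceTrivial (A : C) : ObjectProperty (Slice W A) :=
  fun p => IsTrivialFibration W p.obj.hom

/-- The full simplicial subcategory `K^≃_{/A}` of `K_{/A}` on the trivial fibrations. -/
abbrev TrivialSlice (A : C) := (sliceTrivial W A).FullSubcategory

/-- The squares from `p : E ⟶ A` to `q : F ⟶ B`, with components `g : E ⟶ F` and `f : A ⟶ B`, for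
which `f` and the induced map `E ⟶ A ×_B F` lie in `R`. -/
def squaresIn (R : MorphismProperty C) : MorphismProperty (Arrow C) := fun p q s =>
  R s.right ∧ ∃ (P : C) (π₁ : P ⟶ p.right) (π₂ : P ⟶ q.left) (k : p.left ⟶ P),
    IsPullback π₁ π₂ s.right q.hom ∧ k ≫ π₁ = p.hom ∧ k ≫ π₂ = s.left ∧ R k

/-- The simplicial category `K^𝟚`: the full simplicial subcategory of the category of arrows on the
isofibrations. -/
abbrev IsofibArrow := ObjectProperty.FullSubcategory (C := Arrow C) fun p => W p.hom

/-- The inclusion of `K^𝟚` into the category of all arrows. -/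
abbrev IsofibArrow.ι : IsofibArrow W ⥤ Arrow C := ObjectProperty.ι (fun p : Arrow C => W p.hom)

/-- The isofibrations of `K^𝟚`. -/
def arrowIsofibrations : MorphismProperty (IsofibArrow W) :=
  (squaresIn W).inverseImage (IsofibArrow.ι W)

/-- The objects of `K^𝟚` that are trivial fibrations. -/
def arrowTrivial : ObjectProperty (IsofibArrow W) :=
  fun p => IsTrivialFibration W p.obj.hom

/-- The full simplicial subcategory `K^𝟚_≃` of `K^𝟚` on the trivial fibrations. -/
abbrev TrivialArrow := (arrowTrivial W).FullSubcategory

end Cosmoi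

end Simplicial

end

end InfCosmos

/-! Everything rests on one characterization, `isTrivialFibration_iff`: an isofibration p of an
∞-cosmos is a trivial fibration exactly when every Fun(X, p) is a trivial Kan fibration, that is,
lifts against all monomorphisms. Once equivalences are replaced by a lifting property, trivial
fibrations are visibly stable under base change, products, limits of towers and cotensors.

For the characterization, the Leibniz cotensor axiom upgrades the lifting of Fun(X, p) against the
endpoints of 𝕀 to lifting against the Leibniz products of these endpoints with arbitrary
monomorphisms (`hasIsoLift`). Homotopies along 𝕀 can then be lifted and pasted. An inverse
equivalence is deformed into a strict section, the homotopy from the identity is made constant over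
the base, and transporting along it produces the lifts (`trivKan_of_equivalence`). The same
homotopies give two out of three for equivalences.

The ambient simplicial categories must themselves be shown to be ∞-cosmoi (`slice` and `arrow`). In
a slice over A, a limit is the limit of the total objects pulled back along the diagonal from A into
the limit of the constant diagram at A, and the maps named in the axioms are base changes of the
corresponding maps of K. In K^𝟚, limits are computed on domains and codomains. The isofibrations are
controlled by gap maps E ⟶ A ×_B F, and composition, base change, products, towers, cotensors and
Leibniz cotensors all have gap maps built from the given ones.

By `fullSubcategory` and `createsCosmologicalLimits`, it then remains to show that trivial
fibrations are closed under the limits in the axioms. Over a fixed A, each Fun_{/A}(X, p) is a fibre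
of a trivial Kan fibration, hence contractible, so all functors are equivalences. For squares, the
gap map of an isofibration between trivial fibrations is a trivial fibration by two out of three, so
the closure arguments can be repeated with trivial fibrations instead of isofibrations. Projection
to codomains, Fun(X, p) ⟶ Fun(cod X, cod p), is a trivial Kan fibration when p is a trivial
fibration. Equivalences are therefore detected on codomains, by testing at identity arrows, and two
out of three transfers them to domains. -/

namespace InfCosmos

noncomputable section

open Opposite

/-! ### Homotopies along the free-standing isomorphism -/

/-- The free-standing isomorphism, as a simplicial set. -/
abbrev Iso𝕀 : SSet.{v} := SSet.coherentIso.{v}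

/-- The vertices of the free-standing isomorphism. -/
abbrev Iso𝕀.Vertex : Type v := (SSet.coherentIso.{v}).obj (op (SimplexCategory.mk 0))

/-- The inclusion of `T` into `𝕀 ⊗ T` at a vertex of `𝕀`. -/
def atVertex (x : Iso𝕀.Vertex.{v}) (T : SSet.{v}) : T ⟶ Iso𝕀.{v} ⊗ T :=
  lift (toUnit T ≫ endpoint x) (𝟙 T)

@[simp]
lemma atVertex_snd (x : Iso𝕀.Vertex.{v}) (T : SSet.{v}) : atVertex x T ≫ snd _ _ = 𝟙 T :=
  lift_snd _ _

@[simp]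
lemma atVertex_snd_assoc (x : Iso𝕀.Vertex.{v}) (T : SSet.{v}) {Z' : SSet.{v}} (h : T ⟶ Z') :
    atVertex x T ≫ snd _ _ ≫ h = h :=
  (reassoc_of% (atVertex_snd x T)) h

lemma atVertex_naturality (x : Iso𝕀.Vertex.{v}) {S T : SSet.{v}} (f : S ⟶ T) :
    f ≫ atVertex x T = atVertex x S ≫ Iso𝕀.{v} ◁ f := by
  simp [atVertex]

lemma atVertex_naturality_assoc (x : Iso𝕀.Vertex.{v}) {S T : SSet.{v}} (f : S ⟶ T) {Z' : SSet.{v}} (h : Iso𝕀.{v} ⊗ T ⟶ Z') :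
    f ≫ atVertex x T ≫ h = atVertex x S ≫ Iso𝕀.{v} ◁ f ≫ h :=
  (reassoc_of% (atVertex_naturality x f)) h

/-- Used to trade maps into Z ^ 𝕀 for maps out of 𝕀 ⊗ T, where lifting problems can be posed. -/
lemma curry_evalAt (x : Iso𝕀.Vertex.{v}) {T Z : SSet.{v}} (H : Iso𝕀.{v} ⊗ T ⟶ Z) :
    MonoidalClosed.curry H ≫ evalAt Z x = atVertex x T ≫ H := by
  have h : MonoidalClosed.curry H ≫ evalAt Z x =
      atVertex x T ≫ Iso𝕀.{v} ◁ MonoidalClosed.curry H ≫ (ihom.ev _).app Z := by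
    rw [← atVertex_naturality_assoc]
    rfl
  rw [h, ← MonoidalClosed.uncurry_eq, MonoidalClosed.uncurry_curry]

/-- The class of trivial Kan fibrations: the right lifting property against monomorphisms. -/
abbrev TrivKan : MorphismProperty SSet.{v} := (MorphismProperty.monomorphisms SSet.{v}).rlp

/-- The right lifting property against the Leibniz products of monomorphisms with the inclusions
of the endpoints of `𝕀`. -/
def HasIsoLift {X Y : SSet.{v}} (p : X ⟶ Y) : Prop :=
  ∀ (x : Iso𝕀.Vertex.{v}), (x = SSet.coherentIso.x₀ ∨ x = SSet.coherentIso.x₁) →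
    ∀ {U V : SSet.{v}} (i : U ⟶ V) (_ : Mono i) (a : Iso𝕀.{v} ⊗ U ⟶ X) (b : V ⟶ X)
      (w : Iso𝕀.{v} ⊗ V ⟶ Y), atVertex x U ≫ a = i ≫ b → a ≫ p = Iso𝕀.{v} ◁ i ≫ w →
      b ≫ p = atVertex x V ≫ w →
      ∃ l : Iso𝕀.{v} ⊗ V ⟶ X, Iso𝕀.{v} ◁ i ≫ l = a ∧ atVertex x V ≫ l = b ∧ l ≫ p = w

/-- Simplicial sets with the extension property against the Leibniz products of monomorphisms with
the inclusions of the endpoints of `𝕀`. -/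
def IsoFibrant (X : SSet.{v}) : Prop := HasIsoLift (toUnit X)

/-- Homotopy of maps of simplicial sets along the free-standing isomorphism. -/
def Htpy {T Z : SSet.{v}} (f g : T ⟶ Z) : Prop :=
  ∃ H : Iso𝕀.{v} ⊗ T ⟶ Z, atVertex SSet.coherentIso.x₀ T ≫ H = f ∧
    atVertex SSet.coherentIso.x₁ T ≫ H = g

lemma isQCatEquivalence_iff {X Y : SSet.{v}} (f : X ⟶ Y) :
    IsQCatEquivalence f ↔ ∃ g : Y ⟶ X, Htpy (𝟙 X) (f ≫ g) ∧ Htpy (g ≫ f) (𝟙 Y) := by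
  constructor
  · rintro ⟨g, α, β, h₁, h₂, h₃, h₄⟩
    refine ⟨g, ⟨MonoidalClosed.uncurry α, ?_, ?_⟩, ⟨MonoidalClosed.uncurry β, ?_, ?_⟩⟩ <;>
    simpa only [← curry_evalAt, MonoidalClosed.curry_uncurry]
  · rintro ⟨g, ⟨H, h₁, h₂⟩, ⟨K, h₃, h₄⟩⟩
    exact ⟨g, MonoidalClosed.curry H, MonoidalClosed.curry K, by
      simpa only [curry_evalAt] using ⟨h₁, h₂, h₃, h₄⟩⟩

lemma Htpy.refl {T Z : SSet.{v}} (f : T ⟶ Z) : Htpy f f :=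
  ⟨snd _ _ ≫ f, by simp, by simp⟩

lemma Htpy.pre {S T Z : SSet.{v}} {f g : T ⟶ Z} (h : Htpy f g) (k : S ⟶ T) :
    Htpy (k ≫ f) (k ≫ g) := by
  obtain ⟨H, rfl, rfl⟩ := h
  exact ⟨Iso𝕀.{v} ◁ k ≫ H, by rw [atVertex_naturality_assoc], by rw [atVertex_naturality_assoc]⟩

lemma Htpy.post {T Z Z' : SSet.{v}} {f g : T ⟶ Z} (h : Htpy f g) (k : Z ⟶ Z') :
    Htpy (f ≫ k) (g ≫ k) := by
  obtain ⟨H, rfl, rfl⟩ := h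
  exact ⟨H ≫ k, by simp, by simp⟩

/-- The map `𝕀 ⊗ 𝕀 ⟶ 𝕀` given by a function of vertices. -/
def Iso𝕀.map₂ (φ : Bool → Bool → Bool) : Iso𝕀.{v} ⊗ Iso𝕀.{v} ⟶ Iso𝕀.{v} where
  app n := ↾fun z => Codiscrete.equivFun.symm fun k =>
    ⟨φ (Codiscrete.equivFun z.1 k).down (Codiscrete.equivFun z.2 k).down⟩

/-- Simplices of 𝕀 are arbitrary words in two letters, so an equation of maps into 𝕀 is checked
letter by letter. -/
lemma Iso𝕀.hom_ext {T : SSet.{v}} {f g : T ⟶ Iso𝕀.{v}}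
    (h : ∀ n (t : T.obj n) k,
      (Codiscrete.equivFun (f.app n t) k).down = (Codiscrete.equivFun (g.app n t) k).down) :
    f = g := by
  apply SSet.hom_ext
  intro n
  apply ConcreteCategory.hom_ext
  intro t
  exact Codiscrete.equivFun.injective (funext fun k => ULift.ext _ _ (h n t k))

lemma Iso𝕀.const_zero {T : SSet.{v}} (n) (t : T.obj n) (k) :
    (Codiscrete.equivFun ((toUnit T ≫ endpoint SSet.coherentIso.x₀).app n t) k).down = false :=
  rfl

lemma Iso𝕀.const_one {T : SSet.{v}} (n) (t : T.obj n) (k) :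
    (Codiscrete.equivFun ((toUnit T ≫ endpoint SSet.coherentIso.x₁).app n t) k).down = true :=
  rfl

lemma Iso𝕀.lift_map₂ {T : SSet.{v}} (φ : Bool → Bool → Bool) (f g : T ⟶ Iso𝕀.{v}) (n)
    (t : T.obj n) (k) :
    (Codiscrete.equivFun ((lift f g ≫ Iso𝕀.map₂ φ).app n t) k).down =
      φ (Codiscrete.equivFun (f.app n t) k).down (Codiscrete.equivFun (g.app n t) k).down :=
  rfl

/-- The deformation of `𝕀 ⊗ T` given by `(s, t) ↦ t ∧ ¬ s` on the vertices of `𝕀`. -/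
def Iso𝕀.fold (T : SSet.{v}) : Iso𝕀.{v} ⊗ (Iso𝕀.{v} ⊗ T) ⟶ Iso𝕀.{v} ⊗ T :=
  lift (lift (fst _ _) (snd _ _ ≫ fst _ _) ≫ Iso𝕀.map₂ fun s t => t && !s) (snd _ _ ≫ snd _ _)

/-- The reversal of `𝕀 ⊗ T`. -/
def Iso𝕀.rev (T : SSet.{v}) : Iso𝕀.{v} ⊗ T ⟶ Iso𝕀.{v} ⊗ T :=
  lift (lift (fst _ _) (fst _ _) ≫ Iso𝕀.map₂ fun s _ => !s) (snd _ _)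

@[simp]
lemma Iso𝕀.zero_rev (T : SSet.{v}) : atVertex SSet.coherentIso.x₀ T ≫ Iso𝕀.rev T =
    atVertex SSet.coherentIso.x₁ T := by
  simp only [atVertex, Iso𝕀.rev, comp_lift, comp_lift_assoc, lift_fst, lift_snd]
  congr 1

@[simp]
lemma Iso𝕀.zero_rev_assoc (T : SSet.{v}) {Z' : SSet.{v}} (h : Iso𝕀.{v} ⊗ T ⟶ Z') :
    atVertex SSet.coherentIso.x₀ T ≫ Iso𝕀.rev T ≫ h = atVertex SSet.coherentIso.x₁ T ≫ h :=
  (reassoc_of% (Iso𝕀.zero_rev T)) h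

@[simp]
lemma Iso𝕀.one_rev (T : SSet.{v}) : atVertex SSet.coherentIso.x₁ T ≫ Iso𝕀.rev T =
    atVertex SSet.coherentIso.x₀ T := by
  simp only [atVertex, Iso𝕀.rev, comp_lift, comp_lift_assoc, lift_fst, lift_snd]
  congr 1

@[simp]
lemma Iso𝕀.one_rev_assoc (T : SSet.{v}) {Z' : SSet.{v}} (h : Iso𝕀.{v} ⊗ T ⟶ Z') :
    atVertex SSet.coherentIso.x₁ T ≫ Iso𝕀.rev T ≫ h = atVertex SSet.coherentIso.x₀ T ≫ h :=
  (reassoc_of% (Iso𝕀.one_rev T)) h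

-- The identities for `fold` are the four sides of the square (s, t) ↦ t ∧ ¬ s: the identity at s =
-- 0, the constant 0 at s = 1, the constant 0 at t = 0, and the reversal at t = 1.
@[simp]
lemma Iso𝕀.zero_fold (T : SSet.{v}) :
    atVertex SSet.coherentIso.x₀ (Iso𝕀.{v} ⊗ T) ≫ Iso𝕀.fold T = 𝟙 _ := by
  apply CartesianMonoidalCategory.hom_ext
  · simp only [atVertex, Iso𝕀.fold, comp_lift, comp_lift_assoc, lift_fst, lift_snd_assoc]
    apply Iso𝕀.hom_ext
    intro n t k
    rw [Iso𝕀.lift_map₂, Iso𝕀.const_zero]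
    simp
  · simp [atVertex, Iso𝕀.fold]

@[simp]
lemma Iso𝕀.zero_fold_assoc (T : SSet.{v}) {Z' : SSet.{v}} (h : Iso𝕀.{v} ⊗ T ⟶ Z') :
    atVertex SSet.coherentIso.x₀ (Iso𝕀.{v} ⊗ T) ≫ Iso𝕀.fold T ≫ h = h :=
  (reassoc_of% (Iso𝕀.zero_fold T)) h

@[simp]
lemma Iso𝕀.one_fold (T : SSet.{v}) : atVertex SSet.coherentIso.x₁ (Iso𝕀.{v} ⊗ T) ≫ Iso𝕀.fold T =
    snd _ _ ≫ atVertex SSet.coherentIso.x₀ T := by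
  apply CartesianMonoidalCategory.hom_ext
  · simp only [atVertex, Iso𝕀.fold, comp_lift, comp_lift_assoc, lift_fst, lift_snd_assoc]
    apply Iso𝕀.hom_ext
    intro n t k
    rw [Iso𝕀.lift_map₂, Iso𝕀.const_one]
    simp
    rfl
  · simp [atVertex, Iso𝕀.fold]

@[simp]
lemma Iso𝕀.one_fold_assoc (T : SSet.{v}) {Z' : SSet.{v}} (h : Iso𝕀.{v} ⊗ T ⟶ Z') :
    atVertex SSet.coherentIso.x₁ (Iso𝕀.{v} ⊗ T) ≫ Iso𝕀.fold T ≫ h = snd _ _ ≫ atVertex SSet.coherentIso.x₀ T ≫ h :=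
  (reassoc_of% (Iso𝕀.one_fold T)) h

@[simp]
lemma Iso𝕀.fold_zero (T : SSet.{v}) : Iso𝕀.{v} ◁ atVertex SSet.coherentIso.x₀ T ≫ Iso𝕀.fold T =
    snd _ _ ≫ atVertex SSet.coherentIso.x₀ T := by
  apply CartesianMonoidalCategory.hom_ext
  · simp only [atVertex, Iso𝕀.fold, comp_lift, comp_lift_assoc, lift_fst, lift_snd,
      whiskerLeft_fst, whiskerLeft_snd_assoc]
    apply Iso𝕀.hom_ext
    intro n t k
    rw [Iso𝕀.lift_map₂]
    rfl
  · simp [atVertex, Iso𝕀.fold]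

@[simp]
lemma Iso𝕀.fold_zero_assoc (T : SSet.{v}) {Z' : SSet.{v}} (h : Iso𝕀.{v} ⊗ T ⟶ Z') :
    Iso𝕀.{v} ◁ atVertex SSet.coherentIso.x₀ T ≫ Iso𝕀.fold T ≫ h = snd _ _ ≫ atVertex SSet.coherentIso.x₀ T ≫ h :=
  (reassoc_of% (Iso𝕀.fold_zero T)) h

@[simp]
lemma Iso𝕀.fold_one (T : SSet.{v}) : Iso𝕀.{v} ◁ atVertex SSet.coherentIso.x₁ T ≫ Iso𝕀.fold T =
    Iso𝕀.rev T := by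
  apply CartesianMonoidalCategory.hom_ext
  · simp only [atVertex, Iso𝕀.fold, Iso𝕀.rev, comp_lift, comp_lift_assoc, lift_fst, lift_snd,
      whiskerLeft_fst, whiskerLeft_snd_assoc]
    apply Iso𝕀.hom_ext
    intro n t k
    rw [Iso𝕀.lift_map₂]
    rfl
  · simp [atVertex, Iso𝕀.fold, Iso𝕀.rev]

@[simp]
lemma Iso𝕀.fold_one_assoc (T : SSet.{v}) {Z' : SSet.{v}} (h : Iso𝕀.{v} ⊗ T ⟶ Z') :
    Iso𝕀.{v} ◁ atVertex SSet.coherentIso.x₁ T ≫ Iso𝕀.fold T ≫ h = Iso𝕀.rev T ≫ h :=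
  (reassoc_of% (Iso𝕀.fold_one T)) h

lemma Htpy.symm {T Z : SSet.{v}} {f g : T ⟶ Z} (h : Htpy f g) : Htpy g f := by
  obtain ⟨H, rfl, rfl⟩ := h
  exact ⟨Iso𝕀.rev T ≫ H, by simp, by simp⟩

/-! ### The boundary of `𝕀` -/

/-- The disjoint union of two copies of `T`. -/
def Twice (T : SSet.{v}) : SSet.{v} where
  obj n := T.obj n ⊕ T.obj n
  map f := ↾(Sum.map (T.map f) (T.map f))
  map_id n := by ext x; cases x <;> simp
  map_comp f g := by ext x; cases x <;> simp

/-- The map from `S ⊗ (T ⊔ T)` given by a pair of maps. -/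
def Twice.desc {S T Z : SSet.{v}} (a b : S ⊗ T ⟶ Z) : S ⊗ Twice T ⟶ Z where
  app n := ↾fun z => Sum.elim (fun t => a.app n (z.1, t)) (fun t => b.app n (z.1, t)) z.2
  naturality m n f := by
    ext ⟨s, t⟩
    cases t
    · have h := ConcreteCategory.congr_hom (a.naturality f)
      exact h (s, _)
    · have h := ConcreteCategory.congr_hom (b.naturality f)
      exact h (s, _)

/-- The map from `T ⊔ T` given by a pair of maps. -/
def Twice.desc' {T Z : SSet.{v}} (a b : T ⟶ Z) : Twice T ⟶ Z where
  app n := ↾fun z => Sum.elim (a.app n) (b.app n) z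
  naturality m n f := by
    ext t
    cases t
    · exact ConcreteCategory.congr_hom (a.naturality f) _
    · exact ConcreteCategory.congr_hom (b.naturality f) _

/-- The inclusion of the left summand. -/
def Twice.inl (T : SSet.{v}) : T ⟶ Twice T where
  app n := ↾Sum.inl

/-- The inclusion of the right summand. -/
def Twice.inr (T : SSet.{v}) : T ⟶ Twice T where
  app n := ↾Sum.inr

@[simp]
lemma Twice.inl_desc {S T Z : SSet.{v}} (a b : S ⊗ T ⟶ Z) :
    S ◁ Twice.inl T ≫ Twice.desc a b = a := rfl

@[simp]
lemma Twice.inl_desc_assoc {S T Z : SSet.{v}} (a b : S ⊗ T ⟶ Z) {Z' : SSet.{v}} (h : Z ⟶ Z') :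
    S ◁ Twice.inl T ≫ Twice.desc a b ≫ h = a ≫ h :=
  (reassoc_of% (Twice.inl_desc a b)) h

@[simp]
lemma Twice.inr_desc {S T Z : SSet.{v}} (a b : S ⊗ T ⟶ Z) :
    S ◁ Twice.inr T ≫ Twice.desc a b = b := rfl

@[simp]
lemma Twice.inr_desc_assoc {S T Z : SSet.{v}} (a b : S ⊗ T ⟶ Z) {Z' : SSet.{v}} (h : Z ⟶ Z') :
    S ◁ Twice.inr T ≫ Twice.desc a b ≫ h = b ≫ h :=
  (reassoc_of% (Twice.inr_desc a b)) h

@[simp]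
lemma Twice.inl_desc' {T Z : SSet.{v}} (a b : T ⟶ Z) : Twice.inl T ≫ Twice.desc' a b = a := rfl

@[simp]
lemma Twice.inl_desc'_assoc {T Z : SSet.{v}} (a b : T ⟶ Z) {Z' : SSet.{v}} (h : Z ⟶ Z') :
    Twice.inl T ≫ Twice.desc' a b ≫ h = a ≫ h :=
  (reassoc_of% (Twice.inl_desc' a b)) h

@[simp]
lemma Twice.inr_desc' {T Z : SSet.{v}} (a b : T ⟶ Z) : Twice.inr T ≫ Twice.desc' a b = b := rfl

@[simp]
lemma Twice.inr_desc'_assoc {T Z : SSet.{v}} (a b : T ⟶ Z) {Z' : SSet.{v}} (h : Z ⟶ Z') :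
    Twice.inr T ≫ Twice.desc' a b ≫ h = b ≫ h :=
  (reassoc_of% (Twice.inr_desc' a b)) h

lemma Twice.hom_ext {S T Z : SSet.{v}} {f g : S ⊗ Twice T ⟶ Z}
    (h₁ : S ◁ Twice.inl T ≫ f = S ◁ Twice.inl T ≫ g)
    (h₂ : S ◁ Twice.inr T ≫ f = S ◁ Twice.inr T ≫ g) : f = g := by
  apply SSet.hom_ext
  intro n
  apply ConcreteCategory.hom_ext
  rintro ⟨s, t⟩
  cases t with
  | inl t => exact congrArg (fun k => (NatTrans.app k n : _ → _) (s, t)) h₁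
  | inr t => exact congrArg (fun k => (NatTrans.app k n : _ → _) (s, t)) h₂

lemma Twice.hom_ext' {T Z : SSet.{v}} {f g : Twice T ⟶ Z}
    (h₁ : Twice.inl T ≫ f = Twice.inl T ≫ g)
    (h₂ : Twice.inr T ≫ f = Twice.inr T ≫ g) : f = g := by
  apply SSet.hom_ext
  intro n
  apply ConcreteCategory.hom_ext
  rintro (t | t)
  · exact congrArg (fun k => (NatTrans.app k n : _ → _) t) h₁
  · exact congrArg (fun k => (NatTrans.app k n : _ → _) t) h₂

/-- The inclusion of both ends into `𝕀 ⊗ T`. -/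
def bothEnds (T : SSet.{v}) : Twice T ⟶ Iso𝕀.{v} ⊗ T :=
  Twice.desc' (atVertex SSet.coherentIso.x₀ T) (atVertex SSet.coherentIso.x₁ T)

/-- The two copies of T have different constant 𝕀-coordinates, so they are disjoint; within one copy
the T-coordinate is retained. -/
instance (T : SSet.{v}) : Mono (bothEnds T) := by
  have : ∀ n, Mono ((bothEnds T).app n) := fun n => by
    rw [CategoryTheory.mono_iff_injective]
    have key : ∀ (t : T.obj n),
        (Codiscrete.equivFun ((atVertex SSet.coherentIso.x₀ T).app n t).1 0).down ≠
        (Codiscrete.equivFun ((atVertex SSet.coherentIso.x₁ T).app n t).1 0).down := by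
      intro t h
      cases h
    rintro (t | t) (t' | t') h
    · exact congrArg Sum.inl (congrArg Prod.snd h)
    · cases congrArg (fun z => (Codiscrete.equivFun z.1 0).down) h
    · cases congrArg (fun z => (Codiscrete.equivFun z.1 0).down) h
    · exact congrArg Sum.inr (congrArg Prod.snd h)
  exact NatTrans.mono_of_mono_app _

/-- The empty simplicial set. -/
def Nothing : SSet.{v} where
  obj _ := PEmpty
  map _ := 𝟙 _

/-- The map from the product with the empty simplicial set. -/
def Nothing.elim (S Z : SSet.{v}) : S ⊗ Nothing.{v} ⟶ Z where
  app n := ↾fun z => PEmpty.elim z.2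
  naturality m n f := by
    ext z
    exact PEmpty.elim z.2

/-- The map from the empty simplicial set. -/
def Nothing.to (Z : SSet.{v}) : Nothing.{v} ⟶ Z where
  app n := ↾fun z => PEmpty.elim z
  naturality m n f := by
    ext z
    exact PEmpty.elim z

lemma Nothing.hom_ext {Z : SSet.{v}} (f g : Nothing.{v} ⟶ Z) : f = g := by
  apply SSet.hom_ext
  intro n
  apply ConcreteCategory.hom_ext
  exact fun z => PEmpty.elim z

lemma Nothing.hom_ext' {S Z : SSet.{v}} (f g : S ⊗ Nothing.{v} ⟶ Z) : f = g := by
  apply SSet.hom_ext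
  intro n
  apply ConcreteCategory.hom_ext
  exact fun z => PEmpty.elim z.2

instance (Z : SSet.{v}) : Mono (Nothing.to Z) := by
  have : ∀ n, Mono ((Nothing.to Z).app n) := fun n => by
    rw [CategoryTheory.mono_iff_injective]
    exact fun z => PEmpty.elim z
  exact NatTrans.mono_of_mono_app _

/-- Filling of squares: the missing side of a lift of a square of homotopies of which three sides
are given. -/
lemma HasIsoLift.fill {X Y T : SSet.{v}} {p : X ⟶ Y} (hp : HasIsoLift p)
    (h a b : Iso𝕀.{v} ⊗ T ⟶ X) (w : Iso𝕀.{v} ⊗ (Iso𝕀.{v} ⊗ T) ⟶ Y)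
    (h₁ : atVertex SSet.coherentIso.x₀ T ≫ h = atVertex SSet.coherentIso.x₀ T ≫ a)
    (h₂ : atVertex SSet.coherentIso.x₁ T ≫ h = atVertex SSet.coherentIso.x₀ T ≫ b)
    (h₃ : h ≫ p = atVertex SSet.coherentIso.x₀ _ ≫ w)
    (h₄ : a ≫ p = Iso𝕀.{v} ◁ atVertex SSet.coherentIso.x₀ T ≫ w)
    (h₅ : b ≫ p = Iso𝕀.{v} ◁ atVertex SSet.coherentIso.x₁ T ≫ w) :
    ∃ h' : Iso𝕀.{v} ⊗ T ⟶ X,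
      atVertex SSet.coherentIso.x₀ T ≫ h' = atVertex SSet.coherentIso.x₁ T ≫ a ∧
      atVertex SSet.coherentIso.x₁ T ≫ h' = atVertex SSet.coherentIso.x₁ T ≫ b ∧
      h' ≫ p = atVertex SSet.coherentIso.x₁ _ ≫ w := by
  have inl_both : Twice.inl T ≫ bothEnds T = atVertex SSet.coherentIso.x₀ T := rfl
  have inr_both : Twice.inr T ≫ bothEnds T = atVertex SSet.coherentIso.x₁ T := rfl
  -- The three given sides form the Leibniz product of the vertex 0 with the inclusion of both ends;
  -- the side at outer vertex 1 is read off from the filled square.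
  obtain ⟨l, hl₁, hl₂, hl₃⟩ := hp SSet.coherentIso.x₀ (Or.inl rfl) (bothEnds T) inferInstance
    (Twice.desc a b) h w (by
      apply Twice.hom_ext'
      · rw [atVertex_naturality_assoc, Twice.inl_desc, reassoc_of% inl_both, h₁]
      · rw [atVertex_naturality_assoc, Twice.inr_desc, reassoc_of% inr_both, h₂]) (by
      apply Twice.hom_ext
      · rw [Twice.inl_desc_assoc, h₄, ← MonoidalCategory.whiskerLeft_comp_assoc, inl_both]
      · rw [Twice.inr_desc_assoc, h₅, ← MonoidalCategory.whiskerLeft_comp_assoc, inr_both]) h₃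
  refine ⟨atVertex SSet.coherentIso.x₁ _ ≫ l, ?_, ?_, by rw [Category.assoc, hl₃]⟩
  · rw [atVertex_naturality_assoc, ← inl_both, MonoidalCategory.whiskerLeft_comp_assoc, hl₁,
      Twice.inl_desc]
  · rw [← inr_both, Category.assoc]
    conv_lhs => rw [← Category.assoc, ← Category.assoc, inr_both, atVertex_naturality, Category.assoc]
    rw [← inr_both, MonoidalCategory.whiskerLeft_comp_assoc, hl₁, Twice.inr_desc]

lemma Htpy.trans {T Z : SSet.{v}} (hZ : IsoFibrant Z) {f g k : T ⟶ Z} (h₁ : Htpy f g)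
    (h₂ : Htpy g k) : Htpy f k := by
  obtain ⟨H, rfl, rfl⟩ := h₁
  obtain ⟨K, hK, rfl⟩ := h₂
  -- The given sides are H, the constant homotopy at the start of H, and K; the missing side is the
  -- concatenation.
  obtain ⟨h', h₁, h₂, -⟩ := HasIsoLift.fill hZ H (snd _ _ ≫ atVertex SSet.coherentIso.x₀ T ≫ H) K
    (toUnit _) (by simp) hK.symm (toUnit_unique _ _) (toUnit_unique _ _) (toUnit_unique _ _)
  exact ⟨h', by simpa using h₁, h₂⟩

/-- An equivalence with the Leibniz lifting property along `𝕀` is a trivial Kan fibration. -/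
lemma trivKan_of_equivalence {X Y : SSet.{v}} {p : X ⟶ Y} (hp : HasIsoLift p) (hX : IsoFibrant X)
    (h : IsQCatEquivalence p) : TrivKan p := by
  rw [isQCatEquivalence_iff] at h
  obtain ⟨g, hα, β, hβ₀, hβ₁⟩ := h
  -- For the inclusion of the empty simplicial set, the Leibniz condition is plain homotopy lifting.
  -- Lifting β from g yields, at the other end, a strict section s.
  obtain ⟨K, -, hK₀, hK⟩ := hp SSet.coherentIso.x₀ (Or.inl rfl) (Nothing.to Y) inferInstance
    (Nothing.elim _ _) g β (Nothing.hom_ext _ _) (Nothing.hom_ext' _ _) hβ₀.symm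
  obtain ⟨s, hs⟩ : ∃ s, s = atVertex SSet.coherentIso.x₁ Y ≫ K := ⟨_, rfl⟩
  have hsp : s ≫ p = 𝟙 Y := by rw [hs, Category.assoc, hK, hβ₁]
  have hgs : Htpy g s := ⟨K, hK₀, hs.symm⟩
  -- This joins the identity to p ≫ s, but not yet over Y.
  obtain ⟨H, hH₀, hH₁⟩ := hα.trans hX (hgs.pre p)
  -- The base square contracts H ≫ p to a constant homotopy. The new side F runs from the identity
  -- to p ≫ s and is constant over Y.
  obtain ⟨F, hF₀, hF₁, hF⟩ := hp.fill H (snd _ _) (Iso𝕀.rev X ≫ H ≫ p ≫ s)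
    (Iso𝕀.fold X ≫ H ≫ p) (by simp [hH₀])
    (by rw [Iso𝕀.zero_rev_assoc, hH₁, reassoc_of% hH₁, reassoc_of% hsp])
    (by simp) (by rw [Iso𝕀.fold_zero_assoc, reassoc_of% hH₀])
    (by rw [Iso𝕀.fold_one_assoc]; simp [hsp])
  rw [atVertex_snd] at hF₀
  rw [Iso𝕀.one_rev_assoc, reassoc_of% hH₀] at hF₁
  rw [Iso𝕀.one_fold_assoc, reassoc_of% hH₀] at hF
  intro U V i hi
  constructor
  intro u w sq
  -- At vertex 1 the section gives a lift that restricts to u only up to F. Extending F backwards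
  -- from V to vertex 0, where it starts at the identity, corrects this.
  obtain ⟨l, hl₁, hl₂, hl₃⟩ := hp SSet.coherentIso.x₁ (Or.inr rfl) i hi (Iso𝕀.{v} ◁ u ≫ F) (w ≫ s)
    (snd _ _ ≫ w) (by rw [← atVertex_naturality_assoc, hF₁, reassoc_of% sq.w])
    (by rw [Category.assoc, hF, whiskerLeft_snd_assoc, whiskerLeft_snd_assoc, sq.w])
    (by simp [hsp])
  refine ⟨⟨⟨atVertex SSet.coherentIso.x₀ V ≫ l, ?_, ?_⟩⟩⟩
  · rw [atVertex_naturality_assoc, hl₁, ← atVertex_naturality_assoc, hF₀, Category.comp_id]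
  · rw [Category.assoc, hl₃, atVertex_snd_assoc]

lemma TrivKan.lift {X Y : SSet.{v}} {p : X ⟶ Y} (hp : TrivKan p) {U V : SSet.{v}} (i : U ⟶ V)
    (hi : Mono i) (a : U ⟶ X) (b : V ⟶ Y) (h : a ≫ p = i ≫ b) :
    ∃ l, i ≫ l = a ∧ l ≫ p = b := by
  have := hp i hi
  have sq : CommSq a i p b := ⟨h⟩
  exact ⟨sq.lift, sq.fac_left, sq.fac_right⟩

lemma TrivKan.of_lift {X Y : SSet.{v}} {p : X ⟶ Y}
    (h : ∀ {U V : SSet.{v}} (i : U ⟶ V) (_ : Mono i) (a : U ⟶ X) (b : V ⟶ Y), a ≫ p = i ≫ b →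
      ∃ l, i ≫ l = a ∧ l ≫ p = b) : TrivKan p := by
  intro U V i hi
  refine ⟨fun {a b} sq => ?_⟩
  obtain ⟨l, h₁, h₂⟩ := h i hi a b sq.w
  exact ⟨⟨⟨l, h₁, h₂⟩⟩⟩

lemma TrivKan.exists_section {X Y : SSet.{v}} {p : X ⟶ Y} (hp : TrivKan p) :
    ∃ s : Y ⟶ X, s ≫ p = 𝟙 Y := by
  obtain ⟨s, -, hs⟩ := hp.lift (Nothing.to Y) inferInstance (Nothing.to X) (𝟙 Y)
    (Nothing.hom_ext _ _)
  exact ⟨s, hs⟩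

/-- Maps with the same composite with a trivial Kan fibration are homotopic. -/
lemma TrivKan.htpy {X Y T : SSet.{v}} {p : X ⟶ Y} (hp : TrivKan p) {f g : T ⟶ X}
    (h : f ≫ p = g ≫ p) : Htpy f g := by
  obtain ⟨H, hH, -⟩ := hp.lift (bothEnds T) inferInstance (Twice.desc' f g) (snd _ _ ≫ f ≫ p) (by
    apply Twice.hom_ext'
    · simp [bothEnds]
    · simp [bothEnds, h])
  refine ⟨H, ?_, ?_⟩
  · simpa [bothEnds] using congrArg (Twice.inl T ≫ ·) hH
  · simpa [bothEnds] using congrArg (Twice.inr T ≫ ·) hH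

/-- For a section s, the maps p ≫ s and 𝟙 agree after composing with p, hence are homotopic. -/
lemma TrivKan.isQCatEquivalence {X Y : SSet.{v}} {p : X ⟶ Y} (hp : TrivKan p) :
    IsQCatEquivalence p := by
  obtain ⟨s, hs⟩ := hp.exists_section
  rw [isQCatEquivalence_iff]
  exact ⟨s, hp.htpy (by simp [hs]), by rw [hs]; exact Htpy.refl _⟩

/-! ### Two out of three for equivalences -/

lemma IsQCatEquivalence.comp {X Y Z : SSet.{v}} {f : X ⟶ Y} {g : Y ⟶ Z} (hX : IsoFibrant X)
    (hZ : IsoFibrant Z) (hf : IsQCatEquivalence f) (hg : IsQCatEquivalence g) :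
    IsQCatEquivalence (f ≫ g) := by
  rw [isQCatEquivalence_iff] at hf hg ⊢
  obtain ⟨f', h₁, h₂⟩ := hf
  obtain ⟨g', h₃, h₄⟩ := hg
  refine ⟨g' ≫ f', h₁.trans hX ?_, Htpy.trans hZ ?_ h₄⟩
  · simpa using (h₃.pre f).post f'
  · simpa using (h₂.pre g').post g

/-- With k inverse to f ≫ g, the inverse of f is g ≫ k; the second homotopy is found by inserting g
≫ g' for an inverse g' of g. -/
lemma IsQCatEquivalence.of_comp_right {X Y Z : SSet.{v}} {f : X ⟶ Y} {g : Y ⟶ Z}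
    (hY : IsoFibrant Y) (hg : IsQCatEquivalence g)
    (hfg : IsQCatEquivalence (f ≫ g)) : IsQCatEquivalence f := by
  rw [isQCatEquivalence_iff] at hg hfg ⊢
  obtain ⟨g', h₃, h₄⟩ := hg
  obtain ⟨k, h₁, h₂⟩ := hfg
  refine ⟨g ≫ k, by simpa using h₁, ?_⟩
  have e₁ : Htpy ((g ≫ k) ≫ f) (((g ≫ k) ≫ f) ≫ g ≫ g') := by
    simpa using h₃.pre ((g ≫ k) ≫ f)
  have e₂ : Htpy (((g ≫ k) ≫ f) ≫ g ≫ g') (g ≫ g') := by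
    simpa using (h₂.pre g).post g'
  exact (e₁.trans hY e₂).trans hY h₃.symm

/-- Dually, the inverse of g is k ≫ f, and the missing homotopy inserts f' ≫ f in front. -/
lemma IsQCatEquivalence.of_comp_left {X Y Z : SSet.{v}} {f : X ⟶ Y} {g : Y ⟶ Z}
    (hY : IsoFibrant Y) (hf : IsQCatEquivalence f)
    (hfg : IsQCatEquivalence (f ≫ g)) : IsQCatEquivalence g := by
  rw [isQCatEquivalence_iff] at hf hfg ⊢
  obtain ⟨f', h₃, h₄⟩ := hf
  obtain ⟨k, h₁, h₂⟩ := hfg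
  refine ⟨k ≫ f, ?_, by simpa using h₂⟩
  have e₁ : Htpy (g ≫ k ≫ f) ((f' ≫ f) ≫ g ≫ k ≫ f) := by
    simpa using (h₄.post (g ≫ k ≫ f)).symm
  have e₂ : Htpy ((f' ≫ f) ≫ g ≫ k ≫ f) (f' ≫ f) := by
    simpa using ((h₁.pre f').post f).symm
  exact ((e₁.trans hY e₂).trans hY h₄).symm

lemma TrivKan.of_isPullback {P X Y Z : SSet.{v}} {fst : P ⟶ X} {snd : P ⟶ Y} {f : X ⟶ Z}
    {g : Y ⟶ Z} (h : IsPullback fst snd f g) (hf : TrivKan f) : TrivKan snd :=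
  MorphismProperty.of_isPullback h hf

/-- If the vertical maps of a square are trivial Kan fibrations and the bottom map is an
equivalence, then so is the top map. -/
lemma IsQCatEquivalence.of_square {X Y X' Y' : SSet.{v}} {f : X ⟶ Y} {f' : X' ⟶ Y'} {p : X ⟶ X'}
    {q : Y ⟶ Y'} (hp : TrivKan p) (hq : TrivKan q) (w : f ≫ q = p ≫ f')
    (hX : IsoFibrant X) (hY : IsoFibrant Y) (hY' : IsoFibrant Y') (hf' : IsQCatEquivalence f') :
    IsQCatEquivalence f := by
  refine .of_comp_right hY hq.isQCatEquivalence ?_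
  rw [w]
  exact .comp hX hY' hp.isQCatEquivalence hf'

lemma IsQCatEquivalence.of_square' {X Y X' Y' : SSet.{v}} {f : X ⟶ Y} {f' : X' ⟶ Y'} {p : X ⟶ X'}
    {q : Y ⟶ Y'} (hp : TrivKan p) (hq : TrivKan q) (w : f ≫ q = p ≫ f')
    (hX : IsoFibrant X) (hX' : IsoFibrant X') (hY' : IsoFibrant Y') (hf : IsQCatEquivalence f) :
    IsQCatEquivalence f' := by
  refine .of_comp_left hX' hp.isQCatEquivalence ?_
  rw [← w]
  exact .comp hX hY' hf hq.isQCatEquivalence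

/-! ### Whiskering in function complexes -/

section

variable {C : Type u} [Category.{v} C] [SimplicialCategory C]

lemma Fun.post_comp (X : C) {Y Z Z' : C} (f : Y ⟶ Z) (g : Z ⟶ Z') :
    Fun.post X (f ≫ g) = Fun.post X f ≫ Fun.post X g := eHomWhiskerLeft_comp _ _ _ _

lemma Fun.post_id (X Y : C) : Fun.post X (𝟙 Y) = 𝟙 _ := eHomWhiskerLeft_id _ _ _

lemma Fun.pre_comp {X Y Y' : C} (f : X ⟶ Y) (g : Y ⟶ Y') (Z : C) :
    Fun.pre (f ≫ g) Z = Fun.pre g Z ≫ Fun.pre f Z := eHomWhiskerRight_comp _ _ _ _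

lemma Fun.pre_id (X Y : C) : Fun.pre (𝟙 X) Y = 𝟙 _ := eHomWhiskerRight_id _ _ _

lemma Fun.post_pre {X X' Y Y' : C} (f : X ⟶ X') (g : Y ⟶ Y') :
    Fun.post X' g ≫ Fun.pre f Y' = Fun.pre f Y ≫ Fun.post X g := eHom_whisker_exchange _ _ _

lemma Fun.comp_pre_left {X Y Z : C} {S S' T : SSet.{v}} (s : S' ⟶ S) (c : S ⟶ Fun X Y)
    (d : T ⟶ Fun Y Z) : Fun.comp (s ≫ c) d = s ▷ T ≫ Fun.comp c d := by
  rw [← tensorHom_id, Fun.precomp_comp, Category.id_comp]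

lemma Fun.comp_pre_right {X Y Z : C} {S T T' : SSet.{v}} (s : T' ⟶ T) (c : S ⟶ Fun X Y)
    (d : T ⟶ Fun Y Z) : Fun.comp c (s ≫ d) = S ◁ s ≫ Fun.comp c d := by
  rw [← id_tensorHom, Fun.precomp_comp, Category.id_comp]

lemma Fun.vertex_injective {X Y : C} {f g : X ⟶ Y} (h : Fun.vertex f = Fun.vertex g) : f = g :=
  (eHomEquiv SSet.{v}).injective h

lemma Fun.exists_vertex {X Y : C} (a : 𝟙_ SSet.{v} ⟶ Fun X Y) : ∃ f : X ⟶ Y, Fun.vertex f = a :=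
  (eHomEquiv SSet.{v}).surjective a

/-! ### Conical limits in terms of generalized elements -/

/-- The universal property of a conical limit, in terms of generalized elements of function
complexes. -/
def IsSLimit {J : Type w} [Category J] {F : J ⥤ C} (c : Cone F) : Prop :=
  ∀ (X : C) (T : SSet.{v}) (s : ∀ j, T ⟶ Fun X (F.obj j)),
    (∀ ⦃j j'⦄ (u : j ⟶ j'), s j ≫ Fun.post X (F.map u) = s j') →
    ∃! l : T ⟶ Fun X c.pt, ∀ j, l ≫ Fun.post X (c.π.app j) = s j

lemma IsSLimit.hom {J : Type w} [Category J] {F : J ⥤ C} {c : Cone F} (hc : IsSLimit c) (X : C)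
    (s : ∀ j, X ⟶ F.obj j) (hs : ∀ ⦃j j'⦄ (u : j ⟶ j'), s j ≫ F.map u = s j') :
    ∃! l : X ⟶ c.pt, ∀ j, l ≫ c.π.app j = s j := by
  obtain ⟨l, hl, hu⟩ := hc X (𝟙_ _) (fun j => Fun.vertex (s j)) (fun j j' u => by
    rw [Fun.vertex_post, hs])
  obtain ⟨l, rfl⟩ := Fun.exists_vertex l
  refine ⟨l, fun j => Fun.vertex_injective ?_, fun l' hl' => Fun.vertex_injective (hu _ ?_)⟩
  · rw [← Fun.vertex_post, hl]
  · intro j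
    rw [Fun.vertex_post, hl']

lemma IsSLimit.nonempty_isLimit {J : Type w} [Category J] {F : J ⥤ C} {c : Cone F}
    (hc : IsSLimit c) : Nonempty (IsLimit c) := by
  have h (s : Cone F) := hc.hom s.pt (fun j => s.π.app j) (fun j j' u => s.w u)
  choose l hl hu using h
  exact ⟨⟨l, hl, hu⟩⟩

lemma IsSLimit.hom_ext {J : Type w} [Category J] {F : J ⥤ C} {c : Cone F} (hc : IsSLimit c)
    {X : C} {T : SSet.{v}} {a b : T ⟶ Fun X c.pt}
    (h : ∀ j, a ≫ Fun.post X (c.π.app j) = b ≫ Fun.post X (c.π.app j)) : a = b :=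
  (hc X T (fun j => b ≫ Fun.post X (c.π.app j)) (fun j j' u => by
    rw [Category.assoc, ← Fun.post_comp, c.w])).unique h (fun _ => rfl)

/-- The universal property of a conical limit, for a diagram and a cone given by their components. -/
def IsFamLimit {J : Type w} [Category J] (D : J → C) (φ : ∀ {j j' : J}, (j ⟶ j') → (D j ⟶ D j'))
    {L : C} (π : ∀ j, L ⟶ D j) : Prop :=
  (∀ ⦃j j'⦄ (u : j ⟶ j'), π j ≫ φ u = π j') ∧
  ∀ (X : C) (T : SSet.{v}) (s : ∀ j, T ⟶ Fun X (D j)),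
    (∀ ⦃j j'⦄ (u : j ⟶ j'), s j ≫ Fun.post X (φ u) = s j') →
    ∃! l : T ⟶ Fun X L, ∀ j, l ≫ Fun.post X (π j) = s j

lemma IsSLimit.isFamLimit {J : Type w} [Category J] {F : J ⥤ C} {c : Cone F} (hc : IsSLimit c) :
    IsFamLimit F.obj F.map c.π.app :=
  ⟨fun _ _ u => c.w u, hc⟩

lemma IsFamLimit.hom_ext {J : Type w} [Category J] {D : J → C}
    {φ : ∀ {j j' : J}, (j ⟶ j') → (D j ⟶ D j')} {L : C} {π : ∀ j, L ⟶ D j}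
    (h : IsFamLimit D φ π) {X : C} {T : SSet.{v}} {a b : T ⟶ Fun X L}
    (hab : ∀ j, a ≫ Fun.post X (π j) = b ≫ Fun.post X (π j)) : a = b :=
  (h.2 X T (fun j => b ≫ Fun.post X (π j)) (fun j j' u => by
    rw [Category.assoc, ← Fun.post_comp, h.1])).unique hab (fun _ => rfl)

lemma IsFamLimit.hom_ext' {J : Type w} [Category J] {D : J → C}
    {φ : ∀ {j j' : J}, (j ⟶ j') → (D j ⟶ D j')} {L : C} {π : ∀ j, L ⟶ D j}
    (h : IsFamLimit D φ π) {X : C} {a b : X ⟶ L} (hab : ∀ j, a ≫ π j = b ≫ π j) : a = b := by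
  apply Fun.vertex_injective
  refine h.hom_ext fun j => ?_
  rw [Fun.vertex_post, Fun.vertex_post, hab]

lemma IsFamLimit.exists_hom {J : Type w} [Category J] {D : J → C}
    {φ : ∀ {j j' : J}, (j ⟶ j') → (D j ⟶ D j')} {L : C} {π : ∀ j, L ⟶ D j}
    (h : IsFamLimit D φ π) {X : C} (s : ∀ j, X ⟶ D j)
    (hs : ∀ ⦃j j'⦄ (u : j ⟶ j'), s j ≫ φ u = s j') : ∃ l : X ⟶ L, ∀ j, l ≫ π j = s j := by
  obtain ⟨l, hl, -⟩ := h.2 X (𝟙_ _) (fun j => Fun.vertex (s j)) (fun j j' u => by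
    rw [Fun.vertex_post, hs])
  obtain ⟨l, rfl⟩ := Fun.exists_vertex l
  exact ⟨l, fun j => Fun.vertex_injective (by rw [← Fun.vertex_post, hl])⟩

/-- The underlying limit comes for free from generalized elements: maps from the unit to Fun(X, Y)
are the functors X ⟶ Y. -/
lemma isConicalLimit_iff {J : Type w} [Category J] {F : J ⥤ C} (c : Cone F) :
    IsConicalLimit c ↔ IsSLimit c := by
  constructor
  · intro h X T s hs
    obtain ⟨hX⟩ := h.isLimit_map X
    let d : Cone (F ⋙ eCoyoneda SSet.{v} X) :=
      { pt := T
        π := { app := s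
               naturality := fun j j' u => by
                exact (Category.id_comp _).trans (hs u).symm } }
    exact ⟨hX.lift d, fun j => hX.fac d j, fun l hl => hX.uniq d l hl⟩
  · intro h
    refine ⟨h.nonempty_isLimit, fun X => ?_⟩
    have h' (s : Cone (F ⋙ eCoyoneda SSet.{v} X)) :=
      h X s.pt (fun j => s.π.app j) (fun j j' u => s.w u)
    choose l hl hu using h'
    exact ⟨⟨l, hl, hu⟩⟩

lemma IsSLimit.of_iso {J : Type w} [Category J] {F : J ⥤ C} {c d : Cone F} (hc : IsSLimit c)
    (e : c ≅ d) : IsSLimit d := by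
  rw [← isConicalLimit_iff] at hc ⊢
  refine ⟨hc.isLimit.map fun h => h.ofIsoLimit e, fun X => (hc.isLimit_map X).map fun h => ?_⟩
  exact h.ofIsoLimit ((Cone.functoriality F (eCoyoneda SSet.{v} X)).mapIso e)

lemma IsSLimit.exists_iso {J : Type w} [Category J] {F : J ⥤ C} {c d : Cone F} (hc : IsSLimit c)
    (hd : IsSLimit d) : Nonempty (c ≅ d) := by
  obtain ⟨h⟩ := hc.nonempty_isLimit
  obtain ⟨h'⟩ := hd.nonempty_isLimit
  exact ⟨h.uniqueUpToIso h'⟩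

lemma IsSLimit.hasConicalLimit {J : Type w} [Category J] {F : J ⥤ C} {c : Cone F}
    (hc : IsSLimit c) : HasConicalLimit SSet.{v} F := by
  rw [← isConicalLimit_iff] at hc
  obtain ⟨h⟩ := hc.isLimit
  exact
    { exists_limit := ⟨⟨c, h⟩⟩
      preservesLimit_eCoyoneda := fun X =>
        preservesLimit_of_preserves_limit_cone h (hc.isLimit_map X).some }

/-- Lets the axioms about ordinary limit cones be used together with the enriched universal
property. -/
lemma isSLimit_of_isLimit {J : Type w} [Category J] {F : J ⥤ C} (hF : HasConicalLimit SSet.{v} F)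
    {c : Cone F} (hc : IsLimit c) : IsSLimit c := by
  rw [← isConicalLimit_iff]
  exact ⟨⟨hc⟩, fun X => ⟨isLimitOfPreserves (eCoyoneda SSet.{v} X) hc⟩⟩

lemma exists_isSLimit {J : Type w} [Category J] (F : J ⥤ C) (hF : HasConicalLimit SSet.{v} F) :
    ∃ c : Cone F, IsSLimit c :=
  ⟨limit.cone F, isSLimit_of_isLimit hF (limit.isLimit F)⟩

/-! ### Pullbacks -/

/-- The universal property of a simplicially enriched pullback, in terms of generalized elements of
function complexes. -/
structure IsSPullback {P X Y Z : C} (a : P ⟶ X) (b : P ⟶ Y) (f : X ⟶ Z) (g : Y ⟶ Z) : Prop where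
  w : a ≫ f = b ≫ g
  existsUnique (A : C) (T : SSet.{v}) (s : T ⟶ Fun A X) (t : T ⟶ Fun A Y)
    (h : s ≫ Fun.post A f = t ≫ Fun.post A g) :
    ∃! l : T ⟶ Fun A P, l ≫ Fun.post A a = s ∧ l ≫ Fun.post A b = t

lemma isSLimit_iff_isSPullback {F : WalkingCospan ⥤ C} (c : Cone F) :
    IsSLimit c ↔ IsSPullback (c.π.app .left) (c.π.app .right) (F.map WalkingCospan.Hom.inl)
      (F.map WalkingCospan.Hom.inr) := by
  have h₁ : c.π.app .left ≫ F.map WalkingCospan.Hom.inl = c.π.app .one :=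
    c.w WalkingCospan.Hom.inl
  have h₂ : c.π.app .right ≫ F.map WalkingCospan.Hom.inr = c.π.app .one :=
    c.w WalkingCospan.Hom.inr
  constructor
  · intro h
    refine ⟨by rw [h₁, h₂], fun A T s t w => ?_⟩
    obtain ⟨l, hl, hu⟩ := h A T
      (fun j => match j with
        | .one => s ≫ Fun.post A (F.map WalkingCospan.Hom.inl)
        | .left => s
        | .right => t)
      (fun j j' u => by
        rcases u with _ | _ | _
        · simp
        · rfl
        · exact w.symm)
    refine ⟨l, ⟨hl .left, hl .right⟩, fun l' hl' => hu _ ?_⟩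
    rintro (_ | _ | _)
    · simp only
      rw [← h₁, Fun.post_comp, ← Category.assoc, hl'.1]
    · exact hl'.1
    · exact hl'.2
  · intro h A T s hs
    obtain ⟨l, ⟨hl₁, hl₂⟩, hu⟩ := h.existsUnique A T (s .left) (s .right) (by
      rw [hs WalkingCospan.Hom.inl, hs WalkingCospan.Hom.inr])
    refine ⟨l, ?_, fun l' hl' => hu _ ⟨hl' _, hl' _⟩⟩
    rintro (_ | _ | _)
    · rw [← h₁, Fun.post_comp, ← Category.assoc, hl₁, hs WalkingCospan.Hom.inl]
    · exact hl₁
    · exact hl₂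

section

variable {P X Y Z : C} {a : P ⟶ X} {b : P ⟶ Y} {f : X ⟶ Z} {g : Y ⟶ Z}

lemma IsSPullback.isSLimit (h : IsSPullback a b f g) : IsSLimit (PullbackCone.mk a b h.w) :=
  (isSLimit_iff_isSPullback _).2 h

lemma IsSPullback.isPullback (h : IsSPullback a b f g) : IsPullback a b f g :=
  ⟨⟨h.w⟩, h.isSLimit.nonempty_isLimit⟩

lemma IsSPullback.flip (h : IsSPullback a b f g) : IsSPullback b a g f :=
  ⟨h.w.symm, fun A T s t w => by
    obtain ⟨l, hl, hu⟩ := h.existsUnique A T t s w.symm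
    exact ⟨l, hl.symm, fun l' hl' => hu l' hl'.symm⟩⟩

lemma IsSPullback.hom_ext (h : IsSPullback a b f g) {A : C} {T : SSet.{v}} {s t : T ⟶ Fun A P}
    (h₁ : s ≫ Fun.post A a = t ≫ Fun.post A a) (h₂ : s ≫ Fun.post A b = t ≫ Fun.post A b) :
    s = t :=
  (h.existsUnique A T (t ≫ Fun.post A a) (t ≫ Fun.post A b) (by
    simp only [Category.assoc, ← Fun.post_comp, h.w])).unique ⟨h₁, h₂⟩ ⟨rfl, rfl⟩

lemma IsSPullback.map (h : IsSPullback a b f g) (A : C) :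
    IsPullback (Fun.post A a) (Fun.post A b) (Fun.post A f) (Fun.post A g) := by
  refine IsPullback.mk' (by simp only [← Fun.post_comp, h.w]) (fun T s t => h.hom_ext) ?_
  intro T s t w
  obtain ⟨l, hl, -⟩ := h.existsUnique A T s t w
  exact ⟨l, hl⟩

lemma isSPullback_of_isPullback (hfg : HasConicalPullback SSet.{v} f g)
    (h : IsPullback a b f g) : IsSPullback a b f g :=
  (isSLimit_iff_isSPullback _).1 (isSLimit_of_isLimit hfg h.isLimit)

lemma exists_isSPullback (f : X ⟶ Z) (g : Y ⟶ Z) (hfg : HasConicalPullback SSet.{v} f g) :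
    ∃ (P : C) (a : P ⟶ X) (b : P ⟶ Y), IsSPullback a b f g :=
  ⟨_, _, _, isSPullback_of_isPullback hfg (IsPullback.of_hasPullback f g)⟩

end

/-! ### Cotensors -/

section

variable {U V : SSet.{v}} {A B P Q : C}

lemma comp_cotensorComparison (ε : U ⟶ Fun P A) {X : C} {T : SSet.{v}} (l : T ⟶ Fun X P) :
    l ≫ cotensorComparison ε X = MonoidalClosed.curry ((β_ U T).hom ≫ Fun.comp l ε) := by
  rw [cotensorComparison, ← MonoidalClosed.curry_natural_left]
  congr 1

/-- Postcomposing l with the comparison is, up to transposition and symmetry, `Fun.comp l ε`. So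
this is the Yoneda criterion for the comparison to be an isomorphism. -/
lemma isCotensor_iff (ε : U ⟶ Fun P A) : IsCotensor ε ↔
    ∀ (X : C) (T : SSet.{v}) (s : T ⊗ U ⟶ Fun X A), ∃! l : T ⟶ Fun X P, Fun.comp l ε = s := by
  have key (X : C) (T : SSet.{v}) (l : T ⟶ Fun X P) (s : T ⊗ U ⟶ Fun X A) :
      l ≫ cotensorComparison ε X = MonoidalClosed.curry ((β_ U T).hom ≫ s) ↔
        Fun.comp l ε = s := by
    rw [comp_cotensorComparison, (MonoidalClosed.curry_injective).eq_iff, cancel_epi]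
  constructor
  · intro h X T s
    have := h X
    refine ⟨MonoidalClosed.curry ((β_ U T).hom ≫ s) ≫ inv (cotensorComparison ε X), ?_, ?_⟩
    · simp only
      rw [← key]
      simp
    · intro l hl
      rw [← key] at hl
      simp [← hl]
  · intro h X
    -- The universal element gives a one-sided inverse; uniqueness makes it two-sided.
    obtain ⟨l, hl, -⟩ := h X _ ((β_ _ U).hom ≫ MonoidalClosed.uncurry (𝟙 ((ihom U).obj (Fun X A))))
    rw [← key] at hl
    have hl' : l ≫ cotensorComparison ε X = 𝟙 _ := by simpa using hl
    refine ⟨l, ?_, hl'⟩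
    refine (h X _ (Fun.comp (𝟙 _) ε)).unique ?_ rfl
    rw [← key, Category.assoc, hl', Category.comp_id, ← comp_cotensorComparison, Category.id_comp]

lemma IsCotensor.existsUnique {ε : U ⟶ Fun P A} (h : IsCotensor ε) {X : C} {T : SSet.{v}}
    (s : T ⊗ U ⟶ Fun X A) : ∃! l : T ⟶ Fun X P, Fun.comp l ε = s :=
  (isCotensor_iff ε).1 h X T s

lemma IsCotensor.hom_ext {ε : U ⟶ Fun P A} (h : IsCotensor ε) {X : C} {T : SSet.{v}}
    {s t : T ⟶ Fun X P} (hst : Fun.comp s ε = Fun.comp t ε) : s = t :=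
  (h.existsUnique (Fun.comp t ε)).unique hst rfl

lemma Fun.comp_vertex_left {X Y Z : C} {S : SSet.{v}} (b : S ⟶ Fun Y Z) (h : X ⟶ Y) :
    Fun.comp (Fun.vertex h) b = (λ_ S).hom ≫ b ≫ Fun.pre h Z := by
  rw [← Fun.vertex_comp, Iso.hom_inv_id_assoc]

lemma IsCotensor.hom_ext' {ε : U ⟶ Fun P A} (h : IsCotensor ε) {X : C} {f g : X ⟶ P}
    (hfg : ε ≫ Fun.pre f A = ε ≫ Fun.pre g A) : f = g := by
  apply Fun.vertex_injective
  apply h.hom_ext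
  rw [Fun.comp_vertex_left, Fun.comp_vertex_left, hfg]

lemma IsCotensor.exists_hom {ε : U ⟶ Fun P A} (h : IsCotensor ε) {X : C} (s : U ⟶ Fun X A) :
    ∃ f : X ⟶ P, ε ≫ Fun.pre f A = s := by
  obtain ⟨l, hl, -⟩ := h.existsUnique ((λ_ U).hom ≫ s)
  obtain ⟨f, rfl⟩ := Fun.exists_vertex l
  exact ⟨f, by rwa [Fun.comp_vertex_left, cancel_epi] at hl⟩

lemma Cotensor.homEquiv_apply (c : Cotensor U A) {X : C} (f : X ⟶ c.obj) :
    c.homEquiv X f = c.ε ≫ Fun.pre f A := by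
  have h : c.homEquiv X f = (ρ_ U).inv ≫
      MonoidalClosed.uncurry (Fun.vertex f ≫ cotensorComparison c.ε X) := rfl
  rw [h, comp_cotensorComparison, MonoidalClosed.uncurry_curry, Fun.comp_vertex_left]
  simp

/-- This equation and the next characterize `restrict` and `map`, and replace their definitions in
later computations. -/
lemma Cotensor.ε_pre_restrict (i : U ⟶ V) (c : Cotensor V A) (d : Cotensor U A) :
    d.ε ≫ Fun.pre (Cotensor.restrict i c d) A = i ≫ c.ε := by
  rw [← Cotensor.homEquiv_apply, Cotensor.restrict, Equiv.apply_symm_apply]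

lemma Cotensor.ε_pre_map (p : A ⟶ B) (c : Cotensor U A) (d : Cotensor U B) :
    d.ε ≫ Fun.pre (Cotensor.map p c d) B = c.ε ≫ Fun.post c.obj p := by
  rw [← Cotensor.homEquiv_apply, Cotensor.map, Equiv.apply_symm_apply]

lemma IsCotensor.of_iso {ε : U ⟶ Fun P A} (h : IsCotensor ε) (e : Q ≅ P) :
    IsCotensor (ε ≫ Fun.pre e.hom A) := by
  rw [isCotensor_iff]
  intro X T s
  obtain ⟨l, hl, hu⟩ := h.existsUnique s
  refine ⟨l ≫ Fun.post X e.inv, ?_, fun l' hl' => ?_⟩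
  · simp only
    rw [← Fun.comp_middle, Category.assoc, ← Fun.post_comp, e.inv_hom_id, Fun.post_id,
      Category.comp_id, hl]
  · rw [← hu (l' ≫ Fun.post X e.hom) ((Fun.comp_middle _ _ _).trans hl'), Category.assoc,
      ← Fun.post_comp, e.hom_inv_id, Fun.post_id, Category.comp_id]

lemma IsCotensor.exists_iso {ε : U ⟶ Fun P A} (h : IsCotensor ε) {ε' : U ⟶ Fun Q A}
    (h' : IsCotensor ε') : ∃ e : Q ≅ P, ε ≫ Fun.pre e.hom A = ε' := by
  obtain ⟨f, hf⟩ := h.exists_hom ε'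
  obtain ⟨g, hg⟩ := h'.exists_hom ε
  refine ⟨⟨f, g, h'.hom_ext' ?_, h.hom_ext' ?_⟩, hf⟩
  · rw [Fun.pre_comp, ← Category.assoc, hg, hf, Fun.pre_id, Category.comp_id]
  · rw [Fun.pre_comp, ← Category.assoc, hf, hg, Fun.pre_id, Category.comp_id]

end

end

/-! ### Full simplicial subcategories -/

section

variable {C : Type u} [Category.{v} C] [SimplicialCategory C] {P : ObjectProperty C}

/-- Function complexes of a full subcategory are literally the ambient ones; there are only fewer
test objects. -/
lemma IsSLimit.of_full {J : Type w} [Category J] {F : J ⥤ P.FullSubcategory} {c : Cone F}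
    (h : IsSLimit (P.ι.mapCone c)) : IsSLimit c :=
  fun X T s hs => h X.obj T s hs

omit [SimplicialCategory C] in
lemma exists_full_cone {J : Type w} [Category J] {F : J ⥤ P.FullSubcategory}
    (t : Cone (F ⋙ P.ι)) (ht : P t.pt) : ∃ s : Cone F, Nonempty (P.ι.mapCone s ≅ t) :=
  ⟨{ pt := ⟨t.pt, ht⟩
     π :=
      { app := fun j => ObjectProperty.homMk (t.π.app j)
        naturality := fun j j' u => by
          ext
          exact t.π.naturality u } },
    ⟨Cone.ext (Iso.refl _) (fun j => (Category.id_comp _).symm)⟩⟩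

lemma createsConicalLimit {J : Type w} [Category J] {F : J ⥤ P.FullSubcategory}
    (hF : HasConicalLimit SSet.{v} (F ⋙ P.ι)) (hP : ∀ t : Cone (F ⋙ P.ι), IsSLimit t → P t.pt) :
    CreatesConicalLimit P F where
  exists_limit := hF
  exists_lift t ht := exists_full_cone t (hP t ((isConicalLimit_iff t).1 ht))
  isLimit_of_lift s hs := (isConicalLimit_iff s).2 ((isConicalLimit_iff _).1 hs).of_full

lemma createsConicalLimit_of_exists {J : Type w} [Category J] {F : J ⥤ P.FullSubcategory}
    [P.IsClosedUnderIsomorphisms] (h : ∃ t : Cone (F ⋙ P.ι), IsSLimit t ∧ P t.pt) :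
    CreatesConicalLimit P F := by
  obtain ⟨t, ht, hP⟩ := h
  refine createsConicalLimit ht.hasConicalLimit fun t' ht' => ?_
  obtain ⟨e⟩ := ht.exists_iso ht'
  exact P.prop_of_iso ((Cone.forget _).mapIso e) hP

lemma CreatesConicalLimit.hasConicalLimit {J : Type w} [Category J] {F : J ⥤ P.FullSubcategory}
    (h : CreatesConicalLimit P F) : HasConicalLimit SSet.{v} F := by
  obtain ⟨t, ht⟩ := exists_isSLimit _ h.exists_limit
  obtain ⟨s, ⟨e⟩⟩ := h.exists_lift t ((isConicalLimit_iff t).2 ht)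
  exact (ht.of_iso e.symm).of_full.hasConicalLimit

/-- An ambient limit lifts to a limit of the subcategory, and limits there are unique up to
isomorphism. Thus every limit cone of the subcategory is an ambient conical limit, and the ambient
axioms apply to it. -/
lemma CreatesConicalLimit.isSLimit {J : Type w} [Category J] {F : J ⥤ P.FullSubcategory}
    (h : CreatesConicalLimit P F) {c : Cone F} (hc : IsLimit c) : IsSLimit (P.ι.mapCone c) := by
  obtain ⟨t, ht⟩ := exists_isSLimit _ h.exists_limit
  obtain ⟨s, ⟨e⟩⟩ := h.exists_lift t ((isConicalLimit_iff t).2 ht)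
  have hs := (ht.of_iso e.symm).of_full
  obtain ⟨i⟩ := hs.exists_iso (isSLimit_of_isLimit hs.hasConicalLimit hc)
  exact (ht.of_iso e.symm).of_iso ((Cone.functoriality F P.ι).mapIso i)

lemma IsCotensor.of_full {U : SSet.{v}} {A Q : P.FullSubcategory} {ε : U ⟶ Fun Q.obj A.obj}
    (h : IsCotensor ε) : IsCotensor (C := P.FullSubcategory) (A := A) (P := Q) ε :=
  fun X => h X.obj

/-- An ambient cotensor that lies in P is also a cotensor in the subcategory, hence isomorphic to
any given one there. -/
lemma IsCotensor.of_full_of_exists {U : SSet.{v}} {A Q : P.FullSubcategory} {ε : U ⟶ Fun Q A}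
    (h : IsCotensor ε) {R : C} {η : U ⟶ Fun R A.obj} (hη : IsCotensor η) (hR : P R) :
    IsCotensor (C := C) (A := A.obj) (P := Q.obj) ε := by
  have hη' : IsCotensor (C := P.FullSubcategory) (A := A) (P := ⟨R, hR⟩) η :=
    IsCotensor.of_full (Q := ⟨R, hR⟩) hη
  obtain ⟨e, he⟩ := hη'.exists_iso h
  have h' := hη.of_iso (P.ι.mapIso e)
  rw [← he]
  exact h'

/-- A cotensor of a full subcategory that is a cotensor in the ambient category. -/
def Cotensor.toAmbient {U : SSet.{v}} {A : P.FullSubcategory} (c : Cotensor U A)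
    (h : IsCotensor (C := C) (A := A.obj) (P := c.obj.obj) c.ε) : Cotensor U A.obj :=
  ⟨c.obj.obj, c.ε, h⟩

lemma Cotensor.toAmbient_restrict {U V : SSet.{v}} {A : P.FullSubcategory} (i : U ⟶ V)
    (c : Cotensor V A) (d : Cotensor U A) (hc : IsCotensor (C := C) (A := A.obj) c.ε)
    (hd : IsCotensor (C := C) (A := A.obj) d.ε) :
    P.ι.map (Cotensor.restrict i c d) = Cotensor.restrict i (c.toAmbient hc) (d.toAmbient hd) :=
  hd.hom_ext' ((Cotensor.ε_pre_restrict i c d).trans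
    (Cotensor.ε_pre_restrict i (c.toAmbient hc) (d.toAmbient hd)).symm)

lemma Cotensor.toAmbient_map {U : SSet.{v}} {A B : P.FullSubcategory} (p : A ⟶ B)
    (c : Cotensor U A) (d : Cotensor U B) (hc : IsCotensor (C := C) (A := A.obj) c.ε)
    (hd : IsCotensor (C := C) (A := B.obj) d.ε) :
    P.ι.map (Cotensor.map p c d) =
      Cotensor.map (P.ι.map p) (c.toAmbient hc) (d.toAmbient hd) :=
  hd.hom_ext' ((Cotensor.ε_pre_map p c d).trans
    (Cotensor.ε_pre_map (P.ι.map p) (c.toAmbient hc) (d.toAmbient hd)).symm)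

end

/-! ### Consequences of the axioms of an ∞-cosmos -/

section

variable {C : Type u} [Category.{v} C] [SimplicialCategory C]

namespace IsInfinityCosmos

variable {W : MorphismProperty C} (hC : IsInfinityCosmos W)

include hC

lemma comp_mem {X Y Z : C} {f : X ⟶ Y} {g : Y ⟶ Z} (hf : W f) (hg : W g) : W (f ≫ g) :=
  hC.isMultiplicative.comp_mem _ _ hf hg

lemma respectsIso : W.RespectsIso :=
  MorphismProperty.RespectsIso.mk _ (fun e _ hf => hC.comp_mem (hC.of_iso _ e.isIso_hom) hf)
    (fun e _ hf => hC.comp_mem hf (hC.of_iso _ e.isIso_hom))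

lemma base_change {P X Y Z : C} {a : P ⟶ X} {b : P ⟶ Y} {f : X ⟶ Z} {g : Y ⟶ Z}
    (h : IsPullback a b f g) (hf : W f) : W b :=
  hC.pullback_stable.of_isPullback h hf

lemma isSPullback {P X Y Z : C} {a : P ⟶ X} {b : P ⟶ Y} {f : X ⟶ Z} {g : Y ⟶ Z}
    (hf : W f) (h : IsPullback a b f g) : IsSPullback a b f g :=
  isSPullback_of_isPullback (hC.hasPullbacks f hf g) h

lemma exists_pullback {X Y Z : C} (f : X ⟶ Z) (hf : W f) (g : Y ⟶ Z) :
    ∃ (P : C) (a : P ⟶ X) (b : P ⟶ Y), IsSPullback a b f g :=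
  exists_isSPullback f g (hC.hasPullbacks f hf g)

lemma exists_terminal : ∃ T : C, ∀ (X : C) (S : SSet.{v}), ∃! _l : S ⟶ Fun X T, True := by
  obtain ⟨c, hc⟩ := exists_isSLimit (Functor.empty C) (hC.hasTerminal.hasConicalLimit _)
  refine ⟨c.pt, fun X S => ?_⟩
  obtain ⟨l, -, -⟩ := hc X S (fun j => j.as.elim) (fun j => j.as.elim)
  exact ⟨l, trivial, fun l' _ => hc.hom_ext (fun j => j.as.elim)⟩

/-- This is the Leibniz axiom for ∅ ⟶ U: any two maps into a cotensor by ∅ agree, so the pullback in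
the axiom reduces to B ^ U. -/
lemma map_mem {U : SSet.{v}} {E B : C} (p : E ⟶ B) (hp : W p) (c : Cotensor U E)
    (d : Cotensor U B) : W (Cotensor.map p c d) := by
  obtain ⟨EN⟩ := hC.hasCotensors Nothing E
  obtain ⟨BN⟩ := hC.hasCotensors Nothing B
  have hE {X : C} (f g : X ⟶ EN.obj) : f = g :=
    EN.isCotensor.hom_ext' (Nothing.hom_ext _ _)
  have hB {X : C} (f g : X ⟶ BN.obj) : f = g :=
    BN.isCotensor.hom_ext' (Nothing.hom_ext _ _)
  obtain ⟨t, -⟩ := EN.isCotensor.exists_hom (Nothing.to (Fun d.obj E))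
  refine hC.leibniz (Nothing.to U) inferInstance p hp c EN d BN t (𝟙 _) ?_ _ (hE _ _)
    (Category.comp_id _)
  exact IsPullback.mk' (hB _ _) (fun T f g _ h => by simpa using h)
    (fun T f g _ => ⟨g, hE _ _, Category.comp_id _⟩)

/-- Isofibrations of an ∞-cosmos induce maps of function complexes with the Leibniz lifting property
along `𝕀`. -/
lemma hasIsoLift (X : C) {E B : C} (p : E ⟶ B) (hp : W p) : HasIsoLift (Fun.post X p) := by
  intro x hx U V i hi a b w h₁ h₂ h₃
  obtain ⟨EV⟩ := hC.hasCotensors V E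
  obtain ⟨EU⟩ := hC.hasCotensors U E
  obtain ⟨BV⟩ := hC.hasCotensors V B
  obtain ⟨BU⟩ := hC.hasCotensors U B
  obtain ⟨P, π₁, π₂, hP⟩ := hC.exists_pullback _ (hC.map_mem p hp EU BU)
    (Cotensor.restrict i BV BU)
  obtain ⟨k, hk₁, hk₂⟩ := hP.isPullback.exists_lift (Cotensor.restrict i EV EU)
    (Cotensor.map p EV BV) (by
      apply BU.isCotensor.hom_ext'
      simp only [Fun.pre_comp, ← Category.assoc, Cotensor.ε_pre_restrict, Cotensor.ε_pre_map]
      simp only [Category.assoc, Cotensor.ε_pre_map, Fun.post_pre]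
      simp only [← Category.assoc, Cotensor.ε_pre_restrict])
  -- A lifting problem for Fun(X, p) against the Leibniz product of i with the endpoint is the
  -- transpose of one for Fun(X, k) against the endpoint alone.
  have hk : W k := hC.leibniz i hi p hp EV EU BV BU π₁ π₂ hP.isPullback k hk₁ hk₂
  have hlift : HasLiftingProperty (endpoint x) (Fun.post X k) := by
    rcases hx with rfl | rfl
    · exact (hC.isofibration_post X k hk).lift_zero
    · exact (hC.isofibration_post X k hk).lift_one
  obtain ⟨f, hf⟩ := EV.isCotensor.exists_hom b
  obtain ⟨a', ha', -⟩ := EU.isCotensor.existsUnique a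
  obtain ⟨w', hw', -⟩ := BV.isCotensor.existsUnique w
  -- The data on 𝕀 ⊗ U and on 𝕀 ⊗ V assemble into one map from 𝕀 to Fun(X, P); f, the transpose of
  -- b, prescribes the lift at x.
  obtain ⟨z, ⟨hz₁, hz₂⟩, -⟩ := hP.existsUnique X _ a' w' (by
    apply BU.isCotensor.hom_ext
    rw [Fun.comp_middle, Fun.comp_middle, Cotensor.ε_pre_map, Cotensor.ε_pre_restrict,
      ← Fun.comp_post, Fun.comp_pre_right, ha', hw', h₂])
  have hx' (S : SSet.{v}) : endpoint x ▷ S = (λ_ S).hom ≫ atVertex x S := by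
    rw [← Iso.inv_comp_eq]
    apply CartesianMonoidalCategory.hom_ext
    · simp [atVertex]
    · simp [atVertex]
  have sq : CommSq (Fun.vertex f) (endpoint x) (Fun.post X k) z := by
    refine ⟨hP.hom_ext ?_ ?_⟩
    · apply EU.isCotensor.hom_ext
      rw [Category.assoc, Category.assoc, hz₁, ← Fun.post_comp, hk₁, Fun.comp_middle,
        Cotensor.ε_pre_restrict, Fun.comp_pre_right, Fun.comp_vertex_left, hf, Fun.comp_pre_left, ha', hx',
        Category.assoc, h₁]
      simp
    · apply BV.isCotensor.hom_ext
      rw [Category.assoc, Category.assoc, hz₂, ← Fun.post_comp, hk₂, Fun.comp_middle,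
        Cotensor.ε_pre_map, ← Fun.comp_post, Fun.comp_vertex_left, hf, Fun.comp_pre_left, hw', hx',
        Category.assoc, Category.assoc, h₃]
  refine ⟨Fun.comp sq.lift EV.ε, ?_, ?_, ?_⟩
  · rw [← Fun.comp_pre_right, ← Cotensor.ε_pre_restrict i EV EU, ← Fun.comp_middle, ← hk₁,
      Fun.post_comp, reassoc_of% sq.fac_right, hz₁, ha']
  · have h := Fun.comp_pre_left (endpoint x) sq.lift EV.ε
    rw [sq.fac_left, Fun.comp_vertex_left, hf, hx', Category.assoc, cancel_epi] at h
    exact h.symm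
  · rw [Fun.comp_post, ← Cotensor.ε_pre_map p EV BV, ← Fun.comp_middle, ← hk₂,
      Fun.post_comp, reassoc_of% sq.fac_right, hz₂, hw']

/-- The absolute case comes from the isofibration Y ⟶ 1, because Fun(X, 1) is a point. -/
lemma isoFibrant (X Y : C) : IsoFibrant (Fun X Y) := by
  obtain ⟨T, hT⟩ := hC.exists_terminal
  obtain ⟨f, -⟩ := Fun.exists_vertex (hT Y (𝟙_ _)).choose
  have ht : IsTerminal T := IsTerminal.ofUniqueHom
    (fun Z => (Fun.exists_vertex (hT Z (𝟙_ _)).choose).choose)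
    (fun Z m => Fun.vertex_injective ((hT Z _).unique trivial trivial))
  intro x hx U V i hi a b w h₁ h₂ h₃
  obtain ⟨l, hl₁, hl₂, -⟩ := hC.hasIsoLift X f (hC.to_terminal ht f) x hx i hi a b
    (hT X _).choose h₁ ((hT X _).unique trivial trivial) ((hT X _).unique trivial trivial)
  exact ⟨l, hl₁, hl₂, toUnit_unique _ _⟩

/-- The pivot of the whole argument: from here on, trivial fibrations are handled by lifting. -/
lemma isTrivialFibration_iff {E B : C} (p : E ⟶ B) :
    IsTrivialFibration W p ↔ W p ∧ ∀ X, TrivKan (Fun.post X p) :=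
  ⟨fun h => ⟨h.1, fun X => trivKan_of_equivalence (hC.hasIsoLift X p h.1) (hC.isoFibrant X E)
    (h.2 X)⟩, fun h => ⟨h.1, fun X => (h.2 X).isQCatEquivalence⟩⟩

end IsInfinityCosmos

end

/-! ### Compatible families over towers and discrete diagrams -/

section

variable {C : Type u} [Category.{v} C] [SimplicialCategory C]

lemma tower_compatible {F : ℕᵒᵖ ⥤ C} {X : C} {T : SSet.{v}}
    (s : ∀ j, T ⟶ Fun X (F.obj j))
    (hs : ∀ n : ℕ, s (op (n + 1)) ≫ Fun.post X (F.map (homOfLE (Nat.le_succ n)).op) = s (op n))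
    ⦃j j' : ℕᵒᵖ⦄ (u : j ⟶ j') : s j ≫ Fun.post X (F.map u) = s j' := by
  let α : (Functor.const ℕᵒᵖ).obj T ⟶ F ⋙ eCoyoneda SSet.{v} X :=
    NatTrans.ofOpSequence (fun n => s (op n)) (fun n => (Category.id_comp _).trans (hs n).symm)
  exact ((α.naturality u).symm.trans (Category.id_comp _))

lemma discrete_compatible {J : Type w} {F : Discrete J ⥤ C} {X : C} {T : SSet.{v}}
    (s : ∀ j, T ⟶ Fun X (F.obj j)) ⦃j j' : Discrete J⦄ (u : j ⟶ j') :
    s j ≫ Fun.post X (F.map u) = s j' := by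
  obtain rfl : j = j' := Discrete.ext (Discrete.eq_of_hom u)
  obtain rfl : u = 𝟙 j := Subsingleton.elim _ _
  rw [F.map_id, Fun.post_id, Category.comp_id]

namespace IsInfinityCosmos

variable {W : MorphismProperty C} (hC : IsInfinityCosmos W)

include hC

/-! ### Equivalences and trivial fibrations -/

lemma isEquivalence_comp {X Y Z : C} {f : X ⟶ Y} {g : Y ⟶ Z} (hf : IsEquivalence f)
    (hg : IsEquivalence g) : IsEquivalence (f ≫ g) := fun A => by
  rw [Fun.post_comp]
  exact .comp (hC.isoFibrant A X) (hC.isoFibrant A Z) (hf A) (hg A)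

lemma isEquivalence_of_comp_right {X Y Z : C} {f : X ⟶ Y} {g : Y ⟶ Z} (hg : IsEquivalence g)
    (hfg : IsEquivalence (f ≫ g)) : IsEquivalence f := fun A => by
  refine .of_comp_right (hC.isoFibrant A Y) (hg A) ?_
  rw [← Fun.post_comp]
  exact hfg A

lemma isEquivalence_of_comp_left {X Y Z : C} {f : X ⟶ Y} {g : Y ⟶ Z} (hf : IsEquivalence f)
    (hfg : IsEquivalence (f ≫ g)) : IsEquivalence g := fun A => by
  refine .of_comp_left (hC.isoFibrant A Y) (hf A) ?_
  rw [← Fun.post_comp]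
  exact hfg A

lemma trivKan_post {E B : C} {p : E ⟶ B} (hp : IsTrivialFibration W p) (X : C) :
    TrivKan (Fun.post X p) :=
  ((hC.isTrivialFibration_iff p).1 hp).2 X

lemma isTrivialFibration_of_isIso {X Y : C} (f : X ⟶ Y) [IsIso f] : IsTrivialFibration W f := by
  rw [hC.isTrivialFibration_iff]
  refine ⟨hC.of_iso f inferInstance, fun A => ?_⟩
  have : IsIso (Fun.post A f) := inferInstanceAs (IsIso ((eCoyoneda SSet.{v} A).map f))
  exact MorphismProperty.of_isIso _ _

lemma isTrivialFibration_comp {X Y Z : C} {f : X ⟶ Y} {g : Y ⟶ Z} (hf : IsTrivialFibration W f)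
    (hg : IsTrivialFibration W g) : IsTrivialFibration W (f ≫ g) :=
  ⟨hC.comp_mem hf.1 hg.1, hC.isEquivalence_comp hf.2 hg.2⟩

lemma isTrivialFibration_of_comp {X Y Z : C} {f : X ⟶ Y} {g : Y ⟶ Z} (hf : W f)
    (hg : IsTrivialFibration W g) (hfg : IsTrivialFibration W (f ≫ g)) :
    IsTrivialFibration W f :=
  ⟨hf, hC.isEquivalence_of_comp_right hg.2 hfg.2⟩

lemma isTrivialFibration_base_change {P X Y Z : C} {a : P ⟶ X} {b : P ⟶ Y} {f : X ⟶ Z} {g : Y ⟶ Z}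
    (h : IsPullback a b f g) (hf : IsTrivialFibration W f) : IsTrivialFibration W b := by
  rw [hC.isTrivialFibration_iff]
  exact ⟨hC.base_change h hf.1,
    fun A => .of_isPullback ((hC.isSPullback hf.1 h).map A) (hC.trivKan_post hf A)⟩

lemma isSLimit_product {J : Type v} {F : Discrete J ⥤ C} {c : Cone F} (hc : IsLimit c) :
    IsSLimit c :=
  isSLimit_of_isLimit ((hC.hasProducts.hasConicalLimitsOfShape J).hasConicalLimit F) hc

/-- Lifts are chosen componentwise. -/
lemma isTrivialFibration_product {J : Type v} {F G : Discrete J ⥤ C} {c : Cone F} {d : Cone G}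
    (hc : IsLimit c) (hd : IsLimit d) (f : F ⟶ G) (hf : ∀ j, IsTrivialFibration W (f.app j))
    (φ : c.pt ⟶ d.pt) (hφ : ∀ j, φ ≫ d.π.app j = c.π.app j ≫ f.app j) :
    IsTrivialFibration W φ := by
  rw [hC.isTrivialFibration_iff]
  refine ⟨(hC.product_stable J).condition F G c d hc hd f (fun j => (hf j).1) φ hφ, fun A => ?_⟩
  refine TrivKan.of_lift fun {U V} i hi a b w => ?_
  have h j := (hC.trivKan_post (hf j) A).lift i hi (a ≫ Fun.post A (c.π.app j))
    (b ≫ Fun.post A (d.π.app j)) (by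
      rw [Category.assoc, ← Fun.post_comp, ← hφ, Fun.post_comp, reassoc_of% w])
  choose l hl₁ hl₂ using h
  obtain ⟨m, hm, -⟩ := hC.isSLimit_product hc A V l (discrete_compatible l)
  refine ⟨m, (hC.isSLimit_product hc).hom_ext fun j => ?_,
    (hC.isSLimit_product hd).hom_ext fun j => ?_⟩
  · rw [Category.assoc, hm, hl₁]
  · rw [Category.assoc, ← Fun.post_comp, hφ, Fun.post_comp, ← Category.assoc, hm, hl₂]

lemma isTrivialFibration_tower {F : ℕᵒᵖ ⥤ C} (hF : IsTower (trivialFibrations W) F) {c : Cone F}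
    (hc : IsLimit c) : IsTrivialFibration W (c.π.app (op 0)) := by
  have hF' : IsTower W F := fun n => (hF n).1
  rw [hC.isTrivialFibration_iff]
  refine ⟨hC.tower_stable F hF' c hc 0, fun A => ?_⟩
  have hc' : IsSLimit c := isSLimit_of_isLimit (hC.hasTowerLimits F hF') hc
  refine TrivKan.of_lift fun {U V} i hi a b w => ?_
  -- Each bonding map lifts a partial solution one stage up while keeping the prescribed restriction
  -- to U. The recursion starts with b at stage 0.
  have step (n : ℕ) (l : {l : V ⟶ Fun A (F.obj (op n)) // i ≫ l = a ≫ Fun.post A (c.π.app (op n))}) :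
      ∃ l' : {l : V ⟶ Fun A (F.obj (op (n + 1))) //
        i ≫ l = a ≫ Fun.post A (c.π.app (op (n + 1)))},
        l'.1 ≫ Fun.post A (F.map (homOfLE (Nat.le_succ n)).op) = l.1 := by
    obtain ⟨m, hm₁, hm₂⟩ := (hC.trivKan_post (hF n) A).lift i hi
      (a ≫ Fun.post A (c.π.app (op (n + 1)))) l.1 (by
        rw [Category.assoc, ← Fun.post_comp, c.w, l.2])
    exact ⟨⟨m, hm₁⟩, hm₂⟩
  choose next hnext using step
  let l (n : ℕ) : {l : V ⟶ Fun A (F.obj (op n)) // i ≫ l = a ≫ Fun.post A (c.π.app (op n))} :=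
    Nat.rec ⟨b, w.symm⟩ next n
  obtain ⟨m, hm, -⟩ := hc' A V (fun j => (l j.unop).1) (tower_compatible _ fun n => hnext n (l n))
  exact ⟨m, hc'.hom_ext fun j => by rw [Category.assoc, hm, (l j.unop).2], hm (op 0)⟩

/-- By transposition, lifting Fun(A, p ^ U) against i means lifting Fun(A, p) against i ▷ U, which
is again a monomorphism. -/
lemma isTrivialFibration_map {U : SSet.{v}} {E B : C} (p : E ⟶ B) (hp : IsTrivialFibration W p)
    (c : Cotensor U E) (d : Cotensor U B) : IsTrivialFibration W (Cotensor.map p c d) := by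
  rw [hC.isTrivialFibration_iff]
  refine ⟨hC.map_mem p hp.1 c d, fun A => TrivKan.of_lift fun {S T} i hi a b w => ?_⟩
  have hi' : Mono (i ▷ U) := ⟨fun f g h => by
    apply CartesianMonoidalCategory.hom_ext
    · rw [← cancel_mono i]
      simpa using congrArg (· ≫ fst _ _) h
    · simpa using congrArg (· ≫ snd _ _) h⟩
  obtain ⟨m, hm₁, hm₂⟩ := (hC.trivKan_post hp A).lift (i ▷ U) hi' (Fun.comp a c.ε)
    (Fun.comp b d.ε) (by
      rw [Fun.comp_post, ← Cotensor.ε_pre_map p c d, ← Fun.comp_middle, w, ← tensorHom_id,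
        Fun.precomp_comp, Category.id_comp])
  obtain ⟨l, rfl, -⟩ := c.isCotensor.existsUnique m
  refine ⟨l, c.isCotensor.hom_ext ?_, d.isCotensor.hom_ext ?_⟩
  · rw [← hm₁, ← tensorHom_id, Fun.precomp_comp, Category.id_comp]
  · rw [Fun.comp_middle, Cotensor.ε_pre_map, ← Fun.comp_post, hm₂]

end IsInfinityCosmos

/-! ### Full subcategories closed under limits -/

section

variable {W : MorphismProperty C} {P : ObjectProperty C}

lemma CreatesConicalLimit.isSPullback {E B A Q : P.FullSubcategory} {p : E ⟶ B} {f : A ⟶ B}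
    (h : CreatesConicalLimit P (cospan p f)) {a : Q ⟶ E} {b : Q ⟶ A} (hQ : IsPullback a b p f) :
    IsSPullback (P.ι.map a) (P.ι.map b) (P.ι.map p) (P.ι.map f) :=
  (isSLimit_iff_isSPullback _).1 (h.isSLimit hQ.isLimit)

lemma CreatesCotensor.isCotensor {U : SSet.{v}} {A Q : P.FullSubcategory}
    (h : CreatesCotensor P U A) {ε : U ⟶ Fun Q A} (hε : IsCotensor ε) :
    IsCotensor (C := C) (A := A.obj) (P := Q.obj) ε := by
  obtain ⟨c⟩ := h.exists_cotensor
  exact hε.of_full_of_exists c.isCotensor (h.closed _ c.isCotensor)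

lemma IsSLimit.isTerminal {F : Discrete PEmpty.{1} ⥤ C} {c : Cone F} (hc : IsSLimit c) :
    Nonempty (IsTerminal c.pt) := by
  have h (X : C) := hc.hom X (fun j => j.as.elim) (fun j => j.as.elim)
  choose l hl hu using h
  exact ⟨IsTerminal.ofUniqueHom l (fun X m => hu X m (fun j => j.as.elim))⟩

/-- A full simplicial subcategory of an ∞-cosmos is an ∞-cosmos if its inclusion creates the limits
in the axioms. -/
theorem IsInfinityCosmos.fullSubcategory (hC : IsInfinityCosmos W)
    (hl : CreatesCosmologicalLimits P W) :
    IsInfinityCosmos (C := P.FullSubcategory) (W.inverseImage P.ι) where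
  quasicategory X Y := hC.quasicategory X.obj Y.obj
  isMultiplicative := by
    have := hC.isMultiplicative
    infer_instance
  hasTerminal := ⟨fun F => (hl.terminal F).hasConicalLimit⟩
  hasProducts := ⟨fun J => ⟨fun F => (hl.products J F).hasConicalLimit⟩⟩
  hasCotensors U A := by
    obtain ⟨c⟩ := (hl.cotensors U A).exists_cotensor
    exact ⟨⟨⟨c.obj, (hl.cotensors U A).closed _ c.isCotensor⟩, c.ε,
      (hl.cotensors U A).isCotensor_of_ambient _ _ c.isCotensor⟩⟩
  hasTowerLimits F hF := (hl.towers F hF).hasConicalLimit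
  hasPullbacks p hp f := (hl.pullbacks p hp f).hasConicalLimit
  of_iso f hf := hC.of_iso (P.ι.map f) inferInstance
  to_terminal {A T} hT f := by
    obtain ⟨h⟩ := ((hl.terminal (Functor.empty _)).isSLimit hT).isTerminal
    exact hC.to_terminal h (P.ι.map f)
  pullback_stable :=
    { of_isPullback := fun sq hg =>
        hC.base_change ((hl.pullbacks _ hg _).isSPullback sq).isPullback hg }
  product_stable J :=
    { condition := fun F G c d hc hd f hf φ hφ => by
        obtain ⟨hc'⟩ := ((hl.products J F).isSLimit hc).nonempty_isLimit
        obtain ⟨hd'⟩ := ((hl.products J G).isSLimit hd).nonempty_isLimit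
        exact (hC.product_stable J).condition _ _ _ _ hc' hd' (Functor.whiskerRight f P.ι) hf
          (P.ι.map φ) (fun j => P.ι.congr_map (hφ j)) }
  tower_stable F hF c hc n := by
    obtain ⟨hc'⟩ := ((hl.towers F hF).isSLimit hc).nonempty_isLimit
    exact hC.tower_stable (F ⋙ P.ι) hF _ hc' n
  -- The cotensors and the pullback of the subcategory are ambient ones, so the Leibniz map is
  -- itself an ambient Leibniz map.
  leibniz {U V} i hi {E B} p hp EV EU BV BU {Q} π₁ π₂ hQ k hk₁ hk₂ := by
    have hEV := (hl.cotensors V E).isCotensor EV.isCotensor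
    have hEU := (hl.cotensors U E).isCotensor EU.isCotensor
    have hBV := (hl.cotensors V B).isCotensor BV.isCotensor
    have hBU := (hl.cotensors U B).isCotensor BU.isCotensor
    have h₁ := Cotensor.toAmbient_map p EU BU hEU hBU
    have h₂ := Cotensor.toAmbient_map p EV BV hEV hBV
    have h₃ := Cotensor.toAmbient_restrict i BV BU hBV hBU
    have h₄ := Cotensor.toAmbient_restrict i EV EU hEV hEU
    have hW : W (P.ι.map (Cotensor.map p EU BU)) := by
      rw [h₁]
      exact hC.map_mem _ hp _ _
    have hQ' := ((hl.pullbacks _ hW _).isSPullback hQ).isPullback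
    rw [h₁, h₃] at hQ'
    refine hC.leibniz i hi (P.ι.map p) hp (EV.toAmbient hEV) (EU.toAmbient hEU)
      (BV.toAmbient hBV) (BU.toAmbient hBU) _ _ hQ' (P.ι.map k) ?_ ?_
    · exact (P.ι.map_comp k π₁).symm.trans ((congrArg _ hk₁).trans h₄)
    · exact (P.ι.map_comp k π₂).symm.trans ((congrArg _ hk₂).trans h₂)
  isofibration_post X {E B} p hp := hC.isofibration_post X.obj (P.ι.map p) hp

/-- The inclusion of a full simplicial subcategory that is closed under the limits in the axioms of
an ∞-cosmos creates these limits. -/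
theorem IsInfinityCosmos.createsCosmologicalLimits (hC : IsInfinityCosmos W)
    (terminal : ∀ T : C, IsTerminal T → P T)
    (products : ∀ (J : Type v) (F : Discrete J ⥤ C) (c : Cone F), IsLimit c →
      (∀ j, P (F.obj j)) → P c.pt)
    (cotensors : ∀ {U : SSet.{v}} {A Q : C} (ε : U ⟶ Fun Q A), IsCotensor ε → P A → P Q)
    (towers : ∀ (F : ℕᵒᵖ ⥤ C) (c : Cone F), IsLimit c → IsTower W F → (∀ j, P (F.obj j)) → P c.pt)
    (pullbacks : ∀ {Q E B A : C} (a : Q ⟶ E) (b : Q ⟶ A) (p : E ⟶ B) (f : A ⟶ B),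
      IsPullback a b p f → W p → P E → P B → P A → P Q) :
    CreatesCosmologicalLimits P W where
  terminal F := createsConicalLimit (hC.hasTerminal.hasConicalLimit _)
    (fun t ht => terminal _ ht.isTerminal.some)
  products J F := createsConicalLimit
    ((hC.hasProducts.hasConicalLimitsOfShape J).hasConicalLimit _)
    (fun t ht => products J _ t ht.nonempty_isLimit.some (fun j => (F.obj j).property))
  cotensors U A :=
    { exists_cotensor := hC.hasCotensors U A.obj
      closed := fun ε hε => cotensors ε hε A.property
      isCotensor_of_ambient := fun Q ε hε => hε.of_full }
  towers F hF := createsConicalLimit (hC.hasTowerLimits _ hF)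
    (fun t ht => towers _ t ht.nonempty_isLimit.some hF (fun j => (F.obj j).property))
  pullbacks p hp f := by
    refine createsConicalLimit ?_ ?_
    · have := hC.hasPullbacks (P.ι.map p) hp (P.ι.map f)
      exact HasConicalLimit.of_iso _ (cospanCompIso P.ι p f).symm
    · intro t ht
      rw [isSLimit_iff_isSPullback] at ht
      exact pullbacks _ _ _ _ ht.isPullback hp (ObjectProperty.FullSubcategory.property _)
        (ObjectProperty.FullSubcategory.property _) (ObjectProperty.FullSubcategory.property _)

end

end

/-! ### Function complexes of slices -/

section

variable {C : Type u} [Category.{v} C] [SimplicialCategory C]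

/-- The constant generalized element of a function complex. -/
abbrev Fun.const (S : SSet.{v}) {X Y : C} (f : X ⟶ Y) : S ⟶ Fun X Y := toUnit S ≫ Fun.vertex f

lemma Fun.const_post (S : SSet.{v}) {X Y Z : C} (f : X ⟶ Y) (g : Y ⟶ Z) :
    Fun.const S f ≫ Fun.post X g = Fun.const S (f ≫ g) := by
  rw [Fun.const, Category.assoc, Fun.vertex_post]

lemma Fun.const_pre (S : SSet.{v}) {X Y Z : C} (f : X ⟶ Y) (g : Y ⟶ Z) :
    Fun.const S g ≫ Fun.pre f Z = Fun.const S (f ≫ g) := by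
  rw [Fun.const, Category.assoc, Fun.vertex_pre]

lemma Fun.comp_const (S T : SSet.{v}) {X Y Z : C} (f : X ⟶ Y) (g : Y ⟶ Z) :
    Fun.comp (Fun.const S f) (Fun.const T g) = Fun.const (S ⊗ T) (f ≫ g) := by
  rw [Fun.const, Fun.comp_pre_left, Fun.comp_vertex_left, Category.assoc, Fun.vertex_pre]
  simp only [← Category.assoc]
  congr 1

section Over

variable {A : C}

/-- The forgetful map from function complexes of the slice. -/
def overProj (p q : Over A) : Fun p q ⟶ Fun p.left q.left := overFun.fst p q

lemma overProj_condition (p q : Over A) :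
    overProj p q ≫ Fun.post p.left q.hom = Fun.const _ p.hom := overFun.condition p q

lemma overProj_hom_ext {p q : Over A} {T : SSet.{v}} {f g : T ⟶ Fun p q}
    (h : f ≫ overProj p q = g ≫ overProj p q) : f = g := overFun.hom_ext h

lemma overProj_lift {p q : Over A} {T : SSet.{v}} (f : T ⟶ Fun p.left q.left)
    (hf : f ≫ Fun.post p.left q.hom = Fun.const T p.hom) :
    ∃ l : T ⟶ Fun p q, l ≫ overProj p q = f :=
  ⟨overFun.lift f hf, overFun.lift_fst f hf⟩

lemma overProj_elem {p q : Over A} {T : SSet.{v}} (f : T ⟶ Fun p q) :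
    (f ≫ overProj p q) ≫ Fun.post p.left q.hom = Fun.const T p.hom := by
  rw [Category.assoc, overProj_condition, ← Category.assoc]
  congr 1

lemma vertex_overProj {p q : Over A} (f : p ⟶ q) :
    Fun.vertex f ≫ overProj p q = Fun.vertex f.left := overFun.vertex_fst f

lemma comp_overProj {p q r : Over A} {S T : SSet.{v}} (a : S ⟶ Fun p q) (b : T ⟶ Fun q r) :
    Fun.comp a b ≫ overProj p r = Fun.comp (a ≫ overProj p q) (b ≫ overProj q r) := by
  have h := overFun.comp_fst p q r
  have h' : Fun.comp a b = (a ⊗ₘ b) ≫ overFun.comp p q r := rfl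
  rw [← Fun.precomp_comp, h']
  exact (Category.assoc _ _ _).trans (congrArg _ h)

lemma post_overProj (X : Over A) {p q : Over A} (f : p ⟶ q) :
    Fun.post X f ≫ overProj X q = overProj X p ≫ Fun.post X.left f.left := by
  rw [← Category.id_comp (Fun.post X f), ← Fun.comp_vertex, Category.assoc, comp_overProj,
    vertex_overProj, Category.id_comp, Fun.comp_vertex]

lemma pre_overProj {X p : Over A} (f : X ⟶ p) (q : Over A) :
    Fun.pre f q ≫ overProj X q = overProj p q ≫ Fun.pre f.left q.left := by
  rw [← Category.id_comp (Fun.pre f q), ← Fun.vertex_comp, Category.assoc, comp_overProj,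
    vertex_overProj, Category.id_comp, Fun.vertex_comp]

/-- The function complexes of a slice are fibres of maps of function complexes. -/
lemma isPullback_overProj (p q : Over A) :
    IsPullback (overProj p q) (toUnit _) (Fun.post p.left q.hom) (Fun.vertex p.hom) :=
  IsPullback.mk' (overProj_condition p q) (fun T f g h _ => overProj_hom_ext h)
    (fun T f g h => by
      obtain ⟨l, hl⟩ := overProj_lift f (h.trans (by rw [toUnit_unique g (toUnit _)]))
      exact ⟨l, hl, toUnit_unique _ _⟩)

/-- Postcomposition in a slice is a base change of postcomposition. -/
lemma isPullback_post_over (X : Over A) {p q : Over A} (f : p ⟶ q) :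
    IsPullback (overProj X p) (Fun.post X f) (Fun.post X.left f.left) (overProj X q) :=
  IsPullback.mk' (post_overProj X f).symm (fun T a b h _ => overProj_hom_ext h)
    (fun T a b h => by
      obtain ⟨l, hl⟩ := overProj_lift (p := X) (q := p) a (by
        rw [← Over.w f, Fun.post_comp, reassoc_of% h, overProj_condition, ← Category.assoc]
        congr 1)
      refine ⟨l, hl, overProj_hom_ext ?_⟩
      rw [Category.assoc, post_overProj, reassoc_of% hl, h])

/-! ### Limits in slices -/

section

variable {J : Type w} [Category J] {F : J ⥤ Over A} {L L' : C} {π : ∀ j, L ⟶ (F.obj j).left}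
  {π' : J → (L' ⟶ A)} {m : L ⟶ L'} {δ : A ⟶ L'}

/-- The cone over a diagram in a slice with a given family of legs. -/
def overCone (Q : Over A) (a : ∀ j, Q.left ⟶ (F.obj j).left) (h : ∀ j, a j ≫ (F.obj j).hom = Q.hom)
    (h' : ∀ ⦃j j'⦄ (u : j ⟶ j'), a j ≫ (F.map u).left = a j') : Cone F where
  pt := Q
  π :=
    { app := fun j => Over.homMk (a j) (h j)
      naturality := fun j j' u => by
        ext
        exact (Category.id_comp _).trans (h' u).symm }

/-- The limit of a diagram in a slice is a pullback of the limit of the underlying diagram along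
a diagonal. -/
lemma isSLimit_over (hπ : IsFamLimit (fun j => (F.obj j).left) (fun u => (F.map u).left) π)
    (hπ' : IsFamLimit (fun _ : J => A) (fun _ => 𝟙 A) π')
    (hm : ∀ j, m ≫ π' j = π j ≫ (F.obj j).hom) (hδ : ∀ j, δ ≫ π' j = 𝟙 A)
    {t : Cone F} (a : t.pt.left ⟶ L) (ha : ∀ j, a ≫ π j = (t.π.app j).left)
    (hP : IsSPullback a t.pt.hom m δ) : IsSLimit t := by
  intro X T s hs
  obtain ⟨l, hl, -⟩ := hπ.2 X.left T (fun j => s j ≫ overProj X (F.obj j)) (fun j j' u => by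
    rw [← hs u, Category.assoc, Category.assoc, post_overProj])
  -- All components of s lie over the same map X.hom, so their combination becomes diagonal in the
  -- limit of the constant diagram.
  obtain ⟨z, ⟨hz₁, hz₂⟩, -⟩ := hP.existsUnique X.left T l (Fun.const T X.hom) (by
    refine hπ'.hom_ext fun j => ?_
    rw [Fun.const_post, Fun.const_post, Category.assoc, Category.assoc, hδ, ← Fun.post_comp, hm,
      Fun.post_comp, ← Category.assoc, hl, overProj_elem, Category.comp_id])
  obtain ⟨y, hy⟩ := overProj_lift (p := X) (q := t.pt) z hz₂
  refine ⟨y, fun j => overProj_hom_ext ?_, fun y' hy' => overProj_hom_ext ?_⟩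
  · rw [Category.assoc, post_overProj, ← ha, Fun.post_comp, reassoc_of% hy, reassoc_of% hz₁, hl]
  · refine hP.hom_ext ?_ ?_
    · refine hπ.hom_ext fun j => ?_
      rw [hy, hz₁, hl, ← hy' j, Category.assoc, Category.assoc, Category.assoc, post_overProj,
        ← Fun.post_comp, ha]
    · rw [hy, hz₂, overProj_elem]

lemma exists_isSLimit_over
    (hπ : IsFamLimit (fun j => (F.obj j).left) (fun u => (F.map u).left) π)
    (hπ' : IsFamLimit (fun _ : J => A) (fun _ => 𝟙 A) π')
    (hm : ∀ j, m ≫ π' j = π j ≫ (F.obj j).hom) (hδ : ∀ j, δ ≫ π' j = 𝟙 A)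
    {Q : Over A} (a : Q.left ⟶ L) (hP : IsSPullback a Q.hom m δ) :
    ∃ t : Cone F, t.pt = Q ∧ IsSLimit t :=
  ⟨overCone Q (fun j => a ≫ π j)
    (fun j => by rw [Category.assoc, ← hm, reassoc_of% hP.w, hδ, Category.comp_id])
    (fun j j' u => by rw [Category.assoc, hπ.1]), rfl,
    isSLimit_over hπ hπ' hm hδ a (fun j => rfl) hP⟩

/-- A map T ⟶ t.pt.left becomes a map of the slice once T is given its composite to A; the slice
limit therefore classifies compatible pairs of maps to L and to A. -/
lemma isPullback_of_isLimit_over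
    (hπ : IsFamLimit (fun j => (F.obj j).left) (fun u => (F.map u).left) π)
    (hπ' : IsFamLimit (fun _ : J => A) (fun _ => 𝟙 A) π')
    (hm : ∀ j, m ≫ π' j = π j ≫ (F.obj j).hom) (hδ : ∀ j, δ ≫ π' j = 𝟙 A)
    {t : Cone F} (ht : IsLimit t) (a : t.pt.left ⟶ L) (ha : ∀ j, a ≫ π j = (t.π.app j).left) :
    IsPullback a t.pt.hom m δ := by
  refine IsPullback.mk' ?_ (fun T f g h₁ h₂ => ?_) (fun T f g h => ?_)
  · refine hπ'.hom_ext' fun j => ?_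
    rw [Category.assoc, Category.assoc, hm, hδ, reassoc_of% ha, Over.w, Category.comp_id]
    rfl
  · have key : (Over.homMk f rfl : Over.mk (f ≫ t.pt.hom) ⟶ t.pt) = Over.homMk g h₂.symm := by
      refine ht.hom_ext fun j => ?_
      ext
      refine (congrArg (f ≫ ·) (ha j).symm).trans (.trans ?_ (congrArg (g ≫ ·) (ha j)))
      rw [reassoc_of% h₁]
    exact congrArg CommaMorphism.left key
  · let s : Cone F := overCone (Over.mk g) (fun j => f ≫ π j)
      (fun j => by
        rw [Category.assoc, ← hm, reassoc_of% h, hδ, Category.comp_id]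
        rfl)
      (fun j j' u => by rw [Category.assoc, hπ.1])
    refine ⟨(ht.lift s).left, hπ.hom_ext' fun j => ?_, Over.w (ht.lift s)⟩
    refine (Category.assoc _ _ _).trans ((congrArg ((ht.lift s).left ≫ ·) (ha j)).trans ?_)
    exact congrArg CommaMorphism.left (ht.fac s j)

end

/-- A compatible family over a connected category with identity transition maps is constant. The
diagonal is then an identity, and connected limits in a slice need no pullback. -/
lemma isFamLimit_const (J : Type w) [Category J] [IsConnected J] (A : C) :
    IsFamLimit (fun _ : J => A) (fun _ => 𝟙 A) (fun _ => 𝟙 A) := by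
  refine ⟨fun _ _ _ => Category.comp_id _, fun X T s hs => ?_⟩
  obtain ⟨j₀⟩ := (inferInstance : Nonempty J)
  simp only [Fun.post_id, Category.comp_id] at hs ⊢
  exact ⟨s j₀, fun j => constant_of_preserves_morphisms s (fun j j' u => hs u) j₀ j,
    fun y hy => hy j₀⟩

lemma IsSPullback.of_id {X Y : C} (f : X ⟶ Y) : IsSPullback (𝟙 X) f f (𝟙 Y) :=
  ⟨by simp, fun A T s t h => by
    refine ⟨s, ⟨?_, ?_⟩, fun y hy => ?_⟩
    · rw [Fun.post_id, Category.comp_id]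
    · rw [h, Fun.post_id, Category.comp_id]
    · rw [← hy.1, Fun.post_id, Category.comp_id]⟩

/-- Connected limits in slices are created by the forgetful functor. -/
lemma exists_isSLimit_over_of_isConnected {J : Type w} [Category J] [IsConnected J]
    {F : J ⥤ Over A} {L : C} {π : ∀ j, L ⟶ (F.obj j).left}
    (hπ : IsFamLimit (fun j => (F.obj j).left) (fun u => (F.map u).left) π) (j₀ : J) :
    ∃ t : Cone F, t.pt = Over.mk (π j₀ ≫ (F.obj j₀).hom) ∧ IsSLimit t := by
  have h (j : J) : π j₀ ≫ (F.obj j₀).hom = π j ≫ (F.obj j).hom :=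
    constant_of_preserves_morphisms (fun j => π j ≫ (F.obj j).hom)
      (fun j j' u => by rw [← hπ.1 u, Category.assoc, Over.w]) j₀ j
  exact exists_isSLimit_over hπ (isFamLimit_const J A) (m := π j₀ ≫ (F.obj j₀).hom) (δ := 𝟙 A)
    (fun j => (Category.comp_id _).trans (h j)) (fun j => Category.comp_id _)
    (Q := Over.mk (π j₀ ≫ (F.obj j₀).hom)) (𝟙 L) (IsSPullback.of_id _)

/-! ### Cotensors in slices -/

section

variable {U V : SSet.{v}} {q : Over A}

/-- The diagonal of a cotensor. -/
lemma exists_diagonal (c : Cotensor U A) : ∃ δ : A ⟶ c.obj,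
    c.ε ≫ Fun.pre δ A = Fun.const U (𝟙 A) :=
  c.isCotensor.exists_hom _

/-- A map into q.left ^ U comes from the slice when its image in A ^ U is the diagonal of X.hom,
which is what the pullback along δ imposes. -/
lemma exists_isCotensor_over (cE : Cotensor U q.left) (cA : Cotensor U A) {δ : A ⟶ cA.obj}
    (hδ : cA.ε ≫ Fun.pre δ A = Fun.const U (𝟙 A)) {Q : Over A} {a : Q.left ⟶ cE.obj}
    (hP : IsSPullback a Q.hom (Cotensor.map q.hom cE cA) δ) :
    ∃ ε : U ⟶ Fun Q q, IsCotensor ε := by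
  obtain ⟨ε, hε⟩ := overProj_lift (p := Q) (q := q) (cE.ε ≫ Fun.pre a q.left) (by
    refine Eq.trans ?_ ((Fun.const_pre U Q.hom (𝟙 A)).trans (congrArg _ (Category.comp_id _)))
    rw [← hδ, Category.assoc, Category.assoc, ← Fun.pre_comp, ← hP.w, Fun.pre_comp,
      ← Category.assoc cA.ε, Cotensor.ε_pre_map, Category.assoc, Fun.post_pre])
  refine ⟨ε, (isCotensor_iff ε).2 fun X T s => ?_⟩
  obtain ⟨l, hl, -⟩ := cE.isCotensor.existsUnique (s ≫ overProj X q)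
  obtain ⟨z, ⟨hz₁, hz₂⟩, -⟩ := hP.existsUnique X.left T l (Fun.const T X.hom) (by
    apply cA.isCotensor.hom_ext
    rw [Fun.comp_middle, Fun.comp_middle, Cotensor.ε_pre_map, hδ, ← Fun.comp_post, hl,
      overProj_elem, Fun.comp_const, Category.comp_id])
  obtain ⟨y, hy⟩ := overProj_lift (p := X) (q := Q) z hz₂
  have hcomp (y : T ⟶ Fun X (Q)) : Fun.comp y ε ≫ overProj X q =
      Fun.comp ((y ≫ overProj X (Q)) ≫ Fun.post X.left a) cE.ε := by
    rw [comp_overProj, hε]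
    exact (Fun.comp_middle _ _ _).symm
  refine ⟨y, overProj_hom_ext ?_, fun y' hy' => overProj_hom_ext (hP.hom_ext ?_ ?_)⟩
  · rw [hcomp, hy, hz₁, hl]
  · apply cE.isCotensor.hom_ext
    rw [← hcomp, ← hcomp]
    refine (congrArg (· ≫ overProj X q) hy').trans ?_
    rw [hcomp, hy, hz₁, hl]
  · rw [hy]
    exact (overProj_elem y').trans hz₂.symm

/-- The comparison from a cotensor in a slice to the cotensor of the underlying object. -/
def Cotensor.toBase (c : Cotensor U q) (cE : Cotensor U q.left) : c.obj.left ⟶ cE.obj :=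
  (cE.homEquiv _).symm (c.ε ≫ overProj _ _)

lemma Cotensor.ε_pre_toBase (c : Cotensor U q) (cE : Cotensor U q.left) :
    cE.ε ≫ Fun.pre (c.toBase cE) q.left = c.ε ≫ overProj _ _ := by
  rw [← Cotensor.homEquiv_apply, Cotensor.toBase, Equiv.apply_symm_apply]

/-- The cotensor in a slice is the pullback of the cotensor along the diagonal. -/
lemma Cotensor.isPullback_toBase (c : Cotensor U q) (cE : Cotensor U q.left) (cA : Cotensor U A)
    {δ : A ⟶ cA.obj} (hδ : cA.ε ≫ Fun.pre δ A = Fun.const U (𝟙 A)) :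
    IsPullback (c.toBase cE) c.obj.hom (Cotensor.map q.hom cE cA) δ := by
  refine IsPullback.mk' ?_ (fun T f g h₁ h₂ => ?_) (fun T f g h => ?_)
  · apply cA.isCotensor.hom_ext'
    rw [Fun.pre_comp, Fun.pre_comp, ← Category.assoc, ← Category.assoc, Cotensor.ε_pre_map, hδ,
      Category.assoc, Fun.post_pre, ← Category.assoc, Cotensor.ε_pre_toBase, overProj_elem,
      Fun.const_pre, Category.comp_id]
  · have key : (Over.homMk f rfl : Over.mk (f ≫ c.obj.hom) ⟶ c.obj) = Over.homMk g h₂.symm := by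
      apply c.isCotensor.hom_ext'
      apply overProj_hom_ext
      rw [Category.assoc, Category.assoc, pre_overProj, pre_overProj, ← Category.assoc,
        ← Category.assoc, ← Cotensor.ε_pre_toBase c cE, Category.assoc, Category.assoc,
        ← Fun.pre_comp, ← Fun.pre_comp]
      exact congrArg (fun k => cE.ε ≫ Fun.pre k q.left) h₁
    exact congrArg CommaMorphism.left key
  · obtain ⟨s, hs⟩ := overProj_lift (p := Over.mk g) (q := q) (cE.ε ≫ Fun.pre f q.left) (by
      refine Eq.trans ?_ ((Fun.const_pre U g (𝟙 A)).trans (congrArg _ (Category.comp_id g)))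
      rw [← hδ, Category.assoc, Category.assoc, ← Fun.pre_comp, ← h, Fun.pre_comp,
        ← Category.assoc cA.ε, Cotensor.ε_pre_map, Category.assoc, Fun.post_pre]
      rfl)
    obtain ⟨l, hl⟩ := c.isCotensor.exists_hom s
    refine ⟨l.left, cE.isCotensor.hom_ext' ?_, Over.w l⟩
    rw [Fun.pre_comp, ← Category.assoc, Cotensor.ε_pre_toBase, Category.assoc, ← pre_overProj,
      ← Category.assoc, hl, hs]

end

end Over

end

/-! ### Comparison of cotensors, and the ∞-cosmos structure of slices -/

section

variable {C : Type u} [Category.{v} C] [SimplicialCategory C]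

section

variable {U V : SSet.{v}} {X Y Z : C}

@[simp]
lemma Cotensor.restrict_map (i : U ⟶ V) (p : X ⟶ Y) (XV : Cotensor V X) (XU : Cotensor U X)
    (YV : Cotensor V Y) (YU : Cotensor U Y) :
    Cotensor.restrict i XV XU ≫ Cotensor.map p XU YU =
      Cotensor.map p XV YV ≫ Cotensor.restrict i YV YU := by
  apply YU.isCotensor.hom_ext'
  rw [Fun.pre_comp, Fun.pre_comp, ← Category.assoc, ← Category.assoc, Cotensor.ε_pre_map,
    Cotensor.ε_pre_restrict, Category.assoc, Category.assoc, Cotensor.ε_pre_map, Fun.post_pre,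
    ← Category.assoc, Cotensor.ε_pre_restrict, Category.assoc]

lemma Cotensor.map_comp (p : X ⟶ Y) (q : Y ⟶ Z) (XU : Cotensor U X) (YU : Cotensor U Y)
    (ZU : Cotensor U Z) :
    Cotensor.map p XU YU ≫ Cotensor.map q YU ZU = Cotensor.map (p ≫ q) XU ZU := by
  apply ZU.isCotensor.hom_ext'
  rw [Fun.pre_comp, ← Category.assoc, Cotensor.ε_pre_map, Category.assoc, Fun.post_pre,
    ← Category.assoc, Cotensor.ε_pre_map, Cotensor.ε_pre_map, Fun.post_comp, Category.assoc]

/-- Lifting against a map of simplicial sets is inherited by base changes. -/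
lemma IsQCatIsofibration.of_isPullback {P X Y Z : SSet.{v}} {a : P ⟶ X} {b : P ⟶ Y} {f : X ⟶ Z}
    {g : Y ⟶ Z} (h : IsPullback a b f g) (hf : IsQCatIsofibration f) : IsQCatIsofibration b where
  inner := ⟨MorphismProperty.of_isPullback h hf.inner.mem⟩
  lift_zero := by
    have := hf.lift_zero
    exact h.hasLiftingProperty _
  lift_one := by
    have := hf.lift_one
    exact h.hasLiftingProperty _

lemma IsQCatIsofibration.comp {X Y Z : SSet.{v}} {f : X ⟶ Y} {g : Y ⟶ Z}
    (hf : IsQCatIsofibration f) (hg : IsQCatIsofibration g) : IsQCatIsofibration (f ≫ g) where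
  inner := ⟨MorphismProperty.comp_mem _ _ _ hf.inner.mem hg.inner.mem⟩
  lift_zero := by
    have := hf.lift_zero
    have := hg.lift_zero
    infer_instance
  lift_one := by
    have := hf.lift_one
    have := hg.lift_one
    infer_instance

end

section Slice

variable {A : C} {U V : SSet.{v}}

lemma Cotensor.toBase_map {p q : Over A} (f : p ⟶ q) (c : Cotensor U p) (d : Cotensor U q)
    (cp : Cotensor U p.left) (dq : Cotensor U q.left) :
    c.toBase cp ≫ Cotensor.map f.left cp dq = (Cotensor.map f c d).left ≫ d.toBase dq := by
  apply dq.isCotensor.hom_ext'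
  rw [Fun.pre_comp, Fun.pre_comp, ← Category.assoc, ← Category.assoc, Cotensor.ε_pre_map,
    Cotensor.ε_pre_toBase, Category.assoc, Category.assoc, Fun.post_pre, ← pre_overProj,
    ← Category.assoc, ← Category.assoc, Cotensor.ε_pre_toBase, Cotensor.ε_pre_map, Category.assoc,
    Category.assoc, post_overProj]

lemma Cotensor.toBase_restrict {p : Over A} (i : U ⟶ V) (c : Cotensor V p) (d : Cotensor U p)
    (cp : Cotensor V p.left) (dp : Cotensor U p.left) :
    c.toBase cp ≫ Cotensor.restrict i cp dp = (Cotensor.restrict i c d).left ≫ d.toBase dp := by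
  apply dp.isCotensor.hom_ext'
  rw [Fun.pre_comp, Fun.pre_comp, ← Category.assoc, ← Category.assoc, Cotensor.ε_pre_restrict,
    Cotensor.ε_pre_toBase, Category.assoc, Category.assoc, Cotensor.ε_pre_toBase, ← pre_overProj]
  have h := Cotensor.ε_pre_restrict i c d
  exact (Category.assoc _ _ _).symm.trans
    ((congrArg (· ≫ overProj c.obj p) h.symm).trans (Category.assoc _ _ _))

/-- Source and target are both pulled back along δ; cancelling the square of the target exhibits the
slice map as a base change. -/
lemma Cotensor.isPullback_toBase_map {E B : Over A} (p : E ⟶ B) (c : Cotensor U E)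
    (d : Cotensor U B) (cE : Cotensor U E.left) (cB : Cotensor U B.left) (cA : Cotensor U A)
    {δ : A ⟶ cA.obj} (hδ : cA.ε ≫ Fun.pre δ A = Fun.const U (𝟙 A)) :
    IsPullback (c.toBase cE) (Cotensor.map p c d).left (Cotensor.map p.left cE cB)
      (d.toBase cB) := by
  refine IsPullback.of_bot ?_ (Cotensor.toBase_map _ _ _ _ _) (d.isPullback_toBase cB cA hδ)
  have := c.isPullback_toBase cE cA hδ
  rwa [← Over.w p, ← Cotensor.map_comp _ _ _ cB, ← Over.w (Cotensor.map p c d)] at this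

variable {W : MorphismProperty C}

namespace IsInfinityCosmos

variable (hC : IsInfinityCosmos W)

include hC

lemma map_mem_over {E B : Over A} (p : E ⟶ B) (hp : W p.left) (c : Cotensor U E)
    (d : Cotensor U B) : W (Cotensor.map p c d).left := by
  obtain ⟨cE⟩ := hC.hasCotensors U E.left
  obtain ⟨cB⟩ := hC.hasCotensors U B.left
  obtain ⟨cA⟩ := hC.hasCotensors U A
  obtain ⟨δ, hδ⟩ := exists_diagonal cA
  exact hC.base_change (Cotensor.isPullback_toBase_map p c d cE cB cA hδ) (hC.map_mem _ hp _ _)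

/-- The Leibniz cotensors of a slice are base changes of Leibniz cotensors. -/
lemma leibniz_over (i : U ⟶ V) (hi : Mono i) {E B : Over A} (p : E ⟶ B) (hp : W p.left)
    (EV : Cotensor V E) (EU : Cotensor U E) (BV : Cotensor V B) (BU : Cotensor U B) {P : Over A}
    (π₁ : P ⟶ EU.obj) (π₂ : P ⟶ BV.obj)
    (hP : IsPullback π₁.left π₂.left (Cotensor.map p EU BU).left (Cotensor.restrict i BV BU).left)
    (k : EV.obj ⟶ P) (hk₁ : k ≫ π₁ = Cotensor.restrict i EV EU)
    (hk₂ : k ≫ π₂ = Cotensor.map p EV BV) : W k.left := by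
  obtain ⟨cEV⟩ := hC.hasCotensors V E.left
  obtain ⟨cEU⟩ := hC.hasCotensors U E.left
  obtain ⟨cBV⟩ := hC.hasCotensors V B.left
  obtain ⟨cBU⟩ := hC.hasCotensors U B.left
  obtain ⟨cAV⟩ := hC.hasCotensors V A
  obtain ⟨cAU⟩ := hC.hasCotensors U A
  obtain ⟨δV, hδV⟩ := exists_diagonal cAV
  obtain ⟨δU, hδU⟩ := exists_diagonal cAU
  obtain ⟨Q, ρ₁, ρ₂, hQ⟩ := hC.exists_pullback _ (hC.map_mem p.left hp cEU cBU)
    (Cotensor.restrict i cBV cBU)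
  obtain ⟨κ, hκ₁, hκ₂⟩ := hQ.isPullback.exists_lift (Cotensor.restrict i cEV cEU)
    (Cotensor.map p.left cEV cBV) (Cotensor.restrict_map _ _ _ _ _ _)
  have hκ : W κ :=
    hC.leibniz i hi p.left hp cEV cEU cBV cBU ρ₁ ρ₂ hQ.isPullback κ hκ₁ hκ₂
  have sEU := Cotensor.isPullback_toBase_map p EU BU cEU cBU cAU hδU
  -- Pasting and cancelling against Q shows that P is a base change of Q, first over BV and then
  -- along δV. Since EV is the base change of cEV along δV as well, k is the base change of κ.
  have sP := hP.paste_horiz sEU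
  rw [← Cotensor.toBase_restrict i BV BU cBV cBU] at sP
  obtain ⟨l, hl₁, hl₂⟩ := hQ.isPullback.exists_lift _ _ (sP.w.trans (Category.assoc _ _ _).symm)
  rw [← hl₁] at sP
  have sPQ := IsPullback.of_right sP hl₂ hQ.isPullback
  have sPA := sPQ.paste_vert (BV.isPullback_toBase cBV cAV hδV)
  refine hC.base_change (IsPullback.of_bot (h₁₁ := EV.toBase cEV) ?_ ?_ sPA) hκ
  · have := EV.isPullback_toBase cEV cAV hδV
    rwa [← Over.w p, ← Cotensor.map_comp _ _ _ cBV, ← hκ₂, ← Over.w k, ← Over.w π₂, Category.assoc] at this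
  · apply hQ.isPullback.hom_ext
    · rw [Category.assoc, Category.assoc, hκ₁, hl₁, Cotensor.toBase_restrict i EV EU, ← hk₁,
        Over.comp_left, Category.assoc]
    · rw [Category.assoc, Category.assoc, hκ₂, hl₂, Cotensor.toBase_map p EV BV, ← hk₂,
        Over.comp_left, Category.assoc]

/-- The product of the objects of a slice as a base change of their product. -/
lemma exists_product_over {J : Type v} (F : Discrete J ⥤ Over A) :
    ∃ (c : Cone (F ⋙ Over.forget A)) (d : Cone (F ⋙ (Functor.const (Over A)).obj A))
      (m : c.pt ⟶ d.pt) (δ : A ⟶ d.pt), Nonempty (IsLimit c) ∧ Nonempty (IsLimit d) ∧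
      IsFamLimit (fun j => (F.obj j).left) (fun u => (F.map u).left) c.π.app ∧
      IsFamLimit (fun _ : Discrete J => A) (fun _ => 𝟙 A) d.π.app ∧
      (∀ j, m ≫ d.π.app j =
        c.π.app j ≫ (Functor.whiskerLeft F (Over.forgetCocone A).ι).app j) ∧
      (∀ j, δ ≫ d.π.app j = 𝟙 A) := by
  obtain ⟨c, hc⟩ := exists_isSLimit (F ⋙ Over.forget A)
    ((hC.hasProducts.hasConicalLimitsOfShape J).hasConicalLimit _)
  obtain ⟨d, hd⟩ := exists_isSLimit (F ⋙ (Functor.const (Over A)).obj A)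
    ((hC.hasProducts.hasConicalLimitsOfShape J).hasConicalLimit _)
  have hc' : IsFamLimit (fun j => (F.obj j).left) (fun u => (F.map u).left) c.π.app :=
    hc.isFamLimit
  have hd' : IsFamLimit (fun _ : Discrete J => A) (fun _ => 𝟙 A) d.π.app := hd.isFamLimit
  obtain ⟨m, hm⟩ := hd'.exists_hom (fun j => c.π.app j ≫ (F.obj j).hom) (fun j j' u => by
    rw [← hc'.1 u]
    exact (Category.comp_id _).trans
      ((congrArg _ (Over.w (F.map u)).symm).trans (Category.assoc _ _ _).symm))
  obtain ⟨δ, hδ⟩ := hd'.exists_hom (fun j => 𝟙 A) (fun j j' u => Category.comp_id _)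
  exact ⟨c, d, m, δ, hc.nonempty_isLimit, hd.nonempty_isLimit, hc', hd', hm, hδ⟩

lemma isClosedUnderIsomorphisms_slice (A : C) :
    ObjectProperty.IsClosedUnderIsomorphisms (C := Over A) (fun p => W p.hom) where
  of_iso {p q} e hp := by
    rw [← Over.w e.inv]
    exact hC.comp_mem (hC.of_iso _ (inferInstanceAs (IsIso ((Over.forget A).map e.inv)))) hp

lemma slice_creates_terminal (F : Discrete PEmpty.{1} ⥤ Slice W A) :
    CreatesConicalLimit (fun p : Over A => W p.hom) F := by
  have := hC.isClosedUnderIsomorphisms_slice A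
  refine createsConicalLimit_of_exists ⟨overCone (Over.mk (𝟙 A)) (fun j => j.as.elim)
    (fun j => j.as.elim) (fun j => j.as.elim), fun X T s hs => ?_, hC.of_iso (𝟙 A) inferInstance⟩
  obtain ⟨l, hl⟩ := overProj_lift (p := X) (q := Over.mk (𝟙 A)) (Fun.const T X.hom)
    ((Fun.const_post _ _ _).trans (congrArg _ (Category.comp_id _)))
  refine ⟨l, fun j => j.as.elim, fun y _ => overProj_hom_ext ?_⟩
  refine Eq.trans ?_ ((overProj_elem (q := Over.mk (𝟙 A)) y).trans hl.symm)
  exact ((congrArg (_ ≫ ·) (Fun.post_id X.left A)).trans (Category.comp_id _)).symm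

/-- The structure map of the product is a base change along the diagonal of a product of
isofibrations. -/
lemma slice_creates_products {J : Type v} (F : Discrete J ⥤ Slice W A) :
    CreatesConicalLimit (fun p : Over A => W p.hom) F := by
  have := hC.isClosedUnderIsomorphisms_slice A
  obtain ⟨c, d, m, δ, ⟨hc⟩, ⟨hd⟩, hc', hd', hm, hδ⟩ := hC.exists_product_over
    (F ⋙ ObjectProperty.ι (fun p : Over A => W p.hom))
  have hWm : W m := (hC.product_stable J).condition _ _ c d hc hd _
    (fun j => (F.obj j).property) m hm
  obtain ⟨P, a, b, hP⟩ := hC.exists_pullback m hWm δ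
  obtain ⟨t, ht, hst⟩ := exists_isSLimit_over hc' hd' hm hδ (Q := Over.mk b) a hP
  exact createsConicalLimit_of_exists ⟨t, hst, by
    rw [ht]
    exact hC.base_change hP.isPullback hWm⟩

/-- The limit is formed in K; its structure map is the projection to stage 0 followed by an
isofibration. -/
lemma slice_creates_towers (F : ℕᵒᵖ ⥤ Slice W A) (hF : IsTower (sliceIsofibrations W A) F) :
    CreatesConicalLimit (fun p : Over A => W p.hom) F := by
  have := hC.isClosedUnderIsomorphisms_slice A
  obtain ⟨c, hc⟩ := exists_isSLimit (F ⋙ Slice.forget W A) (hC.hasTowerLimits (F ⋙ Slice.forget W A) hF)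
  obtain ⟨t, ht, hst⟩ := exists_isSLimit_over_of_isConnected
    (F := F ⋙ ObjectProperty.ι (fun p : Over A => W p.hom)) (π := c.π.app) hc.isFamLimit (op 0)
  refine createsConicalLimit_of_exists ⟨t, hst, ?_⟩
  rw [ht]
  exact hC.comp_mem (hC.tower_stable (F ⋙ Slice.forget W A) hF c hc.nonempty_isLimit.some 0) (F.obj (op 0)).property

lemma slice_creates_pullbacks {E B X : Slice W A} (p : E ⟶ B) (hp : sliceIsofibrations W A p)
    (f : X ⟶ B) : CreatesConicalLimit (fun p : Over A => W p.hom) (cospan p f) := by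
  have := hC.isClosedUnderIsomorphisms_slice A
  have hl : HasConicalLimit SSet.{v} (cospan p f ⋙ Slice.forget W A) := by
    have := hC.hasPullbacks ((Slice.forget W A).map p) hp ((Slice.forget W A).map f)
    exact HasConicalLimit.of_iso _ (cospanCompIso (Slice.forget W A) p f).symm
  obtain ⟨c, hc⟩ := exists_isSLimit _ hl
  obtain ⟨t, ht, hst⟩ := exists_isSLimit_over_of_isConnected
    (F := cospan p f ⋙ ObjectProperty.ι (fun p : Over A => W p.hom)) (π := c.π.app) hc.isFamLimit
    .right
  refine createsConicalLimit_of_exists ⟨t, hst, ?_⟩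
  rw [ht]
  exact hC.comp_mem (hC.base_change ((isSLimit_iff_isSPullback c).1 hc).isPullback hp) X.property

lemma slice_isPullback_left {Q E B X : Slice W A} {a : Q ⟶ E} {b : Q ⟶ X} {p : E ⟶ B} {f : X ⟶ B}
    (h : IsPullback a b p f) (hp : sliceIsofibrations W A p) :
    IsPullback a.hom.left b.hom.left p.hom.left f.hom.left :=
  ((hC.slice_creates_pullbacks p hp f).isSPullback h).isPullback.map (Over.forget A)

lemma slice_tower_isLimit {F : ℕᵒᵖ ⥤ Slice W A} (hF : IsTower (sliceIsofibrations W A) F)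
    {c : Cone F} (hc : IsLimit c) : Nonempty (IsLimit ((Slice.forget W A).mapCone c)) := by
  obtain ⟨h⟩ := ((hC.slice_creates_towers F hF).isSLimit hc).nonempty_isLimit
  exact ⟨isLimitOfPreserves (Over.forget A) h⟩

lemma slice_exists_isCotensor (U : SSet.{v}) (E : Slice W A) :
    ∃ (Q : Over A) (ε : U ⟶ Fun Q E.obj), W Q.hom ∧ IsCotensor ε := by
  obtain ⟨cE⟩ := hC.hasCotensors U E.obj.left
  obtain ⟨cA⟩ := hC.hasCotensors U A
  obtain ⟨δ, hδ⟩ := exists_diagonal cA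
  have hm := hC.map_mem E.obj.hom E.property cE cA
  obtain ⟨P, a, b, hP⟩ := hC.exists_pullback _ hm δ
  obtain ⟨ε, hε⟩ := exists_isCotensor_over cE cA hδ (Q := Over.mk b) hP
  exact ⟨_, ε, hC.base_change hP.isPullback hm, hε⟩

lemma slice_isCotensor {U : SSet.{v}} {E Q : Slice W A} {ε : U ⟶ Fun Q E} (hε : IsCotensor ε) :
    IsCotensor (C := Over A) (A := E.obj) (P := Q.obj) ε := by
  obtain ⟨R, η, hR, hη⟩ := hC.slice_exists_isCotensor U E
  exact hε.of_full_of_exists hη hR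

lemma slice_isIso_hom {T : Slice W A} (hT : IsTerminal T) : IsIso T.obj.hom := by
  obtain ⟨h⟩ := ((hC.slice_creates_terminal (Functor.empty _)).isSLimit hT).isTerminal
  have e : T.obj ≅ Over.mk (𝟙 A) := h.uniqueUpToIso Over.mkIdTerminal
  have he : T.obj.hom = e.hom.left := by
    have := Over.w e.hom
    simpa using this.symm
  rw [he]
  exact inferInstanceAs (IsIso ((Over.forget A).map e.hom))

/-- The slices of an ∞-cosmos are ∞-cosmoi. -/
theorem slice (A : C) : IsInfinityCosmos (sliceIsofibrations W A) where
  -- The function complex is a fibre of an inner fibration.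
  quasicategory p q := by
    have h := isPullback_overProj p.obj q.obj
    have : SSet.InnerFibration (toUnit (Fun p.obj q.obj)) :=
      ⟨MorphismProperty.of_isPullback h
        (hC.isofibration_post p.obj.left q.obj.hom q.property).inner.mem⟩
    exact (SSet.quasicategory_iff_of_isTerminal (toUnit (Fun p.obj q.obj))
      isTerminalTensorUnit).2 this
  isMultiplicative := by
    have := hC.isMultiplicative
    exact inferInstanceAs ((W.inverseImage (Slice.forget W A)).IsMultiplicative)
  hasTerminal := ⟨fun F => (hC.slice_creates_terminal F).hasConicalLimit⟩
  hasProducts := ⟨fun J => ⟨fun F => (hC.slice_creates_products F).hasConicalLimit⟩⟩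
  hasCotensors U E := by
    obtain ⟨R, η, hR, hη⟩ := hC.slice_exists_isCotensor U E
    exact ⟨⟨⟨R, hR⟩, η, IsCotensor.of_full (Q := ⟨R, hR⟩) hη⟩⟩
  hasTowerLimits F hF := (hC.slice_creates_towers F hF).hasConicalLimit
  hasPullbacks p hp f := (hC.slice_creates_pullbacks p hp f).hasConicalLimit
  of_iso f hf := hC.of_iso ((Slice.forget W A).map f) inferInstance
  -- The structure map of a terminal object of the slice is invertible, so f is that of p up to
  -- isomorphism.
  to_terminal {p T} hT f := by
    have := hC.slice_isIso_hom hT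
    have h : f.hom.left = p.obj.hom ≫ inv T.obj.hom := by
      rw [IsIso.eq_comp_inv, Over.w]
    change W f.hom.left
    rw [h]
    exact hC.comp_mem p.property (hC.of_iso _ inferInstance)
  pullback_stable :=
    { of_isPullback := fun sq hg => hC.base_change (hC.slice_isPullback_left sq hg) hg }
  product_stable J :=
    { condition := fun F G s t hs ht f hf φ hφ => by
        have hs' := ((hC.slice_creates_products F).isSLimit hs).nonempty_isLimit.some
        have ht' := ((hC.slice_creates_products G).isSLimit ht).nonempty_isLimit.some
        obtain ⟨c, d, m, δ, ⟨hc⟩, ⟨hd⟩, hc', hd', hm, hδ⟩ := hC.exists_product_over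
          (F ⋙ ObjectProperty.ι (fun p : Over A => W p.hom))
        obtain ⟨e, -, -, -, ⟨he⟩, -, he', -, -, -⟩ := hC.exists_product_over
          (G ⋙ ObjectProperty.ι (fun p : Over A => W p.hom))
        obtain ⟨n, hn⟩ := hd'.exists_hom (fun j => e.π.app j ≫ (G.obj j).obj.hom) (fun j j' u => by
          rw [← he'.1 u]
          exact (Category.comp_id _).trans ((congrArg _ (Over.w (G.map u).hom).symm).trans
            (Category.assoc _ _ _).symm))
        obtain ⟨a, ha⟩ := hc'.exists_hom (X := s.pt.obj.left) (fun j => (s.π.app j).hom.left)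
          (fun j j' u => congrArg (fun k => k.hom.left) (s.w u))
        obtain ⟨b, hb⟩ := he'.exists_hom (X := t.pt.obj.left) (fun j => (t.π.app j).hom.left)
          (fun j j' u => congrArg (fun k => k.hom.left) (t.w u))
        obtain ⟨ψ, hψ⟩ := he'.exists_hom (fun j => c.π.app j ≫ (f.app j).hom.left)
          (fun j j' u => by
            have h := congrArg (fun k => k.hom.left) (f.naturality u)
            exact (Category.assoc _ _ _).trans ((congrArg (c.π.app j ≫ ·) h.symm).trans
              ((Category.assoc _ _ _).symm.trans (congrArg (· ≫ (f.app j').hom.left) (hc'.1 u)))))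
        -- Here ψ is the product of the maps in K. Both slice products are pullbacks along the same
        -- δ, so φ is a base change of ψ.
        have hWψ : W ψ := (hC.product_stable J).condition _ _ c e hc he
          (Functor.whiskerRight f (Slice.forget W A)) hf ψ hψ
        have sF := isPullback_of_isLimit_over hc' hd' hm hδ hs' a ha
        have sG := isPullback_of_isLimit_over he' hd' hn hδ ht' b hb
        have hm' : m = ψ ≫ n := hd'.hom_ext' fun j =>
          (hm j).trans ((congrArg (c.π.app j ≫ ·) (Over.w (f.app j).hom).symm).trans
            ((Category.assoc _ _ _).symm.trans ((congrArg (· ≫ (G.obj j).obj.hom) (hψ j).symm).trans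
              ((Category.assoc _ _ _).trans ((congrArg (ψ ≫ ·) (hn j).symm).trans
                (Category.assoc _ _ _).symm)))))
        have hφ' : s.pt.obj.hom = φ.hom.left ≫ t.pt.obj.hom := (Over.w φ.hom).symm
        refine hC.base_change (IsPullback.of_bot (h₁₁ := a) (h₂₁ := b) ?_ ?_ sG) hWψ
        · have := sF
          rw [hm'] at this
          exact hφ' ▸ this
        · refine he'.hom_ext' fun j => ?_
          have h := congrArg (fun k => k.hom.left) (hφ j)
          exact (Category.assoc _ _ _).trans ((congrArg (a ≫ ·) (hψ j)).trans
            ((Category.assoc _ _ _).symm.trans ((congrArg (· ≫ (f.app j).hom.left) (ha j)).trans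
              (h.symm.trans ((congrArg (φ.hom.left ≫ ·) (hb j).symm).trans
                (Category.assoc _ _ _).symm))))) }
  tower_stable F hF c hc n := by
    obtain ⟨h⟩ := hC.slice_tower_isLimit hF hc
    exact hC.tower_stable (F ⋙ Slice.forget W A) hF _ h n
  leibniz {U V} i hi {E B} p hp EV EU BV BU {Q} π₁ π₂ hQ k hk₁ hk₂ := by
    have hEV := hC.slice_isCotensor EV.isCotensor
    have hEU := hC.slice_isCotensor EU.isCotensor
    have hBV := hC.slice_isCotensor BV.isCotensor
    have hBU := hC.slice_isCotensor BU.isCotensor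
    have h₁ := Cotensor.toAmbient_map p EU BU hEU hBU
    have h₂ := Cotensor.toAmbient_map p EV BV hEV hBV
    have h₃ := Cotensor.toAmbient_restrict i BV BU hBV hBU
    have h₄ := Cotensor.toAmbient_restrict i EV EU hEV hEU
    -- Only pullbacks of isofibrations are known to be computed in K, so this must precede the
    -- transfer of `hQ`.
    have hW : sliceIsofibrations W A (Cotensor.map p EU BU) := by
      change W (((ObjectProperty.ι fun p : Over A => W p.hom).map (Cotensor.map p EU BU)).left)
      rw [h₁]
      exact hC.map_mem_over p.hom hp _ _
    have hQ' : IsPullback π₁.hom.left π₂.hom.left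
      ((ObjectProperty.ι fun p : Over A => W p.hom).map (Cotensor.map p EU BU)).left
      ((ObjectProperty.ι fun p : Over A => W p.hom).map (Cotensor.restrict i BV BU)).left :=
      hC.slice_isPullback_left hQ hW
    rw [h₁, h₃] at hQ'
    refine hC.leibniz_over i hi p.hom hp (EV.toAmbient hEV) (EU.toAmbient hEU)
      (BV.toAmbient hBV) (BU.toAmbient hBU) (P := Q.obj) π₁.hom π₂.hom hQ' k.hom ?_ ?_
    · exact (congrArg (fun l => l.hom) hk₁).trans h₄
    · exact (congrArg (fun l => l.hom) hk₂).trans h₂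
  isofibration_post X {E B} p hp :=
    (hC.isofibration_post X.obj.left p.hom.left hp).of_isPullback (isPullback_post_over X.obj p.hom)

end IsInfinityCosmos

end Slice

end

/-! ### The ∞-cosmos of trivial fibrations over a fixed base -/

section

variable {C : Type u} [Category.{v} C] [SimplicialCategory C] {W : MorphismProperty C} {A : C}

namespace IsInfinityCosmos

variable (hC : IsInfinityCosmos W)

include hC

lemma isTrivialFibration_hom_of_isTerminal {T : Slice W A} (hT : IsTerminal T) :
    IsTrivialFibration W T.obj.hom := by
  have := hC.slice_isIso_hom hT
  exact hC.isTrivialFibration_of_isIso _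

/-- The structure map is a base change of the product of the given trivial fibrations. -/
lemma isTrivialFibration_hom_of_product {J : Type v} {F : Discrete J ⥤ Slice W A} {s : Cone F}
    (hs : IsLimit s) (hF : ∀ j, IsTrivialFibration W (F.obj j).obj.hom) :
    IsTrivialFibration W s.pt.obj.hom := by
  have hs' := ((hC.slice_creates_products F).isSLimit hs).nonempty_isLimit.some
  obtain ⟨c, d, m, δ, ⟨hc⟩, ⟨hd⟩, hc', hd', hm, hδ⟩ := hC.exists_product_over
    (F ⋙ ObjectProperty.ι (fun p : Over A => W p.hom))
  obtain ⟨a, ha⟩ := hc'.exists_hom (X := s.pt.obj.left) (fun j => (s.π.app j).hom.left)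
    (fun j j' u => congrArg (fun k => k.hom.left) (s.w u))
  exact hC.isTrivialFibration_base_change (isPullback_of_isLimit_over hc' hd' hm hδ hs' a ha)
    (hC.isTrivialFibration_product hc hd _ hF m hm)

/-- The structure map is a base change of the cotensor of a trivial fibration. -/
lemma isTrivialFibration_hom_of_isCotensor {U : SSet.{v}} {E Q : Slice W A} {ε : U ⟶ Fun Q E}
    (hε : IsCotensor ε) (hE : IsTrivialFibration W E.obj.hom) :
    IsTrivialFibration W Q.obj.hom := by
  obtain ⟨cE⟩ := hC.hasCotensors U E.obj.left
  obtain ⟨cA⟩ := hC.hasCotensors U A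
  obtain ⟨δ, hδ⟩ := exists_diagonal cA
  exact hC.isTrivialFibration_base_change
    (Cotensor.isPullback_toBase ⟨Q.obj, ε, hC.slice_isCotensor hε⟩ cE cA hδ)
    (hC.isTrivialFibration_map _ hE cE cA)

lemma isTrivialFibration_left {p q : Slice W A} {f : p ⟶ q} (hf : sliceIsofibrations W A f)
    (hp : IsTrivialFibration W p.obj.hom) (hq : IsTrivialFibration W q.obj.hom) :
    IsTrivialFibration W f.hom.left :=
  hC.isTrivialFibration_of_comp hf hq (by rwa [Over.w])

/-- By two out of three, the bonding maps are trivial fibrations, hence so is the projection to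
stage 0. -/
lemma isTrivialFibration_hom_of_tower {F : ℕᵒᵖ ⥤ Slice W A} {c : Cone F} (hc : IsLimit c)
    (hF : IsTower (sliceIsofibrations W A) F) (h : ∀ j, IsTrivialFibration W (F.obj j).obj.hom) :
    IsTrivialFibration W c.pt.obj.hom := by
  obtain ⟨hl⟩ := hC.slice_tower_isLimit hF hc
  have h₀ := hC.isTrivialFibration_tower (F := F ⋙ Slice.forget W A)
    (fun n => hC.isTrivialFibration_left (hF n) (h _) (h _)) hl
  have w : (c.π.app (op 0)).hom.left ≫ (F.obj (op 0)).obj.hom = c.pt.obj.hom :=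
    Over.w (c.π.app (op 0)).hom
  exact w ▸ hC.isTrivialFibration_comp h₀ (h (op 0))

lemma isTrivialFibration_hom_of_pullback {Q E B X : Slice W A} {a : Q ⟶ E} {b : Q ⟶ X} {p : E ⟶ B}
    {f : X ⟶ B} (sq : IsPullback a b p f) (hp : sliceIsofibrations W A p)
    (hE : IsTrivialFibration W E.obj.hom) (hB : IsTrivialFibration W B.obj.hom)
    (hX : IsTrivialFibration W X.obj.hom) : IsTrivialFibration W Q.obj.hom := by
  rw [← Over.w b.hom]
  exact hC.isTrivialFibration_comp (hC.isTrivialFibration_base_change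
    (hC.slice_isPullback_left sq hp) (hC.isTrivialFibration_left hp hE hB)) hX

lemma createsCosmologicalLimits_sliceTrivial (A : C) :
    CreatesCosmologicalLimits (sliceTrivial W A) (sliceIsofibrations W A) :=
  (hC.slice A).createsCosmologicalLimits
    (fun _ hT => hC.isTrivialFibration_hom_of_isTerminal hT)
    (fun _ _ _ hc hF => hC.isTrivialFibration_hom_of_product hc hF)
    (fun _ hε hE => hC.isTrivialFibration_hom_of_isCotensor hε hE)
    (fun _ _ hc hF h => hC.isTrivialFibration_hom_of_tower hc hF h)
    (fun _ _ _ _ sq hp hE hB hX => hC.isTrivialFibration_hom_of_pullback sq hp hE hB hX)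

/-- A fibre of a trivial Kan fibration is contractible. -/
lemma trivKan_toUnit_slice (X : Slice W A) {p : Slice W A} (hp : IsTrivialFibration W p.obj.hom) :
    TrivKan (toUnit (Fun X p)) :=
  .of_isPullback (isPullback_overProj X.obj p.obj) (hC.trivKan_post hp _)

/-- All functors between trivial fibrations over a fixed base are equivalences over the base. -/
lemma isEquivalence_slice {p q : Slice W A} (f : p ⟶ q) (hp : IsTrivialFibration W p.obj.hom)
    (hq : IsTrivialFibration W q.obj.hom) : IsEquivalence f := fun X =>
  -- Two out of three for a map between contractible function complexes and their maps to the point.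
  .of_comp_right ((hC.slice A).isoFibrant X q)
    (g := toUnit _) (hC.trivKan_toUnit_slice X hq).isQCatEquivalence
    (by
      rw [toUnit_unique (Fun.post X f ≫ toUnit _) (toUnit _)]
      exact (hC.trivKan_toUnit_slice X hp).isQCatEquivalence)

lemma isEquivalence_left {p q : Slice W A} (f : p ⟶ q) (hp : IsTrivialFibration W p.obj.hom)
    (hq : IsTrivialFibration W q.obj.hom) : IsEquivalence f.hom.left :=
  hC.isEquivalence_of_comp_right hq.2 (by rw [Over.w]; exact hp.2)

theorem isCreatedSubcosmos_sliceTrivial (A : C) :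
    IsCreatedSubcosmos (sliceTrivial W A) (sliceIsofibrations W A) := by
  have hl := hC.createsCosmologicalLimits_sliceTrivial A
  -- Creation of equivalences is automatic, as both sides always hold.
  have h {X Y : TrivialSlice W A} (f : X ⟶ Y) :
      IsEquivalence f ↔ IsEquivalence ((sliceTrivial W A).ι.map f) :=
    iff_of_true (fun Z => hC.isEquivalence_slice f.hom X.property Y.property Z.obj)
      (hC.isEquivalence_slice f.hom X.property Y.property)
  exact ⟨(hC.slice A).fullSubcategory hl, hl, h, fun f => and_congr Iff.rfl (h f)⟩

end IsInfinityCosmos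

end

/-! ### Function complexes of arrows -/

section

variable {C : Type u} [Category.{v} C] [SimplicialCategory C]

/-- The domain projection from function complexes of arrows. -/
def arrowFst (p q : Arrow C) : Fun p q ⟶ Fun p.left q.left := arrowFun.fst p q

/-- The codomain projection from function complexes of arrows. -/
def arrowSnd (p q : Arrow C) : Fun p q ⟶ Fun p.right q.right := arrowFun.snd p q

lemma arrow_condition (p q : Arrow C) :
    arrowFst p q ≫ Fun.post p.left q.hom = arrowSnd p q ≫ Fun.pre p.hom q.right :=
  arrowFun.condition p q

lemma arrow_hom_ext {p q : Arrow C} {T : SSet.{v}} {f g : T ⟶ Fun p q}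
    (h₁ : f ≫ arrowFst p q = g ≫ arrowFst p q) (h₂ : f ≫ arrowSnd p q = g ≫ arrowSnd p q) :
    f = g := arrowFun.hom_ext h₁ h₂

lemma arrow_lift {p q : Arrow C} {T : SSet.{v}} (f : T ⟶ Fun p.left q.left)
    (g : T ⟶ Fun p.right q.right) (h : f ≫ Fun.post p.left q.hom = g ≫ Fun.pre p.hom q.right) :
    ∃ l : T ⟶ Fun p q, l ≫ arrowFst p q = f ∧ l ≫ arrowSnd p q = g :=
  ⟨arrowFun.lift f g h, arrowFun.lift_fst f g h, arrowFun.lift_snd f g h⟩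

lemma arrow_elem {p q : Arrow C} {T : SSet.{v}} (f : T ⟶ Fun p q) :
    (f ≫ arrowFst p q) ≫ Fun.post p.left q.hom = (f ≫ arrowSnd p q) ≫ Fun.pre p.hom q.right := by
  rw [Category.assoc, arrow_condition, Category.assoc]

lemma isPullback_arrow (p q : Arrow C) :
    IsPullback (arrowFst p q) (arrowSnd p q) (Fun.post p.left q.hom) (Fun.pre p.hom q.right) :=
  IsPullback.mk' (arrow_condition p q) (fun _ _ _ h₁ h₂ => arrow_hom_ext h₁ h₂)
    (fun _ f g h => arrow_lift f g h)

lemma vertex_arrowFst {p q : Arrow C} (f : p ⟶ q) :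
    Fun.vertex f ≫ arrowFst p q = Fun.vertex f.left := arrowFun.vertex_fst f

lemma vertex_arrowSnd {p q : Arrow C} (f : p ⟶ q) :
    Fun.vertex f ≫ arrowSnd p q = Fun.vertex f.right := arrowFun.vertex_snd f

lemma comp_arrowFst {p q r : Arrow C} {S T : SSet.{v}} (a : S ⟶ Fun p q) (b : T ⟶ Fun q r) :
    Fun.comp a b ≫ arrowFst p r = Fun.comp (a ≫ arrowFst p q) (b ≫ arrowFst q r) := by
  have h := arrowFun.comp_fst p q r
  have h' : Fun.comp a b = (a ⊗ₘ b) ≫ arrowFun.comp p q r := rfl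
  rw [← Fun.precomp_comp, h']
  exact (Category.assoc _ _ _).trans (congrArg _ h)

lemma comp_arrowSnd {p q r : Arrow C} {S T : SSet.{v}} (a : S ⟶ Fun p q) (b : T ⟶ Fun q r) :
    Fun.comp a b ≫ arrowSnd p r = Fun.comp (a ≫ arrowSnd p q) (b ≫ arrowSnd q r) := by
  have h := arrowFun.comp_snd p q r
  have h' : Fun.comp a b = (a ⊗ₘ b) ≫ arrowFun.comp p q r := rfl
  rw [← Fun.precomp_comp, h']
  exact (Category.assoc _ _ _).trans (congrArg _ h)

lemma post_arrowFst (X : Arrow C) {p q : Arrow C} (f : p ⟶ q) :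
    Fun.post X f ≫ arrowFst X q = arrowFst X p ≫ Fun.post X.left f.left := by
  rw [← Category.id_comp (Fun.post X f), ← Fun.comp_vertex, Category.assoc, comp_arrowFst,
    vertex_arrowFst, Category.id_comp, Fun.comp_vertex]

lemma post_arrowSnd (X : Arrow C) {p q : Arrow C} (f : p ⟶ q) :
    Fun.post X f ≫ arrowSnd X q = arrowSnd X p ≫ Fun.post X.right f.right := by
  rw [← Category.id_comp (Fun.post X f), ← Fun.comp_vertex, Category.assoc, comp_arrowSnd,
    vertex_arrowSnd, Category.id_comp, Fun.comp_vertex]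

lemma pre_arrowFst {X p : Arrow C} (f : X ⟶ p) (q : Arrow C) :
    Fun.pre f q ≫ arrowFst X q = arrowFst p q ≫ Fun.pre f.left q.left := by
  rw [← Category.id_comp (Fun.pre f q), ← Fun.vertex_comp, Category.assoc, comp_arrowFst,
    vertex_arrowFst, Category.id_comp, Fun.vertex_comp]

lemma pre_arrowSnd {X p : Arrow C} (f : X ⟶ p) (q : Arrow C) :
    Fun.pre f q ≫ arrowSnd X q = arrowSnd p q ≫ Fun.pre f.right q.right := by
  rw [← Category.id_comp (Fun.pre f q), ← Fun.vertex_comp, Category.assoc, comp_arrowSnd,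
    vertex_arrowSnd, Category.id_comp, Fun.vertex_comp]

/-! ### Limits of arrows -/

section

variable {J : Type w} [Category J]

lemma IsFamLimit.of_iso {D : J → C} {φ : ∀ {j j' : J}, (j ⟶ j') → (D j ⟶ D j')} {L L' : C}
    {π : ∀ j, L ⟶ D j} {π' : ∀ j, L' ⟶ D j} (h : IsFamLimit D φ π) (e : L' ≅ L)
    (he : ∀ j, e.hom ≫ π j = π' j) : IsFamLimit D φ π' := by
  obtain rfl : π' = fun j => e.hom ≫ π j := funext fun j => (he j).symm
  refine ⟨fun j j' u => by rw [Category.assoc, h.1], fun X T s hs => ?_⟩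
  obtain ⟨l, hl, hu⟩ := h.2 X T s hs
  refine ⟨l ≫ Fun.post X e.inv, fun j => ?_, fun l' hl' => ?_⟩
  · rw [Category.assoc, ← Fun.post_comp, e.inv_hom_id_assoc, hl]
  · rw [← hu (l' ≫ Fun.post X e.hom) (fun j => by rw [Category.assoc, ← Fun.post_comp, hl']),
      Category.assoc, ← Fun.post_comp, e.hom_inv_id, Fun.post_id, Category.comp_id]

variable {F : J ⥤ Arrow C} {L R : C} {π : ∀ j, L ⟶ (F.obj j).left} {ρ : ∀ j, R ⟶ (F.obj j).right}

/-- The cone over a diagram of arrows with given components. -/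
def arrowCone (m : L ⟶ R) (hm : ∀ j, m ≫ ρ j = π j ≫ (F.obj j).hom)
    (hπ : ∀ ⦃j j'⦄ (u : j ⟶ j'), π j ≫ (F.map u).left = π j')
    (hρ : ∀ ⦃j j'⦄ (u : j ⟶ j'), ρ j ≫ (F.map u).right = ρ j') : Cone F where
  pt := Arrow.mk m
  π :=
    { app := fun j => Arrow.homMk (π j) (ρ j) (hm j).symm
      naturality := fun j j' u => by
        ext
        · exact (Category.id_comp _).trans (hπ u).symm
        · exact (Category.id_comp _).trans (hρ u).symm }

/-- Limits of arrows are computed on domains and codomains. -/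
lemma isSLimit_arrow {t : Cone F}
    (hπ : IsFamLimit (L := t.pt.left) (fun j => (F.obj j).left) (fun u => (F.map u).left)
      (fun j => (t.π.app j).left))
    (hρ : IsFamLimit (L := t.pt.right) (fun j => (F.obj j).right) (fun u => (F.map u).right)
      (fun j => (t.π.app j).right)) : IsSLimit t := by
  intro X T s hs
  obtain ⟨l, hl, -⟩ := hπ.2 X.left T (fun j => s j ≫ arrowFst X (F.obj j)) (fun j j' u => by
    rw [← hs u, Category.assoc, Category.assoc, post_arrowFst])
  obtain ⟨r, hr, -⟩ := hρ.2 X.right T (fun j => s j ≫ arrowSnd X (F.obj j)) (fun j j' u => by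
    rw [← hs u, Category.assoc, Category.assoc, post_arrowSnd])
  -- The two component maps form a square because this can be tested after projecting to each
  -- codomain.
  obtain ⟨y, hy₁, hy₂⟩ := arrow_lift (p := X) (q := t.pt) l r (by
    refine hρ.hom_ext fun j => ?_
    have h : t.pt.hom ≫ (t.π.app j).right = (t.π.app j).left ≫ (F.obj j).hom :=
      (Arrow.w (t.π.app j)).symm
    rw [Category.assoc, Category.assoc, ← Fun.post_comp, h, Fun.post_comp, ← Category.assoc, hl,
      arrow_elem, ← hr, Category.assoc, Fun.post_pre])
  refine ⟨y, fun j => arrow_hom_ext ?_ ?_, fun y' hy' => arrow_hom_ext ?_ ?_⟩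
  · rw [Category.assoc, post_arrowFst, reassoc_of% hy₁]
    exact hl j
  · rw [Category.assoc, post_arrowSnd, reassoc_of% hy₂]
    exact hr j
  · refine hπ.hom_ext fun j => ?_
    rw [hy₁, hl, ← hy' j, Category.assoc, Category.assoc, post_arrowFst]
  · refine hρ.hom_ext fun j => ?_
    rw [hy₂, hr, ← hy' j, Category.assoc, Category.assoc, post_arrowSnd]

lemma exists_isSLimit_arrow
    (hπ : IsFamLimit (fun j => (F.obj j).left) (fun u => (F.map u).left) π)
    (hρ : IsFamLimit (fun j => (F.obj j).right) (fun u => (F.map u).right) ρ) (m : L ⟶ R)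
    (hm : ∀ j, m ≫ ρ j = π j ≫ (F.obj j).hom) :
    ∃ t : Cone F, t.pt = Arrow.mk m ∧ IsSLimit t :=
  ⟨arrowCone m hm hπ.1 hρ.1, rfl, isSLimit_arrow (t := arrowCone m hm hπ.1 hρ.1) hπ hρ⟩

/-- If componentwise limits exist, they assemble to a limit of arrows, to which any other one is
isomorphic. -/
lemma isFamLimit_of_isSLimit_arrow
    (hπ : IsFamLimit (fun j => (F.obj j).left) (fun u => (F.map u).left) π)
    (hρ : IsFamLimit (fun j => (F.obj j).right) (fun u => (F.map u).right) ρ) {t : Cone F}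
    (ht : IsSLimit t) :
    IsFamLimit (L := t.pt.left) (fun j => (F.obj j).left) (fun u => (F.map u).left)
      (fun j => (t.π.app j).left) ∧
    IsFamLimit (L := t.pt.right) (fun j => (F.obj j).right) (fun u => (F.map u).right)
      (fun j => (t.π.app j).right) := by
  obtain ⟨m, hm⟩ := hρ.exists_hom (fun j => π j ≫ (F.obj j).hom) (fun j j' u => by
    rw [← hπ.1 u, Category.assoc, Category.assoc, Arrow.w])
  obtain ⟨e⟩ := ht.exists_iso (isSLimit_arrow (t := arrowCone m hm hπ.1 hρ.1) hπ hρ)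
  have he (j : J) : e.hom.hom ≫ (arrowCone m hm hπ.1 hρ.1).π.app j = t.π.app j := e.hom.w j
  let e' := (Cone.forget F).mapIso e
  exact ⟨hπ.of_iso (Arrow.leftFunc.mapIso e') (fun j => congrArg Arrow.Hom.left (he j)),
    hρ.of_iso (Arrow.rightFunc.mapIso e') (fun j => congrArg Arrow.Hom.right (he j))⟩

end

/-! ### Cotensors of arrows -/

section

variable {U V : SSet.{v}} {p q : Arrow C}

/-- Transposing the two components separately gives a square, since compatibility can be tested
through the universal property of the codomain. -/
lemma exists_isCotensor_arrow (c : Cotensor U p.left) (d : Cotensor U p.right) :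
    ∃ ε : U ⟶ Fun (Arrow.mk (Cotensor.map p.hom c d)) p,
      IsCotensor ε ∧ ε ≫ arrowFst _ _ = c.ε ∧ ε ≫ arrowSnd _ _ = d.ε := by
  obtain ⟨ε, hε₁, hε₂⟩ := arrow_lift (p := Arrow.mk (Cotensor.map p.hom c d)) (q := p) c.ε d.ε
    (Cotensor.ε_pre_map p.hom c d).symm
  refine ⟨ε, (isCotensor_iff ε).2 fun X T s => ?_, hε₁, hε₂⟩
  obtain ⟨l, hl, -⟩ := c.isCotensor.existsUnique (s ≫ arrowFst X p)
  obtain ⟨r, hr, -⟩ := d.isCotensor.existsUnique (s ≫ arrowSnd X p)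
  obtain ⟨y, hy₁, hy₂⟩ := arrow_lift (p := X) (q := Arrow.mk (Cotensor.map p.hom c d)) l r (by
    apply d.isCotensor.hom_ext
    refine ((Fun.comp_middle _ _ _).trans ?_).trans (Fun.comp_pre r d.ε X.hom)
    rw [hr, ← arrow_elem, ← hl, Fun.comp_post]
    exact congrArg (Fun.comp l) (Cotensor.ε_pre_map p.hom c d))
  have h₁ (y : T ⟶ Fun X (Arrow.mk (Cotensor.map p.hom c d))) :
      Fun.comp y ε ≫ arrowFst X p = Fun.comp (y ≫ arrowFst X _) c.ε := by
    rw [comp_arrowFst, hε₁]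
  have h₂ (y : T ⟶ Fun X (Arrow.mk (Cotensor.map p.hom c d))) :
      Fun.comp y ε ≫ arrowSnd X p = Fun.comp (y ≫ arrowSnd X _) d.ε := by
    rw [comp_arrowSnd, hε₂]
  refine ⟨y, arrow_hom_ext ?_ ?_, fun y' hy' => arrow_hom_ext ?_ ?_⟩
  · rw [h₁, hy₁, hl]
  · rw [h₂, hy₂, hr]
  · apply c.isCotensor.hom_ext
    rw [← h₁, hy₁, hl]
    exact congrArg (· ≫ arrowFst X p) hy'
  · apply d.isCotensor.hom_ext
    rw [← h₂, hy₂, hr]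
    exact congrArg (· ≫ arrowSnd X p) hy'

/-- Uniqueness of cotensors reduces this to the componentwise one. -/
lemma isCotensor_of_arrow (c : Cotensor U p.left) (d : Cotensor U p.right) {Q : Arrow C}
    {ε : U ⟶ Fun Q p} (hε : IsCotensor ε) :
    IsCotensor (ε ≫ arrowFst Q p) ∧ IsCotensor (ε ≫ arrowSnd Q p) := by
  obtain ⟨η, hη, h₁, h₂⟩ := exists_isCotensor_arrow c d
  obtain ⟨e, rfl⟩ := hη.exists_iso hε
  constructor
  · rw [Category.assoc, pre_arrowFst, reassoc_of% h₁]
    exact c.isCotensor.of_iso (Arrow.leftFunc.mapIso e)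
  · rw [Category.assoc, pre_arrowSnd, reassoc_of% h₂]
    exact d.isCotensor.of_iso (Arrow.rightFunc.mapIso e)

/-- The domain of a cotensor of arrows. -/
def Cotensor.left (c : Cotensor U p) (h : IsCotensor (c.ε ≫ arrowFst c.obj p)) :
    Cotensor U p.left := ⟨c.obj.left, _, h⟩

/-- The codomain of a cotensor of arrows. -/
def Cotensor.right (c : Cotensor U p) (h : IsCotensor (c.ε ≫ arrowSnd c.obj p)) :
    Cotensor U p.right := ⟨c.obj.right, _, h⟩

lemma Cotensor.map_left (f : p ⟶ q) (c : Cotensor U p) (d : Cotensor U q)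
    (hc : IsCotensor (c.ε ≫ arrowFst c.obj p)) (hd : IsCotensor (d.ε ≫ arrowFst d.obj q)) :
    (Cotensor.map f c d).left = Cotensor.map f.left (c.left hc) (d.left hd) := by
  refine hd.hom_ext' (Eq.trans ?_ (Cotensor.ε_pre_map f.left (c.left hc) (d.left hd)).symm)
  have h := congrArg (· ≫ arrowFst c.obj q) (Cotensor.ε_pre_map f c d)
  simp only [Category.assoc, pre_arrowFst, post_arrowFst] at h
  exact (Category.assoc _ _ _).trans (h.trans (Category.assoc _ _ _).symm)

lemma Cotensor.map_right (f : p ⟶ q) (c : Cotensor U p) (d : Cotensor U q)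
    (hc : IsCotensor (c.ε ≫ arrowSnd c.obj p)) (hd : IsCotensor (d.ε ≫ arrowSnd d.obj q)) :
    (Cotensor.map f c d).right = Cotensor.map f.right (c.right hc) (d.right hd) := by
  refine hd.hom_ext' (Eq.trans ?_ (Cotensor.ε_pre_map f.right (c.right hc) (d.right hd)).symm)
  have h := congrArg (· ≫ arrowSnd c.obj q) (Cotensor.ε_pre_map f c d)
  simp only [Category.assoc, pre_arrowSnd, post_arrowSnd] at h
  exact (Category.assoc _ _ _).trans (h.trans (Category.assoc _ _ _).symm)

lemma Cotensor.restrict_left (i : U ⟶ V) (c : Cotensor V p) (d : Cotensor U p)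
    (hc : IsCotensor (c.ε ≫ arrowFst c.obj p)) (hd : IsCotensor (d.ε ≫ arrowFst d.obj p)) :
    (Cotensor.restrict i c d).left = Cotensor.restrict i (c.left hc) (d.left hd) := by
  refine hd.hom_ext' (Eq.trans ?_ (Cotensor.ε_pre_restrict i (c.left hc) (d.left hd)).symm)
  have h := congrArg (· ≫ arrowFst c.obj p) (Cotensor.ε_pre_restrict i c d)
  simp only [Category.assoc, pre_arrowFst] at h
  exact (Category.assoc _ _ _).trans h

lemma Cotensor.restrict_right (i : U ⟶ V) (c : Cotensor V p) (d : Cotensor U p)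
    (hc : IsCotensor (c.ε ≫ arrowSnd c.obj p)) (hd : IsCotensor (d.ε ≫ arrowSnd d.obj p)) :
    (Cotensor.restrict i c d).right = Cotensor.restrict i (c.right hc) (d.right hd) := by
  refine hd.hom_ext' (Eq.trans ?_ (Cotensor.ε_pre_restrict i (c.right hc) (d.right hd)).symm)
  have h := congrArg (· ≫ arrowSnd c.obj p) (Cotensor.ε_pre_restrict i c d)
  simp only [Category.assoc, pre_arrowSnd] at h
  exact (Category.assoc _ _ _).trans h

/-- The structure map of a cotensor of arrows. -/
lemma Cotensor.obj_hom (c : Cotensor U p) (hl : IsCotensor (c.ε ≫ arrowFst c.obj p))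
    (hr : IsCotensor (c.ε ≫ arrowSnd c.obj p)) :
    c.obj.hom = Cotensor.map p.hom (c.left hl) (c.right hr) := by
  refine hr.hom_ext' (Eq.trans ?_ (Cotensor.ε_pre_map p.hom (c.left hl) (c.right hr)).symm)
  exact (arrow_elem c.ε).symm

end

end

/-! ### Gap maps of commutative squares -/

section

variable {C : Type u} [Category.{v} C]

/-- The squares from `p : E ⟶ A` to `q : F ⟶ B` whose gap map `E ⟶ A ×_B F` lies in `R`. -/
def gapIn (R : MorphismProperty C) : MorphismProperty (Arrow C) := fun p q s =>
  ∃ (P : C) (π₁ : P ⟶ p.right) (π₂ : P ⟶ q.left) (k : p.left ⟶ P),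
    IsPullback π₁ π₂ s.right q.hom ∧ k ≫ π₁ = p.hom ∧ k ≫ π₂ = s.left ∧ R k

variable {R : MorphismProperty C}

/-- The domain component is the gap map followed by a base change of the codomain component. -/
lemma gapIn.left_mem [R.IsMultiplicative] [R.IsStableUnderBaseChange] {p q : Arrow C} {s : p ⟶ q}
    (h : gapIn R s) (hs : R s.right) : R s.left := by
  obtain ⟨P, π₁, π₂, k, hP, -, hk, hR⟩ := h
  rw [← hk]
  exact R.comp_mem _ _ hR (R.of_isPullback hP hs)

/-- The source arrow is the gap map followed by a base change of the target arrow. This is how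
limits of arrows are seen to stay in the class. -/
lemma gapIn.hom_mem [R.IsMultiplicative] [R.IsStableUnderBaseChange] {p q : Arrow C} {s : p ⟶ q}
    (h : gapIn R s) (hq : R q.hom) : R p.hom := by
  obtain ⟨P, π₁, π₂, k, hP, hk, -, hR⟩ := h
  rw [← hk]
  exact R.comp_mem _ _ hR (R.of_isPullback hP.flip hq)

lemma gapIn_of_isIso [R.ContainsIdentities] {p q : Arrow C} (s : p ⟶ q) [IsIso s.left]
    [IsIso s.right] : gapIn R s :=
  ⟨p.left, p.hom, s.left, 𝟙 _, IsPullback.of_vert_isIso ⟨(Arrow.w s).symm⟩,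
    Category.id_comp _, Category.id_comp _, R.id_mem _⟩

/-- The gap map of the composite is that of s followed by the base change of that of t along
s.right; `h` supplies the pullback this needs. -/
lemma gapIn.comp [R.IsMultiplicative] [R.IsStableUnderBaseChange] {p q r : Arrow C} {s : p ⟶ q}
    {t : q ⟶ r} (hs : gapIn R s) (ht : gapIn R t)
    (h : ∀ {Q : C} {π₁ : Q ⟶ q.right} {π₂ : Q ⟶ r.left}, IsPullback π₁ π₂ t.right r.hom →
      ∃ (P : C) (ρ₁ : P ⟶ Q) (ρ₂ : P ⟶ p.right), IsPullback ρ₁ ρ₂ π₁ s.right) :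
    gapIn R (s ≫ t) := by
  obtain ⟨P, π₁, π₂, k, hP, hk₁, hk₂, hk⟩ := hs
  obtain ⟨P', π₁', π₂', k', hP', hk₁', hk₂', hk'⟩ := ht
  obtain ⟨Q, ρ₁, ρ₂, hQ⟩ := h hP'
  obtain ⟨κ, hκ₁, hκ₂⟩ := hQ.exists_lift (π₂ ≫ k') π₁ (by rw [Category.assoc, hk₁', hP.w])
  have hκ : IsPullback π₂ κ k' ρ₁ := by
    refine IsPullback.of_bot ?_ hκ₁.symm hQ
    rw [hκ₂, hk₁']
    exact hP.flip
  refine ⟨Q, ρ₂, ρ₁ ≫ π₂', k ≫ κ, hQ.flip.paste_vert hP', ?_, ?_, ?_⟩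
  · rw [Category.assoc, hκ₂, hk₁]
  · rw [Category.assoc, reassoc_of% hκ₁, hk₂', reassoc_of% hk₂, Arrow.comp_left]
  · exact R.comp_mem _ _ hk (R.of_isPullback hκ hk')

/-- By pasting pullbacks, the gap map of b is a base change of that of p. -/
lemma gapIn.base_change [R.IsStableUnderBaseChange] {Q E B X : Arrow C} {a : Q ⟶ E} {b : Q ⟶ X}
    {p : E ⟶ B} {f : X ⟶ B} (hl : IsPullback a.left b.left p.left f.left)
    (hr : IsPullback a.right b.right p.right f.right)
    (h : ∃ (P : C) (ρ₁ : P ⟶ X.left) (ρ₂ : P ⟶ Q.right), IsPullback ρ₁ ρ₂ X.hom b.right)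
    (hp : gapIn R p) : gapIn R b := by
  obtain ⟨P, π₁, π₂, k, hP, hk₁, hk₂, hk⟩ := hp
  obtain ⟨S, ρ₁, ρ₂, hS⟩ := h
  have h₁ := hS.flip.paste_horiz hr
  rw [← Arrow.w f] at h₁
  obtain ⟨l, hl₁, hl₂⟩ := hP.exists_lift (ρ₂ ≫ a.right) (ρ₁ ≫ f.left) (by
    rw [h₁.w, Category.assoc])
  rw [← hl₁] at h₁
  have h₂ := IsPullback.of_right h₁ hl₂ hP
  obtain ⟨κ, hκ₁, hκ₂⟩ := hS.exists_lift b.left Q.hom (Arrow.w b)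
  refine ⟨S, ρ₂, ρ₁, κ, hS.flip, hκ₂, hκ₁, R.of_isPullback (IsPullback.of_bot (h₁₁ := a.left) ?_ ?_ h₂) hk⟩
  · rw [hκ₁, hk₂]
    exact hl
  · apply hP.hom_ext
    · rw [Category.assoc, Category.assoc, hk₁, hl₁, reassoc_of% hκ₂, Arrow.w]
    · rw [Category.assoc, Category.assoc, hk₂, hl₂, reassoc_of% hκ₁, hl.w]

/-- The cone over a tower given by a compatible sequence. -/
def towerCone {G : ℕᵒᵖ ⥤ C} {X : C} (k : ∀ n : ℕ, X ⟶ G.obj (op n))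
    (hk : ∀ n : ℕ, k (n + 1) ≫ G.map (homOfLE (Nat.le_succ n)).op = k n) : Cone G where
  pt := X
  π := NatTrans.ofOpSequence k (fun n => (Category.id_comp _).trans (hk n).symm)

/-- The gap maps of the projections from the limit of a tower of squares are the projections from
the limit of a tower. -/
lemma exists_tower_gapIn [R.IsStableUnderBaseChange] {F : ℕᵒᵖ ⥤ Arrow C}
    (hF : ∀ n : ℕ, gapIn R (F.map (homOfLE (Nat.le_succ n)).op)) {t : Cone F}
    (hl : IsLimit (Arrow.leftFunc.mapCone t)) (hr : IsLimit (Arrow.rightFunc.mapCone t))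
    (h : ∀ n : ℕ, ∃ (P : C) (a : P ⟶ (F.obj (op n)).left) (b : P ⟶ t.pt.right),
      IsPullback a b (F.obj (op n)).hom (t.π.app (op n)).right) :
    ∃ (G : ℕᵒᵖ ⥤ C) (k : ∀ n : ℕ, t.pt.left ⟶ G.obj (op n))
      (hk : ∀ n : ℕ, k (n + 1) ≫ G.map (homOfLE (Nat.le_succ n)).op = k n)
      (a : ∀ n : ℕ, G.obj (op n) ⟶ (F.obj (op n)).left) (b : ∀ n : ℕ, G.obj (op n) ⟶ t.pt.right),
      Nonempty (IsLimit (towerCone k hk)) ∧ IsTower R G ∧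
      (∀ n, IsPullback (a n) (b n) (F.obj (op n)).hom (t.π.app (op n)).right) ∧
      (∀ n : ℕ, k n ≫ a n = (t.π.app (op n)).left) ∧ (∀ n : ℕ, k n ≫ b n = t.pt.hom) := by
  choose P a b hP using h
  let σ (n : ℕ) : F.obj (op (n + 1)) ⟶ F.obj (op n) := F.map (homOfLE (Nat.le_succ n)).op
  let τ (n : ℕ) : t.pt ⟶ F.obj (op n) := t.π.app (op n)
  have hσ (n : ℕ) : τ (n + 1) ≫ σ n = τ n := t.w _
  have hσl (n : ℕ) : (τ (n + 1)).left ≫ (σ n).left = (τ n).left :=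
    congrArg Arrow.Hom.left (hσ n)
  have hσr (n : ℕ) : (τ (n + 1)).right ≫ (σ n).right = (τ n).right :=
    congrArg Arrow.Hom.right (hσ n)
  replace hP (n : ℕ) : IsPullback (a n) (b n) (F.obj (op n)).hom (τ n).right := hP n
  -- The stages P n pull the n-th arrow back to the limit of the codomains. The transition map is a
  -- base change of the gap map of σ n, hence in R.
  have hg (n : ℕ) : ∃ g : P (n + 1) ⟶ P n, g ≫ a n = a (n + 1) ≫ (σ n).left ∧
      g ≫ b n = b (n + 1) ∧ R g := by
    obtain ⟨Q, π₁, π₂, k, hQ, hk₁, hk₂, hk⟩ : gapIn R (σ n) := hF n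
    obtain ⟨g, hg₁, hg₂⟩ := (hP n).exists_lift (a (n + 1) ≫ (σ n).left) (b (n + 1)) (by
      rw [Category.assoc, Arrow.w, reassoc_of% (hP (n + 1)).w, hσr])
    have h₁ := hP n
    rw [← hσr] at h₁
    obtain ⟨l, hl₁, hl₂⟩ := hQ.exists_lift (b n ≫ (τ (n + 1)).right) (a n)
      ((Category.assoc _ _ _).trans h₁.w.symm)
    rw [← hl₂] at h₁
    have h₂ := IsPullback.of_right h₁ hl₁ hQ.flip
    have h₃ := hP (n + 1)
    rw [← hg₂, ← hk₁] at h₃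
    refine ⟨g, hg₁, hg₂, R.of_isPullback (IsPullback.of_bot h₃ ?_ h₂) hk⟩
    apply hQ.hom_ext
    · rw [Category.assoc, Category.assoc, hk₁, hl₁, (hP (n + 1)).w, reassoc_of% hg₂]
    · rw [Category.assoc, Category.assoc, hk₂, hl₂, hg₁]
  choose g hg₁ hg₂ hg₃ using hg
  have hmap (n : ℕ) : (Functor.ofOpSequence g).map (homOfLE (Nat.le_succ n)).op = g n :=
    Functor.ofOpSequence_map_homOfLE_succ g n
  -- Only these equations about the tower are kept; its recursive construction is forgotten.
  obtain ⟨G, a, b, hP, hg₁, hg₂, hG⟩ : ∃ (G : ℕᵒᵖ ⥤ C)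
      (a : ∀ n : ℕ, G.obj (op n) ⟶ (F.obj (op n)).left) (b : ∀ n : ℕ, G.obj (op n) ⟶ t.pt.right),
      (∀ n, IsPullback (a n) (b n) (F.obj (op n)).hom (τ n).right) ∧
      (∀ n : ℕ, G.map (homOfLE (Nat.le_succ n)).op ≫ a n = a (n + 1) ≫ (σ n).left) ∧
      (∀ n : ℕ, G.map (homOfLE (Nat.le_succ n)).op ≫ b n = b (n + 1)) ∧ IsTower R G :=
    ⟨Functor.ofOpSequence g, a, b, hP, fun n => (congrArg (· ≫ a n) (hmap n)).trans (hg₁ n),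
      fun n => (congrArg (· ≫ b n) (hmap n)).trans (hg₂ n), fun n => (hmap n).symm ▸ hg₃ n⟩
  have hk (n : ℕ) := (hP n).exists_lift (τ n).left t.pt.hom (Arrow.w (τ n))
  choose k hk₁ hk₂ using hk
  have hkg (n : ℕ) : k (n + 1) ≫ G.map (homOfLE (Nat.le_succ n)).op = k n := by
    apply (hP n).hom_ext
    · rw [Category.assoc, hg₁, reassoc_of% hk₁, hσl, hk₁]
    · rw [Category.assoc, hg₂, hk₂, hk₂]
  refine ⟨G, k, hkg, a, b, ?_, hG, hP, hk₁, hk₂⟩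
  -- A cone over G has one common component in the limit of the codomains, so it carries no more
  -- information than a cone over the domains.
  have hsb (s : Cone G) (n : ℕ) : s.π.app (op n) ≫ b n = s.π.app (op 0) ≫ b 0 := by
    induction n with
    | zero => rfl
    | succ n ih =>
      rw [← ih, ← hg₂, ← s.w (homOfLE (Nat.le_succ n)).op, Category.assoc]
  have hlift (s : Cone G) : ∃ l : s.pt ⟶ t.pt.left, ∀ n : ℕ, l ≫ k n = s.π.app (op n) := by
    have hsa (n : ℕ) : (s.π.app (op (n + 1)) ≫ a (n + 1)) ≫ (σ n).left = s.π.app (op n) ≫ a n := by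
      rw [← s.w (homOfLE (Nat.le_succ n)).op, Category.assoc, Category.assoc, hg₁]
    obtain ⟨l, hl⟩ : ∃ l : s.pt ⟶ t.pt.left, ∀ n : ℕ, l ≫ (τ n).left = s.π.app (op n) ≫ a n :=
      ⟨hl.lift (towerCone (G := F ⋙ Arrow.leftFunc) (fun n => s.π.app (op n) ≫ a n) hsa),
        fun n => hl.fac _ (op n)⟩
    refine ⟨l, fun n => (hP n).hom_ext ?_ ?_⟩
    · rw [Category.assoc, hk₁, hl]
    · rw [Category.assoc, hk₂, hsb]
      refine hr.hom_ext fun j => ?_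
      change (l ≫ t.pt.hom) ≫ (τ j.unop).right = _ ≫ (τ j.unop).right
      rw [← hsb s j.unop, Category.assoc, Category.assoc, ← Arrow.w, reassoc_of% hl, (hP _).w]
  have huniq {X : C} (l m : X ⟶ t.pt.left) (hlm : ∀ n, l ≫ k n = m ≫ k n) : l = m := by
    refine hl.hom_ext fun j => ?_
    change l ≫ (τ j.unop).left = m ≫ (τ j.unop).left
    rw [← hk₁, reassoc_of% (hlm j.unop)]
  choose l hl' using hlift
  exact ⟨⟨l, fun s j => hl' s j.unop,
    fun s m hm => huniq m (l s) fun n => (hm (op n)).trans (hl' s n).symm⟩⟩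

end

/-! ### The ∞-cosmos of isofibrations -/

section

variable {C : Type u} [Category.{v} C] [SimplicialCategory C] {W : MorphismProperty C}

lemma isLimit_left_of_isFamLimit {J : Type w} [Category J] {F : J ⥤ Arrow C} {t : Cone F}
    (h : IsFamLimit (L := t.pt.left) (fun j => (F.obj j).left) (fun u => (F.map u).left)
      (fun j => (t.π.app j).left)) : Nonempty (IsLimit (Arrow.leftFunc.mapCone t)) :=
  IsSLimit.nonempty_isLimit (c := Arrow.leftFunc.mapCone t) h.2

lemma isLimit_right_of_isFamLimit {J : Type w} [Category J] {F : J ⥤ Arrow C} {t : Cone F}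
    (h : IsFamLimit (L := t.pt.right) (fun j => (F.obj j).right) (fun u => (F.map u).right)
      (fun j => (t.π.app j).right)) : Nonempty (IsLimit (Arrow.rightFunc.mapCone t)) :=
  IsSLimit.nonempty_isLimit (c := Arrow.rightFunc.mapCone t) h.2

/-- The inclusion of the isofibrations into all arrows creates the limit of `F`, and limits of `F`
are computed on domains and codomains. -/
structure HasArrowLimit (W : MorphismProperty C) {J : Type w} [Category J]
    (F : J ⥤ IsofibArrow W) : Prop where
  creates : CreatesConicalLimit (fun p : Arrow C => W p.hom) F
  left (c : Cone F) (hc : IsLimit c) : IsFamLimit (L := c.pt.obj.left)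
    (fun j => (F.obj j).obj.left) (fun u => (F.map u).hom.left) (fun j => (c.π.app j).hom.left)
  right (c : Cone F) (hc : IsLimit c) : IsFamLimit (L := c.pt.obj.right)
    (fun j => (F.obj j).obj.right) (fun u => (F.map u).hom.right) (fun j => (c.π.app j).hom.right)

omit [SimplicialCategory C] in
lemma exists_lift_of_product {J : Type w} {F : Discrete J ⥤ C} {c : Cone F} (hc : IsLimit c) {X : C}
    (x : ∀ j, X ⟶ F.obj j) : ∃ l : X ⟶ c.pt, ∀ j, l ≫ c.π.app j = x j :=
  ⟨hc.lift ⟨X, Discrete.natTrans x⟩, fun j => hc.fac _ j⟩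

section

variable {U V : SSet.{v}}

lemma Cotensor.ε_pre_post {A B X : C} (p : A ⟶ B) (c : Cotensor U A) (d : Cotensor U B)
    (x : X ⟶ c.obj) :
    (c.ε ≫ Fun.pre x A) ≫ Fun.post X p = d.ε ≫ Fun.pre (x ≫ Cotensor.map p c d) B := by
  rw [Fun.pre_comp, ← Category.assoc d.ε, Cotensor.ε_pre_map, Category.assoc, Category.assoc,
    Fun.post_pre]

/-- Cotensors preserve pullbacks. -/
lemma IsSPullback.cotensor {P X Y Z : C} {a : P ⟶ X} {b : P ⟶ Y} {f : X ⟶ Z} {g : Y ⟶ Z}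
    (h : IsSPullback a b f g) (cP : Cotensor U P) (cX : Cotensor U X) (cY : Cotensor U Y)
    (cZ : Cotensor U Z) :
    IsPullback (Cotensor.map a cP cX) (Cotensor.map b cP cY) (Cotensor.map f cX cZ)
      (Cotensor.map g cY cZ) := by
  refine IsPullback.mk' (by rw [Cotensor.map_comp, Cotensor.map_comp, h.w])
    (fun T x y h₁ h₂ => cP.isCotensor.hom_ext' (h.hom_ext ?_ ?_)) (fun T x y w => ?_)
  · rw [Cotensor.ε_pre_post a cP cX, Cotensor.ε_pre_post a cP cX, h₁]
  · rw [Cotensor.ε_pre_post b cP cY, Cotensor.ε_pre_post b cP cY, h₂]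
  · obtain ⟨l, ⟨hl₁, hl₂⟩, -⟩ := h.existsUnique T U (cX.ε ≫ Fun.pre x X) (cY.ε ≫ Fun.pre y Y)
      (by rw [Cotensor.ε_pre_post f cX cZ, Cotensor.ε_pre_post g cY cZ, w])
    obtain ⟨z, rfl⟩ := cP.isCotensor.exists_hom l
    refine ⟨z, cX.isCotensor.hom_ext' ?_, cY.isCotensor.hom_ext' ?_⟩
    · rw [← hl₁, Cotensor.ε_pre_post a cP cX]
    · rw [← hl₂, Cotensor.ε_pre_post b cP cY]

end

namespace IsInfinityCosmos

variable (hC : IsInfinityCosmos W)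

include hC

lemma isClosedUnderIsomorphisms_arrow :
    ObjectProperty.IsClosedUnderIsomorphisms (C := Arrow C) (fun p => W p.hom) where
  of_iso {p q} e hp := by
    have := hC.respectsIso
    exact (W.arrow_mk_iso_iff e).1 hp

/-- Given limits of the components, the only condition left is that the induced map between them is
an isofibration. -/
lemma hasArrowLimit {J : Type w} [Category J] {F : J ⥤ IsofibArrow W} {L R : C}
    {π : ∀ j, L ⟶ (F.obj j).obj.left} {ρ : ∀ j, R ⟶ (F.obj j).obj.right}
    (hπ : IsFamLimit (fun j => (F.obj j).obj.left) (fun u => (F.map u).hom.left) π)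
    (hρ : IsFamLimit (fun j => (F.obj j).obj.right) (fun u => (F.map u).hom.right) ρ)
    (hW : ∀ m : L ⟶ R, (∀ j, m ≫ ρ j = π j ≫ (F.obj j).obj.hom) → W m) : HasArrowLimit W F := by
  have := hC.isClosedUnderIsomorphisms_arrow
  obtain ⟨m, hm⟩ := hρ.exists_hom (fun j => π j ≫ (F.obj j).obj.hom) (fun j j' u => by
    rw [← hπ.1 u, Category.assoc, Category.assoc, Arrow.w])
  obtain ⟨t, ht, hst⟩ := exists_isSLimit_arrow
    (F := F ⋙ ObjectProperty.ι (fun p : Arrow C => W p.hom)) hπ hρ m hm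
  have hcr : CreatesConicalLimit (fun p : Arrow C => W p.hom) F :=
    createsConicalLimit_of_exists ⟨t, hst, by rw [ht]; exact hW m hm⟩
  exact ⟨hcr,
    fun c hc => (isFamLimit_of_isSLimit_arrow
      (F := F ⋙ ObjectProperty.ι (fun p : Arrow C => W p.hom)) hπ hρ (hcr.isSLimit hc)).1,
    fun c hc => (isFamLimit_of_isSLimit_arrow
      (F := F ⋙ ObjectProperty.ι (fun p : Arrow C => W p.hom)) hπ hρ (hcr.isSLimit hc)).2⟩

lemma hasArrowLimit_terminal (F : Discrete PEmpty.{1} ⥤ IsofibArrow W) : HasArrowLimit W F := by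
  obtain ⟨T, hT⟩ := hC.exists_terminal
  refine hC.hasArrowLimit (L := T) (R := T) (π := fun j => j.as.elim) (ρ := fun j => j.as.elim)
    ⟨fun j => j.as.elim, fun X S s _ => ?_⟩ ⟨fun j => j.as.elim, fun X S s _ => ?_⟩ fun m _ => ?_
  · obtain ⟨l, -, hu⟩ := hT X S
    exact ⟨l, fun j => j.as.elim, fun y _ => hu y trivial⟩
  · obtain ⟨l, -, hu⟩ := hT X S
    exact ⟨l, fun j => j.as.elim, fun y _ => hu y trivial⟩
  · obtain ⟨l, -, hu⟩ := hT T (𝟙_ _)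
    have : m = 𝟙 T := Fun.vertex_injective ((hu _ trivial).trans (hu _ trivial).symm)
    rw [this]
    exact hC.of_iso _ inferInstance

lemma hasArrowLimit_product {J : Type v} (F : Discrete J ⥤ IsofibArrow W) :
    HasArrowLimit W F := by
  obtain ⟨c, hc⟩ := exists_isSLimit (F ⋙ IsofibArrow.ι W ⋙ Arrow.leftFunc)
    ((hC.hasProducts.hasConicalLimitsOfShape J).hasConicalLimit _)
  obtain ⟨d, hd⟩ := exists_isSLimit (F ⋙ IsofibArrow.ι W ⋙ Arrow.rightFunc)
    ((hC.hasProducts.hasConicalLimitsOfShape J).hasConicalLimit _)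
  refine hC.hasArrowLimit (π := c.π.app) (ρ := d.π.app) hc.isFamLimit hd.isFamLimit fun m hm => ?_
  exact (hC.product_stable J).condition _ _ c d hc.nonempty_isLimit.some hd.nonempty_isLimit.some
    (Functor.whiskerLeft (F ⋙ IsofibArrow.ι W) Arrow.leftToRight) (fun j => (F.obj j).property) m hm

/-- The gap maps are themselves projections from the limit of a tower of isofibrations, so the tower
axiom of K applies. -/
lemma gapIn_tower {F : ℕᵒᵖ ⥤ Arrow C} (hF : IsTower (squaresIn W) F) (hp : ∀ j, W (F.obj j).hom)
    {t : Cone F} (hl : IsLimit (Arrow.leftFunc.mapCone t))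
    (hr : IsLimit (Arrow.rightFunc.mapCone t)) (n : ℕ) : gapIn W (t.π.app (op n)) := by
  have := hC.pullback_stable
  obtain ⟨G, k, hk, a, b, ⟨hlim⟩, hG, hP, ha, hb⟩ := exists_tower_gapIn (fun n => (hF n).2) hl hr
    (fun n => by
      obtain ⟨P, a, b, h⟩ := hC.exists_pullback _ (hp (op n)) (t.π.app (op n)).right
      exact ⟨P, a, b, h.isPullback⟩)
  exact ⟨_, b n, a n, k n, (hP n).flip, hb n, ha n, hC.tower_stable G hG _ hlim n⟩

lemma hasArrowLimit_tower (F : ℕᵒᵖ ⥤ IsofibArrow W) (hF : IsTower (arrowIsofibrations W) F) :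
    HasArrowLimit W F := by
  have := hC.isMultiplicative
  have := hC.pullback_stable
  obtain ⟨c, hc⟩ := exists_isSLimit (F ⋙ IsofibArrow.ι W ⋙ Arrow.leftFunc)
    (hC.hasTowerLimits _ fun n => gapIn.left_mem (hF n).2 (hF n).1)
  obtain ⟨d, hd⟩ := exists_isSLimit (F ⋙ IsofibArrow.ι W ⋙ Arrow.rightFunc)
    (hC.hasTowerLimits _ fun n => (hF n).1)
  refine hC.hasArrowLimit (π := c.π.app) (ρ := d.π.app) hc.isFamLimit hd.isFamLimit fun m hm => ?_
  let t : Cone (F ⋙ IsofibArrow.ι W) := arrowCone m hm (fun _ _ u => c.w u) (fun _ _ u => d.w u)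
  -- The limit arrow factors as the gap map of the projection to stage 0 followed by a base change
  -- of the arrow at stage 0.
  have h : gapIn W (t.π.app (op 0)) := hC.gapIn_tower (F := F ⋙ IsofibArrow.ι W) hF
    (fun j => (F.obj j).property) (t := t) (isLimit_left_of_isFamLimit hc.isFamLimit).some
    (isLimit_right_of_isFamLimit hd.isFamLimit).some 0
  exact h.hom_mem (F.obj (op 0)).property

lemma gapIn_base_change {R : MorphismProperty C} [R.IsStableUnderBaseChange] {Q E B X : Arrow C}
    {a : Q ⟶ E} {b : Q ⟶ X} {p : E ⟶ B} {f : X ⟶ B} (hX : W X.hom)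
    (hl : IsPullback a.left b.left p.left f.left)
    (hr : IsPullback a.right b.right p.right f.right) (hp : gapIn R p) : gapIn R b := by
  obtain ⟨P, ρ₁, ρ₂, h⟩ := hC.exists_pullback X.hom hX b.right
  exact hp.base_change hl hr ⟨P, ρ₁, ρ₂, h.isPullback⟩

lemma hasArrowLimit_pullback {E B X : IsofibArrow W} (p : E ⟶ B) (hp : arrowIsofibrations W p)
    (f : X ⟶ B) : HasArrowLimit W (cospan p f) := by
  have := hC.isMultiplicative
  have := hC.pullback_stable
  have hpl : W p.hom.left := gapIn.left_mem hp.2 hp.1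
  have hpr : W p.hom.right := hp.1
  have h₁ : HasConicalLimit SSet.{v} (cospan p f ⋙ IsofibArrow.ι W ⋙ Arrow.leftFunc) := by
    have : HasConicalPullback SSet.{v} ((IsofibArrow.ι W ⋙ Arrow.leftFunc).map p)
      ((IsofibArrow.ι W ⋙ Arrow.leftFunc).map f) := hC.hasPullbacks _ hpl f.hom.left
    exact HasConicalLimit.of_iso _
      (cospanCompIso (IsofibArrow.ι W ⋙ Arrow.leftFunc) p f).symm
  have h₂ : HasConicalLimit SSet.{v} (cospan p f ⋙ IsofibArrow.ι W ⋙ Arrow.rightFunc) := by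
    have : HasConicalPullback SSet.{v} ((IsofibArrow.ι W ⋙ Arrow.rightFunc).map p)
      ((IsofibArrow.ι W ⋙ Arrow.rightFunc).map f) := hC.hasPullbacks _ hpr f.hom.right
    exact HasConicalLimit.of_iso _
      (cospanCompIso (IsofibArrow.ι W ⋙ Arrow.rightFunc) p f).symm
  obtain ⟨c, hc⟩ := exists_isSLimit _ h₁
  obtain ⟨d, hd⟩ := exists_isSLimit _ h₂
  refine hC.hasArrowLimit (π := c.π.app) (ρ := d.π.app) hc.isFamLimit hd.isFamLimit fun m hm => ?_
  have hcp := ((isSLimit_iff_isSPullback c).1 hc).isPullback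
  have hdp := ((isSLimit_iff_isSPullback d).1 hd).isPullback
  let a : Arrow.mk m ⟶ E.obj := Arrow.homMk (c.π.app .left) (d.π.app .left) (hm .left).symm
  let b : Arrow.mk m ⟶ X.obj := Arrow.homMk (c.π.app .right) (d.π.app .right) (hm .right).symm
  -- The pulled-back arrow m is the gap map of b followed by a base change of the arrow X.
  have h : gapIn W b := hC.gapIn_base_change (a := a) (p := p.hom) (f := f.hom) X.property hcp hdp
    hp.2
  exact h.hom_mem X.property

lemma arrow_isPullback {Q E B X : IsofibArrow W} {a : Q ⟶ E} {b : Q ⟶ X} {p : E ⟶ B} {f : X ⟶ B}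
    (h : IsPullback a b p f) (hp : arrowIsofibrations W p) :
    IsPullback a.hom.left b.hom.left p.hom.left f.hom.left ∧
    IsPullback a.hom.right b.hom.right p.hom.right f.hom.right := by
  have hl := hC.hasArrowLimit_pullback p hp f
  exact
    ⟨((isSLimit_iff_isSPullback ((IsofibArrow.ι W ⋙ Arrow.leftFunc).mapCone h.cone)).1
      (hl.left _ h.isLimit).2).isPullback,
    ((isSLimit_iff_isSPullback ((IsofibArrow.ι W ⋙ Arrow.rightFunc).mapCone h.cone)).1
      (hl.right _ h.isLimit).2).isPullback⟩

lemma arrow_exists_isCotensor (U : SSet.{v}) (E : IsofibArrow W) :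
    ∃ (Q : Arrow C) (ε : U ⟶ Fun Q E.obj), W Q.hom ∧ IsCotensor ε := by
  obtain ⟨c⟩ := hC.hasCotensors U E.obj.left
  obtain ⟨d⟩ := hC.hasCotensors U E.obj.right
  obtain ⟨ε, hε, -⟩ := exists_isCotensor_arrow c d
  exact ⟨_, ε, hC.map_mem _ E.property c d, hε⟩

lemma arrow_isCotensor {U : SSet.{v}} {E Q : IsofibArrow W} {ε : U ⟶ Fun Q E}
    (hε : IsCotensor ε) : IsCotensor (C := Arrow C) (A := E.obj) (P := Q.obj) ε := by
  obtain ⟨R, η, hR, hη⟩ := hC.arrow_exists_isCotensor U E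
  exact hε.of_full_of_exists hη hR

lemma isCotensor_arrowFst {U : SSet.{v}} {E Q : Arrow C} {ε : U ⟶ Fun Q E}
    (hε : IsCotensor ε) : IsCotensor (ε ≫ arrowFst Q E) := by
  obtain ⟨c⟩ := hC.hasCotensors U E.left
  obtain ⟨d⟩ := hC.hasCotensors U E.right
  exact (isCotensor_of_arrow c d hε).1

lemma isCotensor_arrowSnd {U : SSet.{v}} {E Q : Arrow C} {ε : U ⟶ Fun Q E}
    (hε : IsCotensor ε) : IsCotensor (ε ≫ arrowSnd Q E) := by
  obtain ⟨c⟩ := hC.hasCotensors U E.left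
  obtain ⟨d⟩ := hC.hasCotensors U E.right
  exact (isCotensor_of_arrow c d hε).2

lemma arrow_terminal {T : IsofibArrow W} (hT : IsTerminal T) :
    Nonempty (IsTerminal T.obj.right) ∧ IsIso T.obj.hom := by
  have h := hC.hasArrowLimit_terminal (Functor.empty _)
  have hl := h.left _ hT
  have hr := h.right _ hT
  have h₁ (X : C) := hr.exists_hom (X := X) (fun j => j.as.elim) (fun j => j.as.elim)
  choose t _ using h₁
  have h₂ {X : C} (f g : X ⟶ T.obj.right) : f = g := hr.hom_ext' (fun j => j.as.elim)
  obtain ⟨s, -⟩ := hl.exists_hom (X := T.obj.right) (fun j => j.as.elim) (fun j => j.as.elim)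
  exact ⟨⟨IsTerminal.ofUniqueHom t (fun _ _ => h₂ _ _)⟩,
    ⟨s, hl.hom_ext' (fun j => j.as.elim), h₂ _ _⟩⟩

lemma squaresIn_comp {p q r : Arrow C} {s : p ⟶ q} {t : q ⟶ r} (hr : W r.hom)
    (hs : squaresIn W s) (ht : squaresIn W t) : squaresIn W (s ≫ t) := by
  have := hC.isMultiplicative
  have := hC.pullback_stable
  refine ⟨hC.comp_mem hs.1 ht.1, gapIn.comp hs.2 ht.2 fun {Q π₁ π₂} h => ?_⟩
  obtain ⟨P, ρ₁, ρ₂, hP⟩ := hC.exists_pullback π₁ (hC.base_change h.flip hr) s.right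
  exact ⟨P, ρ₁, ρ₂, hP.isPullback⟩

lemma squaresIn_of_isIso {p q : Arrow C} (s : p ⟶ q) [IsIso s] : squaresIn W s := by
  have := hC.isMultiplicative
  have : IsIso s.left := inferInstanceAs (IsIso (Arrow.leftFunc.map s))
  have : IsIso s.right := inferInstanceAs (IsIso (Arrow.rightFunc.map s))
  exact ⟨hC.of_iso _ inferInstance, gapIn_of_isIso s⟩

lemma isMultiplicative_arrow : (arrowIsofibrations W).IsMultiplicative where
  id_mem p := hC.squaresIn_of_isIso (𝟙 p.obj)
  comp_mem {_ _ r} _ _ hs ht := hC.squaresIn_comp r.property hs ht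

/-- A terminal arrow is invertible, so the pullback in question is the codomain of p and the gap map
is p itself. -/
lemma squaresIn_to_terminal {p T : IsofibArrow W} (hT : IsTerminal T) (f : p ⟶ T) :
    arrowIsofibrations W f := by
  obtain ⟨⟨h⟩, _⟩ := hC.arrow_terminal hT
  change squaresIn W f.hom
  refine ⟨hC.to_terminal h _, p.obj.right, 𝟙 _, f.hom.right ≫ inv T.obj.hom, p.obj.hom,
    IsPullback.of_horiz_isIso ⟨by simp⟩, Category.comp_id _, ?_, p.property⟩
  rw [← Category.assoc, IsIso.comp_inv_eq]
  exact (Arrow.w f.hom).symm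

/-- The gap map of a product of squares is the product of the gap maps. -/
lemma gapIn_product {J : Type v} {F G : Discrete J ⥤ Arrow C} {s : Cone F} {t : Cone G}
    (hsl : IsLimit (Arrow.leftFunc.mapCone s)) (hsr : IsLimit (Arrow.rightFunc.mapCone s))
    (htl : IsLimit (Arrow.leftFunc.mapCone t)) (htr : IsLimit (Arrow.rightFunc.mapCone t))
    (f : ∀ j, F.obj j ⟶ G.obj j) (hf : ∀ j, gapIn W (f j)) (φ : s.pt ⟶ t.pt)
    (hφ : ∀ j, φ ≫ t.π.app j = s.π.app j ≫ f j) : gapIn W φ := by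
  choose P π₁ π₂ k hP hk₁ hk₂ hk using hf
  obtain ⟨c, hc⟩ := exists_isSLimit (Discrete.functor fun j => P ⟨j⟩)
    ((hC.hasProducts.hasConicalLimitsOfShape J).hasConicalLimit _)
  obtain ⟨hc⟩ := hc.nonempty_isLimit
  -- From here on, the product of the pullbacks P j enters only through its universal property and
  -- the stability of isofibrations under products.
  obtain ⟨Q, pr, hQ, hW, hQ'⟩ : ∃ (Q : C) (pr : ∀ j, Q ⟶ P j),
      (∀ (X : C) (x : ∀ j, X ⟶ P j), ∃ l : X ⟶ Q, ∀ j, l ≫ pr j = x j) ∧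
      (∀ (κ : s.pt.left ⟶ Q), (∀ j, κ ≫ pr j = (s.π.app j).left ≫ k j) → W κ) ∧
      (∀ (X : C) (x y : X ⟶ Q), (∀ j, x ≫ pr j = y ≫ pr j) → x = y) :=
    ⟨c.pt, fun j => c.π.app j, fun X x => exists_lift_of_product hc x,
      fun κ hκ => (hC.product_stable J).condition _ _ (Arrow.leftFunc.mapCone s) c hsl hc
        (Discrete.natTrans fun j => k j) hk κ hκ, fun X x y h => hc.hom_ext h⟩
  let σ (j : Discrete J) : s.pt ⟶ F.obj j := s.π.app j
  let τ (j : Discrete J) : t.pt ⟶ G.obj j := t.π.app j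
  have hsr' {X : C} {x y : X ⟶ s.pt.right} (h : ∀ j, x ≫ (σ j).right = y ≫ (σ j).right) : x = y :=
    hsr.hom_ext h
  have htl' {X : C} {x y : X ⟶ t.pt.left} (h : ∀ j, x ≫ (τ j).left = y ≫ (τ j).left) : x = y :=
    htl.hom_ext h
  have htr' {X : C} {x y : X ⟶ t.pt.right} (h : ∀ j, x ≫ (τ j).right = y ≫ (τ j).right) : x = y :=
    htr.hom_ext h
  have hφl (j : Discrete J) : φ.left ≫ (τ j).left = (σ j).left ≫ (f j).left :=
    congrArg Arrow.Hom.left (hφ j)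
  have hφr (j : Discrete J) : φ.right ≫ (τ j).right = (σ j).right ≫ (f j).right :=
    congrArg Arrow.Hom.right (hφ j)
  obtain ⟨ρ₁, hρ₁⟩ : ∃ l : Q ⟶ s.pt.right, ∀ j, l ≫ (σ j).right = pr j ≫ π₁ j :=
    exists_lift_of_product hsr fun j => pr j ≫ π₁ j
  obtain ⟨ρ₂, hρ₂⟩ : ∃ l : Q ⟶ t.pt.left, ∀ j, l ≫ (τ j).left = pr j ≫ π₂ j :=
    exists_lift_of_product htl fun j => pr j ≫ π₂ j
  obtain ⟨κ, hκ⟩ := hQ s.pt.left fun j => (σ j).left ≫ k j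
  refine ⟨Q, ρ₁, ρ₂, κ, IsPullback.mk' (htr' fun j => ?_) (fun T x y h₁ h₂ => ?_)
    (fun T x y w => ?_), hsr' fun j => ?_, htl' fun j => ?_, hW κ hκ⟩
  · rw [Category.assoc, Category.assoc, hφr, reassoc_of% hρ₁, ← Arrow.w, reassoc_of% hρ₂, (hP j).w]
  · refine hQ' _ _ _ fun j => (hP j).hom_ext ?_ ?_
    · rw [Category.assoc, Category.assoc, ← hρ₁, reassoc_of% h₁]
    · rw [Category.assoc, Category.assoc, ← hρ₂, reassoc_of% h₂]
  · have h (j : Discrete J) := (hP j).exists_lift (x ≫ (σ j).right) (y ≫ (τ j).left) (by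
      rw [Category.assoc, Category.assoc, Arrow.w, ← hφr, reassoc_of% w])
    choose z hz₁ hz₂ using h
    obtain ⟨l, hl⟩ := hQ T z
    refine ⟨l, hsr' fun j => ?_, htl' fun j => ?_⟩
    · rw [Category.assoc, hρ₁, reassoc_of% (hl j), hz₁]
    · rw [Category.assoc, hρ₂, reassoc_of% (hl j), hz₂]
  · rw [Category.assoc, hρ₁, reassoc_of% (hκ j), hk₁, Arrow.w]
  · rw [Category.assoc, hρ₂, reassoc_of% (hκ j), hk₂, hφl]

/-- The map factors through M below as a base change of Fun(X.left, k), with k the gap map, followed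
by a base change of Fun(X.right, s.right). -/
lemma isQCatIsofibration_post_arrow (X : Arrow C) {p q : Arrow C} (s : p ⟶ q)
    (hq : W q.hom) (hs : squaresIn W s) : IsQCatIsofibration (Fun.post X s) := by
  obtain ⟨hr, P, π₁, π₂, k, hP, hk₁, hk₂, hk⟩ := hs
  have hP' := (hC.isSPullback hq hP.flip).flip
  let M := pullback (Fun.post X.right s.right) (arrowSnd X q)
  have hM : IsPullback (pullback.fst _ _) (pullback.snd _ _)
    (Fun.post X.right s.right) (arrowSnd X q) := IsPullback.of_hasPullback _ _
  obtain ⟨l, ⟨hl₁, hl₂⟩, -⟩ := hP'.existsUnique X.left M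
    (pullback.fst _ _ ≫ Fun.pre X.hom p.right) (pullback.snd _ _ ≫ arrowFst X q) (by
      rw [arrow_elem, ← hM.w, Category.assoc, Category.assoc, Fun.post_pre])
  obtain ⟨e, he₁, he₂⟩ := hM.exists_lift (arrowSnd X p) (Fun.post X s) (post_arrowSnd X s).symm
  -- A point of M fixes the codomain component and the composite square to q; a lift to Fun(X, p) is
  -- then exactly a lift of the induced element of Fun(X.left, P) along k.
  have hsq : IsPullback (arrowFst X p) e (Fun.post X.left k) l := by
    refine IsPullback.mk' (hP'.hom_ext ?_ ?_) (fun T f g h₁ h₂ => arrow_hom_ext h₁ ?_)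
      (fun T f g h => ?_)
    · rw [Category.assoc, Category.assoc, hl₁, reassoc_of% he₁, ← Fun.post_comp, hk₁,
        arrow_condition]
    · rw [Category.assoc, Category.assoc, hl₂, reassoc_of% he₂, ← Fun.post_comp, hk₂,
        post_arrowFst]
    · rw [← he₁, reassoc_of% h₂]
    · have h₁ := congrArg (· ≫ Fun.post X.left π₁) h
      have h₂ := congrArg (· ≫ Fun.post X.left π₂) h
      simp only [Category.assoc, hl₁, hl₂, ← Fun.post_comp, hk₁, hk₂] at h₁ h₂
      obtain ⟨y, hy₁, hy₂⟩ := arrow_lift (p := X) (q := p) f (g ≫ pullback.fst _ _)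
        (h₁.trans (Category.assoc _ _ _).symm)
      refine ⟨y, hy₁, hM.hom_ext ?_ (arrow_hom_ext ?_ ?_)⟩
      · rw [Category.assoc, he₁, hy₂]
      · rw [Category.assoc, Category.assoc, reassoc_of% he₂, post_arrowFst, reassoc_of% hy₁, h₂,
          Category.assoc]
      · rw [Category.assoc, Category.assoc, reassoc_of% he₂, post_arrowSnd, reassoc_of% hy₂, hM.w,
          Category.assoc]
  rw [← he₂]
  exact ((hC.isofibration_post X.left k hk).of_isPullback hsq).comp
    ((hC.isofibration_post X.right s.right hr).of_isPullback hM)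

/-- The codomain projection is a base change of Fun(p.left, q.hom), hence an inner fibration over a
quasi-category. -/
lemma quasicategory_arrow (p q : Arrow C) (hq : W q.hom) : SSet.Quasicategory (Fun p q) := by
  have h := (hC.isofibration_post p.left q.hom hq).of_isPullback (isPullback_arrow p q)
  have : SSet.InnerFibration (arrowSnd p q) := h.inner
  have := hC.quasicategory p.right q.right
  have h' : SSet.InnerFibration (toUnit (Fun p.right q.right)) :=
    (SSet.quasicategory_iff_of_isTerminal _ isTerminalTensorUnit).1 inferInstance
  refine (SSet.quasicategory_iff_of_isTerminal (toUnit (Fun p q)) isTerminalTensorUnit).2 ?_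
  rw [← toUnit_unique (arrowSnd p q ≫ toUnit _) (toUnit _)]
  exact ⟨MorphismProperty.comp_mem _ _ _ h.inner.mem h'.mem⟩

/-- The gap map of a square of Leibniz cotensors is a Leibniz cotensor of the gap map. -/
lemma leibniz_gap {U V : SSet.{v}} (i : U ⟶ V) (hi : Mono i) {E₁ E₀ B₁ B₀ R : C} {p₁ : E₁ ⟶ B₁}
    {p₀ : E₀ ⟶ B₀} {e : E₁ ⟶ E₀} {b : B₁ ⟶ B₀} {r₁ : R ⟶ E₀} {r₂ : R ⟶ B₁}
    (hR : IsSPullback r₁ r₂ p₀ b) {ρ : E₁ ⟶ R} (hρ₁ : ρ ≫ r₁ = e) (hρ₂ : ρ ≫ r₂ = p₁) (hρ : W ρ)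
    (E₁V : Cotensor V E₁) (E₁U : Cotensor U E₁) (E₀V : Cotensor V E₀) (E₀U : Cotensor U E₀)
    (B₁V : Cotensor V B₁) (B₁U : Cotensor U B₁) (B₀V : Cotensor V B₀) (B₀U : Cotensor U B₀)
    {Q₁ Q₀ : C} {x₁ : Q₁ ⟶ E₁U.obj} {y₁ : Q₁ ⟶ B₁V.obj} {x₀ : Q₀ ⟶ E₀U.obj} {y₀ : Q₀ ⟶ B₀V.obj}
    (h₁ : IsPullback x₁ y₁ (Cotensor.map p₁ E₁U B₁U) (Cotensor.restrict i B₁V B₁U))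
    (h₀ : IsPullback x₀ y₀ (Cotensor.map p₀ E₀U B₀U) (Cotensor.restrict i B₀V B₀U))
    {q : Q₁ ⟶ Q₀} (hq₁ : q ≫ x₀ = x₁ ≫ Cotensor.map e E₁U E₀U)
    (hq₂ : q ≫ y₀ = y₁ ≫ Cotensor.map b B₁V B₀V) {k₁ : E₁V.obj ⟶ Q₁} {k₀ : E₀V.obj ⟶ Q₀}
    (hk₁x : k₁ ≫ x₁ = Cotensor.restrict i E₁V E₁U) (hk₁y : k₁ ≫ y₁ = Cotensor.map p₁ E₁V B₁V)
    (hk₀x : k₀ ≫ x₀ = Cotensor.restrict i E₀V E₀U) (hk₀y : k₀ ≫ y₀ = Cotensor.map p₀ E₀V B₀V)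
    {S : C} {s₁ : S ⟶ E₀V.obj} {s₂ : S ⟶ Q₁} (hS : IsPullback s₁ s₂ k₀ q) {κ : E₁V.obj ⟶ S}
    (hκ₁ : κ ≫ s₁ = Cotensor.map e E₁V E₀V) (hκ₂ : κ ≫ s₂ = k₁) : W κ := by
  obtain ⟨RV⟩ := hC.hasCotensors V R
  obtain ⟨RU⟩ := hC.hasCotensors U R
  have hRV := hR.cotensor RV E₀V B₁V B₀V
  have hRU := hR.cotensor RU E₀U B₁U B₀U
  -- Because cotensors preserve the pullback R, the components of S assemble into a map u to R ^ V;
  -- with it, S is E₁ ^ U ×_{R ^ U} R ^ V and κ is the Leibniz cotensor of ρ.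
  obtain ⟨u, hu₁, hu₂⟩ := hRV.exists_lift s₁ (s₂ ≫ y₁) (by
    rw [← hk₀y, reassoc_of% hS.w, hq₂, Category.assoc])
  refine hC.leibniz i hi ρ hρ E₁V E₁U RV RU (s₂ ≫ x₁) u ?_ κ ?_ ?_
  · refine IsPullback.mk' (hRU.hom_ext ?_ ?_) (fun T a a' w₁ w₂ => ?_) (fun T a a' w => ?_)
    · rw [Category.assoc, Category.assoc, Category.assoc, Cotensor.map_comp, hρ₁,
        Cotensor.restrict_map _ _ _ _ E₀V, reassoc_of% hu₁, ← hk₀x, reassoc_of% hS.w, hq₁]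
    · rw [Category.assoc, Category.assoc, Category.assoc, Cotensor.map_comp, hρ₂,
        Cotensor.restrict_map _ _ _ _ B₁V, reassoc_of% hu₂, h₁.w]
    · refine hS.hom_ext ?_ (h₁.hom_ext ?_ ?_)
      · rw [← hu₁, reassoc_of% w₂]
      · simpa only [Category.assoc] using w₁
      · rw [Category.assoc, Category.assoc, ← hu₂, reassoc_of% w₂]
    · have wx := congrArg (· ≫ Cotensor.map r₁ RU E₀U) w
      have wy := congrArg (· ≫ Cotensor.map r₂ RU B₁U) w
      simp only [Category.assoc, Cotensor.map_comp, hρ₁, hρ₂] at wx wy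
      rw [Cotensor.restrict_map _ _ _ _ E₀V] at wx
      rw [Cotensor.restrict_map _ _ _ _ B₁V] at wy
      obtain ⟨z, hz₁, hz₂⟩ := h₁.exists_lift a (a' ≫ Cotensor.map r₂ RV B₁V)
        (wy.trans (Category.assoc _ _ _).symm)
      obtain ⟨l, hl₁, hl₂⟩ := hS.exists_lift (a' ≫ Cotensor.map r₁ RV E₀V) z (by
        apply h₀.hom_ext
        · rw [Category.assoc, Category.assoc, Category.assoc, hk₀x, hq₁, reassoc_of% hz₁, wx]
        · rw [Category.assoc, Category.assoc, Category.assoc, hk₀y, hq₂, reassoc_of% hz₂, hRV.w])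
      refine ⟨l, by rw [reassoc_of% hl₂, hz₁], hRV.hom_ext ?_ ?_⟩
      · rw [Category.assoc, hu₁, hl₁]
      · rw [Category.assoc, hu₂, reassoc_of% hl₂, hz₂]
  · rw [reassoc_of% hκ₂, hk₁x]
  · apply hRV.hom_ext
    · rw [Category.assoc, hu₁, hκ₁, Cotensor.map_comp, hρ₁]
    · rw [Category.assoc, hu₂, reassoc_of% hκ₂, hk₁y, Cotensor.map_comp, hρ₂]

/-- Cotensors preserve the pullback that defines the gap map, so the gap map of p ^ U is the
cotensor of that of p. -/
lemma map_mem_arrow {U : SSet.{v}} {E B : Arrow C} (p : E ⟶ B) (hB : W B.hom)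
    (hp : squaresIn W p) (c : Cotensor U E) (d : Cotensor U B) :
    squaresIn W (Cotensor.map p c d) := by
  have hcl := hC.isCotensor_arrowFst c.isCotensor
  have hcr := hC.isCotensor_arrowSnd c.isCotensor
  have hdl := hC.isCotensor_arrowFst d.isCotensor
  have hdr := hC.isCotensor_arrowSnd d.isCotensor
  obtain ⟨hpr, R, r₁, r₂, ρ, hR, hρ₁, hρ₂, hρ⟩ := hp
  obtain ⟨cR⟩ := hC.hasCotensors U R
  have hcR := (hC.isSPullback hB hR.flip).flip.cotensor cR (c.right hcr) (d.left hdl) (d.right hdr)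
  rw [← Cotensor.map_right p c d hcr hdr, ← d.obj_hom hdl hdr] at hcR
  refine ⟨?_, cR.obj, _, _, Cotensor.map ρ (c.left hcl) cR, hcR, ?_, ?_, hC.map_mem ρ hρ _ _⟩
  · rw [Cotensor.map_right p c d hcr hdr]
    exact hC.map_mem _ hpr _ _
  · rw [c.obj_hom hcl hcr, ← hρ₁]
    exact Cotensor.map_comp _ _ _ _ _
  · rw [Cotensor.map_left p c d hcl hdl, ← hρ₂]
    exact Cotensor.map_comp _ _ _ _ _

/-- The codomain component is a Leibniz cotensor in K of p.right; `leibniz_gap` identifies the gap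
map with the one of the gap map of p. -/
lemma leibniz_arrow {U V : SSet.{v}} (i : U ⟶ V) (hi : Mono i) {E B : Arrow C} (p : E ⟶ B)
    (hB : W B.hom) (hp : squaresIn W p) (EV : Cotensor V E) (EU : Cotensor U E)
    (BV : Cotensor V B) (BU : Cotensor U B) {P : Arrow C} (hP : W P.hom) (π₁ : P ⟶ EU.obj)
    (π₂ : P ⟶ BV.obj)
    (hl : IsPullback π₁.left π₂.left (Cotensor.map p EU BU).left
      (Cotensor.restrict i BV BU).left)
    (hr : IsPullback π₁.right π₂.right (Cotensor.map p EU BU).right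
      (Cotensor.restrict i BV BU).right)
    (k : EV.obj ⟶ P) (hk₁ : k ≫ π₁ = Cotensor.restrict i EV EU)
    (hk₂ : k ≫ π₂ = Cotensor.map p EV BV) : squaresIn W k := by
  have hEVl := hC.isCotensor_arrowFst EV.isCotensor
  have hEVr := hC.isCotensor_arrowSnd EV.isCotensor
  have hEUl := hC.isCotensor_arrowFst EU.isCotensor
  have hEUr := hC.isCotensor_arrowSnd EU.isCotensor
  have hBVl := hC.isCotensor_arrowFst BV.isCotensor
  have hBVr := hC.isCotensor_arrowSnd BV.isCotensor
  have hBUl := hC.isCotensor_arrowFst BU.isCotensor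
  have hBUr := hC.isCotensor_arrowSnd BU.isCotensor
  rw [Cotensor.map_left p EU BU hEUl hBUl, Cotensor.restrict_left i BV BU hBVl hBUl] at hl
  rw [Cotensor.map_right p EU BU hEUr hBUr, Cotensor.restrict_right i BV BU hBVr hBUr] at hr
  have hk₁l : k.left ≫ π₁.left = _ :=
    (congrArg Arrow.Hom.left hk₁).trans (Cotensor.restrict_left i EV EU hEVl hEUl)
  have hk₂l : k.left ≫ π₂.left = _ :=
    (congrArg Arrow.Hom.left hk₂).trans (Cotensor.map_left p EV BV hEVl hBVl)
  have hk₁r : k.right ≫ π₁.right = _ :=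
    (congrArg Arrow.Hom.right hk₁).trans (Cotensor.restrict_right i EV EU hEVr hEUr)
  have hk₂r : k.right ≫ π₂.right = _ :=
    (congrArg Arrow.Hom.right hk₂).trans (Cotensor.map_right p EV BV hEVr hBVr)
  obtain ⟨hpr, R, r₁, r₂, ρ, hR, hρ₁, hρ₂, hρ⟩ := hp
  obtain ⟨S, s₂, s₁, hS⟩ := hC.exists_pullback P.hom hP k.right
  obtain ⟨κ, hκ₂, hκ₁⟩ := hS.isPullback.exists_lift k.left EV.obj.hom (Arrow.w k)
  refine ⟨hC.leibniz i hi p.right hpr (EV.right hEVr) (EU.right hEUr) (BV.right hBVr)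
    (BU.right hBUr) _ _ hr k.right hk₁r hk₂r, S, s₁, s₂, κ, hS.isPullback.flip, hκ₁, hκ₂, ?_⟩
  exact hC.leibniz_gap i hi (hC.isSPullback hB hR.flip).flip hρ₁ hρ₂ hρ (EV.left hEVl)
    (EU.left hEUl) (EV.right hEVr) (EU.right hEUr) (BV.left hBVl) (BU.left hBUl) (BV.right hBVr)
    (BU.right hBUr) hl hr
    ((Arrow.w π₁).symm.trans (congrArg (π₁.left ≫ ·) (EU.obj_hom hEUl hEUr)))
    ((Arrow.w π₂).symm.trans (congrArg (π₂.left ≫ ·) (BV.obj_hom hBVl hBVr)))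
    hk₁l hk₂l hk₁r hk₂r hS.isPullback.flip (hκ₁.trans (EV.obj_hom hEVl hEVr)) hκ₂

/-- The isofibrations of an ∞-cosmos form an ∞-cosmos. -/
theorem arrow : IsInfinityCosmos (arrowIsofibrations W) where
  quasicategory p q := hC.quasicategory_arrow p.obj q.obj q.property
  isMultiplicative := hC.isMultiplicative_arrow
  hasTerminal := ⟨fun F => (hC.hasArrowLimit_terminal F).creates.hasConicalLimit⟩
  hasProducts := ⟨fun J => ⟨fun F => (hC.hasArrowLimit_product F).creates.hasConicalLimit⟩⟩
  hasCotensors U E := by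
    obtain ⟨R, η, hR, hη⟩ := hC.arrow_exists_isCotensor U E
    exact ⟨⟨⟨R, hR⟩, η, IsCotensor.of_full (Q := ⟨R, hR⟩) hη⟩⟩
  hasTowerLimits F hF := (hC.hasArrowLimit_tower F hF).creates.hasConicalLimit
  hasPullbacks p hp f := (hC.hasArrowLimit_pullback p hp f).creates.hasConicalLimit
  of_iso f hf := hC.squaresIn_of_isIso ((IsofibArrow.ι W).map f)
  to_terminal hT f := hC.squaresIn_to_terminal hT f
  pullback_stable :=
    { of_isPullback := fun {X _ _ _ _ _ _ _} sq hg => by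
        have := hC.pullback_stable
        obtain ⟨hl, hr⟩ := hC.arrow_isPullback sq hg
        exact ⟨hC.base_change hr hg.1, hC.gapIn_base_change X.property hl hr hg.2⟩ }
  product_stable J :=
    { condition := fun F G s t hs ht f hf φ hφ => by
        have hF := hC.hasArrowLimit_product F
        have hG := hC.hasArrowLimit_product G
        obtain ⟨hsr⟩ := isLimit_right_of_isFamLimit (t := (IsofibArrow.ι W).mapCone s)
          (hF.right s hs)
        obtain ⟨htr⟩ := isLimit_right_of_isFamLimit (t := (IsofibArrow.ι W).mapCone t)
          (hG.right t ht)
        obtain ⟨hsl⟩ := isLimit_left_of_isFamLimit (t := (IsofibArrow.ι W).mapCone s)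
          (hF.left s hs)
        obtain ⟨htl⟩ := isLimit_left_of_isFamLimit (t := (IsofibArrow.ι W).mapCone t)
          (hG.left t ht)
        refine ⟨(hC.product_stable J).condition _ _ _ _ hsr htr
          (Functor.whiskerRight f (IsofibArrow.ι W ⋙ Arrow.rightFunc)) (fun j => (hf j).1)
          φ.hom.right (fun j => congrArg (fun l => l.hom.right) (hφ j)),
          hC.gapIn_product hsl hsr htl htr (fun j => (f.app j).hom) (fun j => (hf j).2) φ.hom
            (fun j => congrArg (fun l => l.hom) (hφ j))⟩ }
  tower_stable F hF c hc n := by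
    have hl := hC.hasArrowLimit_tower F hF
    obtain ⟨hcr⟩ := isLimit_right_of_isFamLimit (t := (IsofibArrow.ι W).mapCone c)
      (hl.right c hc)
    obtain ⟨hcl⟩ := isLimit_left_of_isFamLimit (t := (IsofibArrow.ι W).mapCone c)
      (hl.left c hc)
    exact ⟨hC.tower_stable (F ⋙ IsofibArrow.ι W ⋙ Arrow.rightFunc) (fun n => (hF n).1) _ hcr n,
      hC.gapIn_tower (F := F ⋙ IsofibArrow.ι W) hF (fun j => (F.obj j).property) hcl hcr n⟩
  leibniz {U V} i hi {E B} p hp EV EU BV BU {Q} π₁ π₂ hQ k hk₁ hk₂ := by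
    have hEV := hC.arrow_isCotensor EV.isCotensor
    have hEU := hC.arrow_isCotensor EU.isCotensor
    have hBV := hC.arrow_isCotensor BV.isCotensor
    have hBU := hC.arrow_isCotensor BU.isCotensor
    have h₁ := Cotensor.toAmbient_map p EU BU hEU hBU
    have h₂ := Cotensor.toAmbient_map p EV BV hEV hBV
    have h₃ := Cotensor.toAmbient_restrict i BV BU hBV hBU
    have h₄ := Cotensor.toAmbient_restrict i EV EU hEV hEU
    have hW : arrowIsofibrations W (Cotensor.map p EU BU) := by
      change squaresIn W ((ObjectProperty.ι fun p : Arrow C => W p.hom).map (Cotensor.map p EU BU))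
      rw [h₁]
      exact hC.map_mem_arrow p.hom B.property hp _ _
    obtain ⟨hl, hr⟩ : IsPullback π₁.hom.left π₂.hom.left
        ((ObjectProperty.ι fun p : Arrow C => W p.hom).map (Cotensor.map p EU BU)).left
        ((ObjectProperty.ι fun p : Arrow C => W p.hom).map (Cotensor.restrict i BV BU)).left ∧
      IsPullback π₁.hom.right π₂.hom.right
        ((ObjectProperty.ι fun p : Arrow C => W p.hom).map (Cotensor.map p EU BU)).right
        ((ObjectProperty.ι fun p : Arrow C => W p.hom).map (Cotensor.restrict i BV BU)).right :=
      hC.arrow_isPullback hQ hW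
    rw [h₁, h₃] at hl hr
    exact hC.leibniz_arrow i hi p.hom B.property hp (EV.toAmbient hEV) (EU.toAmbient hEU)
      (BV.toAmbient hBV) (BU.toAmbient hBU) (P := Q.obj) Q.property π₁.hom π₂.hom hl hr k.hom
      ((congrArg (fun l => l.hom) hk₁).trans h₄) ((congrArg (fun l => l.hom) hk₂).trans h₂)
  isofibration_post X {E B} p hp :=
    hC.isQCatIsofibration_post_arrow X.obj p.hom B.property hp

end IsInfinityCosmos

end

/-! ### The ∞-cosmos of trivial fibrations with varying base -/

section

variable {C : Type u} [Category.{v} C] [SimplicialCategory C] {W : MorphismProperty C}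

namespace IsInfinityCosmos

variable (hC : IsInfinityCosmos W)

include hC

lemma isMultiplicative_trivialFibrations : (trivialFibrations W).IsMultiplicative where
  id_mem X := hC.isTrivialFibration_of_isIso (𝟙 X)
  comp_mem _ _ hf hg := hC.isTrivialFibration_comp hf hg

lemma isStableUnderBaseChange_trivialFibrations :
    (trivialFibrations W).IsStableUnderBaseChange where
  of_isPullback sq hg := hC.isTrivialFibration_base_change sq hg

/-- The gap map followed by a base change of q.hom is p.hom, so two out of three applies. Thereby
the closure arguments for isofibrations also serve for trivial fibrations. -/
lemma gapIn_trivialFibrations {p q : Arrow C} {s : p ⟶ q} (hs : gapIn W s)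
    (hp : IsTrivialFibration W p.hom) (hq : IsTrivialFibration W q.hom) :
    gapIn (trivialFibrations W) s := by
  obtain ⟨P, π₁, π₂, k, hP, hk₁, hk₂, hk⟩ := hs
  exact ⟨P, π₁, π₂, k, hP, hk₁, hk₂, hC.isTrivialFibration_of_comp hk
    (hC.isTrivialFibration_base_change hP.flip hq) (by rwa [hk₁])⟩

lemma isTrivialFibration_hom_of_isTerminal_arrow {T : IsofibArrow W} (hT : IsTerminal T) :
    IsTrivialFibration W T.obj.hom := by
  obtain ⟨-, _⟩ := hC.arrow_terminal hT
  exact hC.isTrivialFibration_of_isIso _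

lemma isTrivialFibration_hom_of_product_arrow {J : Type v} {F : Discrete J ⥤ IsofibArrow W}
    {s : Cone F} (hs : IsLimit s) (hF : ∀ j, IsTrivialFibration W (F.obj j).obj.hom) :
    IsTrivialFibration W s.pt.obj.hom := by
  have h := hC.hasArrowLimit_product F
  obtain ⟨hl⟩ := isLimit_left_of_isFamLimit (t := (IsofibArrow.ι W).mapCone s) (h.left s hs)
  obtain ⟨hr⟩ := isLimit_right_of_isFamLimit (t := (IsofibArrow.ι W).mapCone s) (h.right s hs)
  exact hC.isTrivialFibration_product hl hr
    (Functor.whiskerLeft (F ⋙ IsofibArrow.ι W) Arrow.leftToRight) hF s.pt.obj.hom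
    (fun j => (Arrow.w (s.π.app j).hom).symm)

lemma isTrivialFibration_hom_of_isCotensor_arrow {U : SSet.{v}} {E Q : IsofibArrow W}
    {ε : U ⟶ Fun Q E} (hε : IsCotensor ε) (hE : IsTrivialFibration W E.obj.hom) :
    IsTrivialFibration W Q.obj.hom := by
  let c : Cotensor U E.obj := ⟨Q.obj, ε, hC.arrow_isCotensor hε⟩
  have hl := hC.isCotensor_arrowFst c.isCotensor
  have hr := hC.isCotensor_arrowSnd c.isCotensor
  have h := hC.isTrivialFibration_map _ hE (c.left hl) (c.right hr)
  rwa [← c.obj_hom hl hr] at h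

/-- The limit arrow is the projection of a tower of trivial fibrations to its stage 0, followed by a
base change of the arrow F 0. -/
lemma isTrivialFibration_hom_of_tower_arrow {F : ℕᵒᵖ ⥤ IsofibArrow W} {c : Cone F}
    (hc : IsLimit c) (hF : IsTower (arrowIsofibrations W) F)
    (h : ∀ j, IsTrivialFibration W (F.obj j).obj.hom) : IsTrivialFibration W c.pt.obj.hom := by
  have := hC.isMultiplicative_trivialFibrations
  have := hC.isStableUnderBaseChange_trivialFibrations
  have hl := hC.hasArrowLimit_tower F hF
  obtain ⟨hcl⟩ := isLimit_left_of_isFamLimit (t := (IsofibArrow.ι W).mapCone c) (hl.left c hc)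
  obtain ⟨hcr⟩ := isLimit_right_of_isFamLimit (t := (IsofibArrow.ι W).mapCone c) (hl.right c hc)
  obtain ⟨G, k, hk, a, b, ⟨hlim⟩, hG, hP, -, hb⟩ := exists_tower_gapIn
    (R := trivialFibrations W) (F := F ⋙ IsofibArrow.ι W)
    (fun n => hC.gapIn_trivialFibrations (hF n).2 (h _) (h _)) hcl hcr (fun n => by
      obtain ⟨P, a, b, h⟩ := hC.exists_pullback _ (F.obj (op n)).property
        (c.π.app (op n)).hom.right
      exact ⟨P, a, b, h.isPullback⟩)
  have h₀ : k 0 ≫ b 0 = c.pt.obj.hom := hb 0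
  rw [← h₀]
  exact hC.isTrivialFibration_comp (hC.isTrivialFibration_tower hG hlim)
    (hC.isTrivialFibration_base_change (hP 0) (h _))

/-- The gap map of b is a base change of a trivial fibration, and composing it with a base change of
X gives Q. -/
lemma isTrivialFibration_hom_of_pullback_arrow {Q E B X : IsofibArrow W} {a : Q ⟶ E} {b : Q ⟶ X}
    {p : E ⟶ B} {f : X ⟶ B} (sq : IsPullback a b p f) (hp : arrowIsofibrations W p)
    (hE : IsTrivialFibration W E.obj.hom) (hB : IsTrivialFibration W B.obj.hom)
    (hX : IsTrivialFibration W X.obj.hom) : IsTrivialFibration W Q.obj.hom := by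
  have := hC.isMultiplicative_trivialFibrations
  have := hC.isStableUnderBaseChange_trivialFibrations
  obtain ⟨hl, hr⟩ := hC.arrow_isPullback sq hp
  exact (hC.gapIn_base_change X.property hl hr
    (hC.gapIn_trivialFibrations hp.2 hE hB)).hom_mem hX

lemma createsCosmologicalLimits_arrowTrivial :
    CreatesCosmologicalLimits (arrowTrivial W) (arrowIsofibrations W) :=
  hC.arrow.createsCosmologicalLimits
    (fun _ hT => hC.isTrivialFibration_hom_of_isTerminal_arrow hT)
    (fun _ _ _ hc hF => hC.isTrivialFibration_hom_of_product_arrow hc hF)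
    (fun _ hε hE => hC.isTrivialFibration_hom_of_isCotensor_arrow hε hE)
    (fun _ _ hc hF h => hC.isTrivialFibration_hom_of_tower_arrow hc hF h)
    (fun _ _ _ _ sq hp hE hB hX => hC.isTrivialFibration_hom_of_pullback_arrow sq hp hE hB hX)

lemma trivKan_arrowSnd (X : Arrow C) {p : Arrow C} (hp : IsTrivialFibration W p.hom) :
    TrivKan (arrowSnd X p) :=
  .of_isPullback (isPullback_arrow X p) (hC.trivKan_post hp _)

/-- Both codomain projections are trivial Kan fibrations, so two out of three moves the question to
codomains. -/
lemma isQCatEquivalence_post_arrow_iff (X : IsofibArrow W) {p q : IsofibArrow W} (s : p ⟶ q)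
    (hp : IsTrivialFibration W p.obj.hom) (hq : IsTrivialFibration W q.obj.hom) :
    IsQCatEquivalence (Fun.post X s) ↔
      IsQCatEquivalence (Fun.post X.obj.right s.hom.right) :=
  ⟨fun h => .of_square' (hC.trivKan_arrowSnd X.obj hp) (hC.trivKan_arrowSnd X.obj hq)
      (post_arrowSnd X.obj s.hom) (hC.arrow.isoFibrant X p) (hC.isoFibrant _ _)
      (hC.isoFibrant _ _) h,
    fun h => .of_square (hC.trivKan_arrowSnd X.obj hp) (hC.trivKan_arrowSnd X.obj hq)
      (post_arrowSnd X.obj s.hom) (hC.arrow.isoFibrant X p) (hC.arrow.isoFibrant X q)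
      (hC.isoFibrant _ _) h⟩

/-- The identity of an object, as a trivial fibration. -/
lemma arrowTrivial_id (Y : C) : ∃ p : TrivialArrow W, p.obj.obj = Arrow.mk (𝟙 Y) := by
  have h := hC.isTrivialFibration_of_isIso (𝟙 Y)
  exact ⟨⟨⟨Arrow.mk (𝟙 Y), h.1⟩, h⟩, rfl⟩

/-- Every object Y is the codomain of the trivial fibration 𝟙 Y, so trivial fibrations suffice as
test objects. Hence equivalences in the subcategory and in K^𝟚 agree. -/
lemma isEquivalence_right_of_arrow {p q : IsofibArrow W} (s : p ⟶ q)
    (hp : IsTrivialFibration W p.obj.hom) (hq : IsTrivialFibration W q.obj.hom)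
    (h : ∀ X : TrivialArrow W, IsQCatEquivalence (Fun.post X.obj s)) :
    IsEquivalence s.hom.right := fun Y => by
  obtain ⟨X, hX⟩ := hC.arrowTrivial_id Y
  have h := (hC.isQCatEquivalence_post_arrow_iff X.obj s hp hq).1 (h X)
  rwa [hX] at h

lemma isEquivalence_arrow_iff {p q : IsofibArrow W} (s : p ⟶ q)
    (hp : IsTrivialFibration W p.obj.hom) (hq : IsTrivialFibration W q.obj.hom) :
    IsEquivalence s ↔ IsEquivalence s.hom.right :=
  ⟨fun h => hC.isEquivalence_right_of_arrow s hp hq fun X => h X.obj,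
    fun h X => (hC.isQCatEquivalence_post_arrow_iff X s hp hq).2 (h _)⟩

lemma isEquivalence_trivialArrow_iff {p q : TrivialArrow W} (s : p ⟶ q) :
    IsEquivalence s ↔ IsEquivalence s.hom.hom.right :=
  ⟨fun h => hC.isEquivalence_right_of_arrow s.hom p.property q.property h,
    fun h X => (hC.isQCatEquivalence_post_arrow_iff X.obj s.hom p.property q.property).2 (h _)⟩

/-- Two out of three around the square, whose other two sides are equivalences. -/
lemma isEquivalence_left_iff {p q : Arrow C} (s : p ⟶ q) (hp : IsTrivialFibration W p.hom)
    (hq : IsTrivialFibration W q.hom) : IsEquivalence s.left ↔ IsEquivalence s.right := by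
  constructor
  · intro h
    have := hC.isEquivalence_comp h hq.2
    rw [Arrow.w] at this
    exact hC.isEquivalence_of_comp_left hp.2 this
  · intro h
    have := hC.isEquivalence_comp hp.2 h
    rw [← Arrow.w] at this
    exact hC.isEquivalence_of_comp_right hq.2 this

theorem isCreatedSubcosmos_arrowTrivial :
    IsCreatedSubcosmos (arrowTrivial W) (arrowIsofibrations W) := by
  have hl := hC.createsCosmologicalLimits_arrowTrivial
  have h {X Y : TrivialArrow W} (f : X ⟶ Y) :
      IsEquivalence f ↔ IsEquivalence ((arrowTrivial W).ι.map f) :=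
    (hC.isEquivalence_trivialArrow_iff f).trans
      (hC.isEquivalence_arrow_iff f.hom X.property Y.property).symm
  exact ⟨hC.arrow.fullSubcategory hl, hl, h, fun f => and_congr Iff.rfl (h f)⟩

/-- Being an equivalence only concerns the codomain component, while triviality of the gap map is
automatic once it is an isofibration. -/
lemma isTrivialFibration_trivialArrow_iff {p q : TrivialArrow W} (s : p ⟶ q) :
    IsTrivialFibration ((arrowIsofibrations W).inverseImage (arrowTrivial W).ι) s ↔
      squaresIn (trivialFibrations W) s.hom.hom := by
  constructor
  · rintro ⟨hs, he⟩
    exact ⟨⟨hs.1, (hC.isEquivalence_trivialArrow_iff s).1 he⟩,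
      hC.gapIn_trivialFibrations hs.2 p.property q.property⟩
  · rintro ⟨hs, P, π₁, π₂, k, hP, hk₁, hk₂, hk⟩
    exact ⟨⟨hs.1, P, π₁, π₂, k, hP, hk₁, hk₂, hk.1⟩,
      (hC.isEquivalence_trivialArrow_iff s).2 hs.2⟩

end IsInfinityCosmos

end

end

end InfCosmos

/-! ### The proposition -/

theorem mainTheorem12 {K : Type u} [Category.{v} K] [SimplicialCategory K]
    (W : MorphismProperty K) (hK : InfCosmos.IsInfinityCosmos W) :
    (∀ A : K,
      InfCosmos.IsCreatedSubcosmos (InfCosmos.sliceTrivial W A) (InfCosmos.sliceIsofibrations W A) ∧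
      ∀ {p q : InfCosmos.TrivialSlice W A} (f : p ⟶ q),
        InfCosmos.IsEquivalence f ∧
        InfCosmos.IsEquivalence
          ((InfCosmos.Slice.forget W A).map ((InfCosmos.sliceTrivial W A).ι.map f))) ∧
    InfCosmos.IsCreatedSubcosmos (InfCosmos.arrowTrivial W) (InfCosmos.arrowIsofibrations W) ∧
    ∀ {p q : InfCosmos.TrivialArrow W} (s : p ⟶ q),
      (InfCosmos.IsEquivalence s ↔
        InfCosmos.IsEquivalence
          ((InfCosmos.IsofibArrow.ι W).map ((InfCosmos.arrowTrivial W).ι.map s)).left ∧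
        InfCosmos.IsEquivalence
          ((InfCosmos.IsofibArrow.ι W).map ((InfCosmos.arrowTrivial W).ι.map s)).right) ∧
      (InfCosmos.IsTrivialFibration
          ((InfCosmos.arrowIsofibrations W).inverseImage (InfCosmos.arrowTrivial W).ι) s ↔
        InfCosmos.squaresIn (InfCosmos.trivialFibrations W)
          ((InfCosmos.IsofibArrow.ι W).map ((InfCosmos.arrowTrivial W).ι.map s))) := by
  exact ⟨fun A => ⟨hK.isCreatedSubcosmos_sliceTrivial A, fun {p q} f =>
      ⟨fun X => hK.isEquivalence_slice f.hom p.property q.property X.obj,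
        hK.isEquivalence_left f.hom p.property q.property⟩⟩,
    hK.isCreatedSubcosmos_arrowTrivial, fun {p q} s =>
      ⟨(hK.isEquivalence_trivialArrow_iff s).trans
        ⟨fun h => ⟨(hK.isEquivalence_left_iff s.hom.hom p.property q.property).2 h, h⟩, And.right⟩,
        hK.isTrivialFibration_trivialArrow_iff s⟩⟩
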